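/- **Setting.** Let $\alpha\in(0,1)$, $b\ge 0$, $c>0$, and put $\Phi(l)=bl+cl^{1+\alpha}$ and $\nu_\alpha(dy)=\frac{c\alpha(\alpha+1)}{\Gamma(1-\alpha)}y^{-\alpha-2}dy$ on $(0,\infty)$. Let $W$ be the scale function: $W=0$ on $(-\infty,0)$, $W$ is continuous and strictly increasing on $[0,\infty)$, and $\int_0^\infty e^{-lx}W(x)\,dx=1/\Phi(l)$ for all $l>0$. Write $f*h(t)=\int_0^t f(t-s)h(s)\,ds$ and, for $a>0$, $\rho\in(0,1)$, $$I_a^\rho f(t)=\frac1{a\Gamma(\rho)}\int_0^t(t-s)^{\rho-1}f(s)\,ds,\qquad D_a^\rho f(t)=\frac{a}{\Gamma(1-\rho)}\frac{d}{dt}\int_0^t(t-s)^{-\rho}f(s)\,ds,$$ $$\mathcal V_\alpha f(t)=\int_0^\infty\Big(\exp\Big\{\int_{(t-y)^+}^t f(r)dr\Big\}-1-\int_{(t-y)^+}^t f(r)dr\Big)\nu_\alpha(dy).$$ **Theorem.** (i) Let $(\Omega,\mathscr F,(\mathscr F_t)_{t\ge0},\mathbf P)$ be a filtered probability space carrying an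 $(\mathscr F_t)$-Poisson random measure $N_\alpha(ds,dy,dz)$ on $[0,\infty)\times(0,\infty)^2$ with intensity $ds\,\nu_\alpha(dy)\,dz$ and compensated measure $\tilde N_\alpha$, and let $\zeta$ be an $\mathscr F_0$-measurable, almost surely strictly positive random variable (for instance a constant). A continuous adapted real process $X$ satisfies, for every $t\ge0$ almost surely, $$X(t)=\zeta(1-bW(t))+\int_0^t\int_0^\infty\int_0^{X(s)}\big(W(t-s)-W(t-s-y)\big)\tilde N_\alpha(ds,dy,dz)$$ if and only if it satisfies, for every $t\ge0$ almost surely, $$X(t)=\zeta-b\int_0^t\frac{(t-s)^{\alpha-1}}{c\Gamma(\alpha)}X(s)\,ds+\int_0^t\int_0^\infty\int_0^{X(s)}\int_{(t-s-y)^+}^{t-s}\frac{r^{\alpha-1}}{c\Gamma(\alpha)}\,dr\,\tilde N_\alpha(ds,dy,dz).$$ Here the stochastic integrals are Itô integrals of predictable, almost surely square-integrable integrands, and $\int_0^{X(s)}$ means integration over $\{0<z\le X(s)\}$ (empty if $X(s)\le0$). (ii) Let $\lambda\in\mathbb C$ with $\mathrm{Re}\,\lambda\le0$, let $g:[0,\infty)\to\{z\in\mathbb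 C:\mathrm{Re}\,z\le 0\}$ be bounded and measurable, and let $v$ be a complex function that is continuous on $(0,\infty)$ and integrable on $(0,T)$ for every $T>0$. Then $v$ satisfies the nonlinear Volterra equation $$v(t)=\lambda W'(t)+(g+\mathcal V_\alpha v)*W'(t),\qquad t>0,$$ with absolutely convergent convolution integrals, if and only if it satisfies the fractional Riccati equation $$D_c^\alpha v(t)=-bv(t)+g(t)+\mathcal V_\alpha v(t),\qquad I_{1/c}^{1-\alpha}v(0+)=\lambda,$$ in the following sense: the function $I_{1/c}^{1-\alpha}v(t)=\frac{c}{\Gamma(1-\alpha)}\int_0^t(t-s)^{-\alpha}v(s)\,ds$, whose derivative is $D_c^\alpha v$, tends to $\lambda$ as $t\to0+$ and is absolutely continuous on every $[0,T]$ when given the value $\lambda$ at $0$, and the differential equation holds for almost every $t>0$. In that case the differential equation moreover holds, with a classical derivative, at every $t>0$ at which $g$ is continuous. -/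

import Mathlib

open MeasureTheory ProbabilityTheory Filter Topology Set
open scoped NNReal ENNReal

universe u

noncomputable section

namespace RoughBranching

/-! ### The scale function and the Levy measure -/

/-- Laplace exponent `Φ(l) = b l + c l ^ (1 + α)` of the spectrally positive stable process. -/
def laplaceExponent (α b c l : ℝ) : ℝ := b * l + c * l ^ (1 + α)

/-- `W` is the scale function: zero on the negative half line, continuous and strictly increasing
on `[0, ∞)`, with Laplace transform `1 / Φ`. (As `1 / Φ(l)` is not zero, the equation of the
Bochner integral contains the integrability.) These properties determine `W`. -/
structure IsScaleFunction (α b c : ℝ) (W : ℝ → ℝ) : Prop where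
  zero_of_neg : ∀ x < 0, W x = 0
  continuousOn : ContinuousOn W (Ici 0)
  strictMonoOn : StrictMonoOn W (Ici 0)
  laplace : ∀ l > 0, ∫ x in Ioi (0 : ℝ), Real.exp (-l * x) * W x = 1 / laplaceExponent α b c l

/-- The Levy measure `ν_α(dy) = c α (α + 1) / Γ(1 - α) * y ^ (- α - 2) dy` on `y > 0`. -/
def levyMeasure (α c : ℝ) : Measure ℝ :=
  (volume.restrict (Ioi 0)).withDensity fun y =>
    ENNReal.ofReal (c * α * (α + 1) / Real.Gamma (1 - α) * y ^ (-α - 2))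

/-! ### Poisson random measures and compensated stochastic integrals

Points of the state space are triples `(s, y, z)` with `s` the time. -/

/-- The intensity `ds ν_α(dy) dz`, carried by `s ≥ 0`, `y > 0`, `z > 0`. -/
def intensity (α c : ℝ) : Measure (ℝ≥0 × ℝ × ℝ) :=
  (volume.comap ((↑) : ℝ≥0 → ℝ)).prod ((levyMeasure α c).prod (volume.restrict (Ioi 0)))

/-- `N` is a Poisson random measure with intensity `μ` relative to the filtration `ℱ`. -/
structure IsPoissonRandomMeasure {Ω : Type u} [mΩ : MeasurableSpace Ω] (P : Measure Ω)
    (ℱ : Filtration ℝ≥0 mΩ) (μ : Measure (ℝ≥0 × ℝ × ℝ))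
    (N : Ω → Measure (ℝ≥0 × ℝ × ℝ)) : Prop where
  measurable : Measurable N
  /-- `N(A)` is Poisson distributed with parameter `μ(A)`. -/
  law : ∀ A, MeasurableSet A → μ A ≠ ∞ →
    P.map (fun ω => N ω A) = (poissonMeasure (μ A).toNNReal).map (fun k : ℕ => (k : ℝ≥0∞))
  /-- Disjoint sets have independent masses. -/
  indep : ∀ (n : ℕ) (A : Fin n → Set (ℝ≥0 × ℝ × ℝ)), (∀ i, MeasurableSet (A i)) →
    Pairwise (fun i j => Disjoint (A i) (A j)) → iIndepFun (fun i ω => N ω (A i)) P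
  /-- `N` is adapted. -/
  adapted : ∀ (t : ℝ≥0) (A), MeasurableSet A → A ⊆ {e | e.1 ≤ t} →
    Measurable[ℱ t] (fun ω => N ω A)
  /-- After time `t`, `N` is independent of `ℱ t`. -/
  indep_future : ∀ t : ℝ≥0,
    Indep (⨆ (A : Set (ℝ≥0 × ℝ × ℝ)) (_ : MeasurableSet A ∧ A ⊆ {e | t < e.1}),
      MeasurableSpace.comap (fun ω => N ω A) inferInstance) (ℱ t) P

/-- Measurability with respect to the product of the predictable σ-algebra on `[0, ∞) × Ω` and the
Borel σ-algebra in the marks `(y, z)`. -/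
def IsPredictableIntegrand {Ω : Type u} [mΩ : MeasurableSpace Ω] (ℱ : Filtration ℝ≥0 mΩ)
    (H : (ℝ≥0 × Ω) × (ℝ × ℝ) → ℝ) : Prop :=
  Measurable[ℱ.predictable.prod (inferInstance : MeasurableSpace (ℝ × ℝ))] H

/-- `Y` is (a version of) the Ito integral of `H` with respect to the compensated measure `N - μ`:
`H` is predictable, almost surely square integrable for `μ`, and `Y` is the limit in probability
of the pathwise integrals `∫ Hₙ dN - ∫ Hₙ dμ` for some predictable `Hₙ` that are almost surely
integrable for `N` and for `μ` and satisfy `∫ |Hₙ - H|² dμ → 0` in probability.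
The limit does not depend on the choice of the `Hₙ`, up to null sets. -/
structure IsCompensatedIntegral {Ω : Type u} [mΩ : MeasurableSpace Ω] (P : Measure Ω)
    (ℱ : Filtration ℝ≥0 mΩ) (μ : Measure (ℝ≥0 × ℝ × ℝ)) (N : Ω → Measure (ℝ≥0 × ℝ × ℝ))
    (H : (ℝ≥0 × Ω) × (ℝ × ℝ) → ℝ) (Y : Ω → ℝ) : Prop where
  predictable : IsPredictableIntegrand ℱ H
  sq_finite : ∀ᵐ ω ∂P, ∫⁻ e, ENNReal.ofReal (H ((e.1, ω), e.2) ^ 2) ∂μ < ∞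
  exists_approx : ∃ Hn : ℕ → (ℝ≥0 × Ω) × (ℝ × ℝ) → ℝ,
    (∀ n, IsPredictableIntegrand ℱ (Hn n)) ∧
    (∀ n, ∀ᵐ ω ∂P, Integrable (fun e => Hn n ((e.1, ω), e.2)) μ ∧
      Integrable (fun e => Hn n ((e.1, ω), e.2)) (N ω)) ∧
    (∀ ε : ℝ≥0∞, 0 < ε → Tendsto (fun n => P {ω | ε ≤
      ∫⁻ e, ENNReal.ofReal ((Hn n ((e.1, ω), e.2) - H ((e.1, ω), e.2)) ^ 2) ∂μ}) atTop (𝓝 0)) ∧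
    TendstoInMeasure P
      (fun n ω => ∫ e, Hn n ((e.1, ω), e.2) ∂(N ω) - ∫ e, Hn n ((e.1, ω), e.2) ∂μ) atTop Y

/-! ### The two stochastic equations -/

/-- The integrand `1_{s ≤ t} 1_{0 < z ≤ X(s)} k(t - s, y)`, so that its compensated integral is
`∫_0^t ∫_0^∞ ∫_0^{X(s)} k(t - s, y) (N - μ)(ds, dy, dz)`. -/
def volterraIntegrand {Ω : Type u} (X : ℝ≥0 → Ω → ℝ) (k : ℝ → ℝ → ℝ) (t : ℝ≥0) :
    (ℝ≥0 × Ω) × (ℝ × ℝ) → ℝ :=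
  {p | p.1.1 ≤ t ∧ 0 < p.2.2 ∧ p.2.2 ≤ X p.1.1 p.1.2}.indicator
    fun p => k ((t : ℝ) - (p.1.1 : ℝ)) p.2.1

/-- The continuous adapted process `X` solves the stochastic Volterra equation
`X(t) = ζ (1 - b W(t)) + ∫_0^t ∫_0^∞ ∫_0^{X(s)} (W(t-s) - W(t-s-y)) (N - μ)(ds, dy, dz)`,
for every `t`, almost surely. -/
structure SolvesSVE {Ω : Type u} [mΩ : MeasurableSpace Ω] (α b c : ℝ) (W : ℝ → ℝ)
    (P : Measure Ω) (ℱ : Filtration ℝ≥0 mΩ) (N : Ω → Measure (ℝ≥0 × ℝ × ℝ))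
    (ζ : Ω → ℝ) (X : ℝ≥0 → Ω → ℝ) : Prop where
  adapted : StronglyAdapted ℱ X
  continuous : ∀ ω, Continuous fun t => X t ω
  equation : ∀ t : ℝ≥0, ∃ Y : Ω → ℝ,
    IsCompensatedIntegral P ℱ (intensity α c) N
      (volterraIntegrand X (fun r y => W r - W (r - y)) t) Y ∧
    ∀ᵐ ω ∂P, X t ω = ζ ω * (1 - b * W t) + Y ω

/-- The continuous adapted process `X` solves the fractional form
`X(t) = ζ - b ∫_0^t (t-s)^(α-1) / (c Γ(α)) X(s) ds
  + ∫_0^t ∫_0^∞ ∫_0^{X(s)} ∫_{(t-s-y)^+}^{t-s} r^(α-1) / (c Γ(α)) dr (N - μ)(ds, dy, dz)`,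
for every `t`, almost surely. -/
structure SolvesFractionalSVE {Ω : Type u} [mΩ : MeasurableSpace Ω] (α b c : ℝ)
    (P : Measure Ω) (ℱ : Filtration ℝ≥0 mΩ) (N : Ω → Measure (ℝ≥0 × ℝ × ℝ))
    (ζ : Ω → ℝ) (X : ℝ≥0 → Ω → ℝ) : Prop where
  adapted : StronglyAdapted ℱ X
  continuous : ∀ ω, Continuous fun t => X t ω
  equation : ∀ t : ℝ≥0, ∃ Y : Ω → ℝ,
    IsCompensatedIntegral P ℱ (intensity α c) N
      (volterraIntegrand X
        (fun r y => ∫ x in (max (r - y) 0)..r, x ^ (α - 1) / (c * Real.Gamma α)) t) Y ∧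
    ∀ᵐ ω ∂P, X t ω = ζ ω
      - b * (∫ s in (0 : ℝ)..t, ((t : ℝ) - s) ^ (α - 1) / (c * Real.Gamma α) * X s.toNNReal ω)
      + Y ω

/-! ### The two deterministic equations -/

/-- Riemann-Liouville integral
`I_a^ρ f(t) = 1 / (a Γ(ρ)) ∫_0^t (t - s)^(ρ - 1) f(s) ds`. -/
def rlIntegral (ρ a : ℝ) (f : ℝ → ℂ) (t : ℝ) : ℂ :=
  ((1 / (a * Real.Gamma ρ) : ℝ) : ℂ) * ∫ s in (0 : ℝ)..t, (((t - s) ^ (ρ - 1) : ℝ) : ℂ) * f s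

/-- Riemann-Liouville derivative
`D_a^ρ f(t) = a / Γ(1 - ρ) (d/dt) ∫_0^t (t - s)^(- ρ) f(s) ds`. -/
def rlDeriv (ρ a : ℝ) (f : ℝ → ℂ) (t : ℝ) : ℂ :=
  ((a / Real.Gamma (1 - ρ) : ℝ) : ℂ) *
    deriv (fun r : ℝ => ∫ s in (0 : ℝ)..r, (((r - s) ^ (-ρ) : ℝ) : ℂ) * f s) t

/-- The operator `𝒱_α`,
`𝒱_α f(t) = ∫_0^∞ (exp(∫_{(t-y)^+}^t f) - 1 - ∫_{(t-y)^+}^t f) ν_α(dy)`. -/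
def opV (α c : ℝ) (f : ℝ → ℂ) (t : ℝ) : ℂ :=
  ∫ y, (Complex.exp (∫ r in (max (t - y) 0)..t, f r) - 1 - ∫ r in (max (t - y) 0)..t, f r)
    ∂(levyMeasure α c)

/-- The class of functions in which both equations are read: continuous on `(0, ∞)` and integrable
at `0` (solutions are singular at `0`). For such `v` and `t > 0`, the integral defining
`𝒱_α v(t)` converges absolutely. -/
structure IsAdmissible (v : ℝ → ℂ) : Prop where
  continuousOn : ContinuousOn v (Ioi 0)
  integrable : ∀ T > 0, IntervalIntegrable v volume 0 T

/-- `v` is a global solution of `v = lam W' + (g + 𝒱_α v) * W'`, the convolution being an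
absolutely convergent integral. -/
structure SolvesVolterra (α c : ℝ) (W : ℝ → ℝ) (lam : ℂ) (g v : ℝ → ℂ) : Prop where
  admissible : IsAdmissible v
  integrable : ∀ t > 0, IntervalIntegrable
    (fun s => (g (t - s) + opV α c v (t - s)) * ((deriv W s : ℝ) : ℂ)) volume 0 t
  equation : ∀ t > 0, v t = lam * ((deriv W t : ℝ) : ℂ) +
    ∫ s in (0 : ℝ)..t, (g (t - s) + opV α c v (t - s)) * ((deriv W s : ℝ) : ℂ)

/-- `v` is a global solution of `D_c^α v = - b v + g + 𝒱_α v` with the initial condition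
`lim_{t → 0+} c / Γ(1-α) ∫_0^t (t-s)^(-α) v(s) ds = lam`: the function under the limit, whose
derivative is `D_c^α v`, is absolutely continuous on every `[0, T]` once it is given the value
`lam` at `0`, and the differential equation holds almost everywhere. With
`rlIntegral (1 - α) (1 / c)` the constant in front is `1 / ((1 / c) Γ(1-α)) = c / Γ(1-α)`. -/
structure SolvesFractionalRiccati (α b c : ℝ) (lam : ℂ) (g v : ℝ → ℂ) : Prop where
  admissible : IsAdmissible v
  initial : Tendsto (rlIntegral (1 - α) (1 / c) v) (𝓝[>] 0) (𝓝 lam)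
  absolutelyContinuous : ∀ T > 0, AbsolutelyContinuousOnInterval
    (Function.update (rlIntegral (1 - α) (1 / c) v) 0 lam) 0 T
  equation : ∀ᵐ t ∂(volume.restrict (Ioi (0 : ℝ))),
    rlDeriv α c v t = -(b : ℂ) * v t + g t + opV α c v t

end RoughBranching

end

open RoughBranching

/-! Write `k` for `kern α c`, `K` for its primitive `kernInt α c`, and `κ` for the complementary
kernel `kern (1 - α) (1 / c)`. Both halves rest on one resolvent identity. As `1/Φ(l) * (1 + b/(c
l^α)) = 1/(c l^(1+α))`, uniqueness of the Laplace transform gives `W + b (k * W) = K`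
(`IsScaleFunction.resolvent`). It bounds the increments of `W` by those of `K`, so `W` is absolutely
continuous, and differentiation gives `W' + b (k * W') = k` (`IsScaleFunction.deriv_eq`). With the
Beta integral `κ * k = 1` this becomes `κ * W' = 1 - b W` (`IsScaleFunction.conv_kern_compl_deriv`).

Part (ii). Put `F = g + 𝒱_α v`. Both equations are equivalent to: `F` is locally integrable and `κ *
v = λ + ∫ (F - b v)` (`solvesVolterra_iff`, `solvesFractionalRiccati_iff`). From the Volterra
equation one convolves with `κ`; conversely one convolves the integrated equation with `W'` and
differentiates (`IsScaleFunction.volterra_iff`). The Riccati side is the fundamental theorem of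
calculus for absolutely continuous functions. Local integrability of `F` at `0` has to be extracted
from each formulation separately. The operator `𝒱_α` enters only through the continuity of `𝒱_α v`
on `(0, ∞)`, so the equation is treated as linear with source `F`.

Part (i). If `A' = A + β (L * A)` and `Y(u)` is the compensated integral of the increments of `A`,
then `Y + β (L * Y)` is the compensated integral of the increments of `A'`; this is a stochastic
Fubini theorem, `isCompensatedIntegral_conv`. The choice `A = W`, `L = k`, `β = b` leads from the
first equation to the second, and `A = K`, `L = W'`, `β = -b` leads back; what remains is
deterministic resolvent algebra for the continuous paths of `X`.

For the Fubini theorem the small jumps are removed. The remaining integrals are pathwise, so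
ordinary Fubini applies, and the error is controlled in `L²` on the event that `X` is bounded by `m`
up to time `t`. The needed inequality `IsPoissonRandomMeasure.lintegral_compInt_sq_le` is derived
from the axioms of the random measure: the covariance of compensated masses is computed on
predictable rectangles from the independence of past and future, extended by a monotone class
argument, and passed to general integrands by Fatou. A Lenglart type inequality then shows that
every approximating sequence has the same limit (`IsCompensatedIntegral.tendstoInMeasure`). -/

noncomputable section

namespace RoughBranching

/-! ### Convolution on the half line -/

section Convolution

variable {E : Type*} [NormedAddCommGroup E] [NormedSpace ℝ E]

/-- The one-sided convolution `∫_0^t f(t - s) h(s) ds`. -/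
def conv (f : ℝ → ℝ) (h : ℝ → E) (t : ℝ) : E := ∫ s in (0 : ℝ)..t, f (t - s) • h s

lemma conv_eq_integral_comp_sub (f : ℝ → ℝ) (h : ℝ → E) (t : ℝ) :
    conv f h t = ∫ s in (0 : ℝ)..t, f s • h (t - s) := by
  have := intervalIntegral.integral_comp_sub_left (a := 0) (b := t)
    (fun s => f s • h (t - s)) t
  simpa [conv] using this

lemma conv_comm (f h : ℝ → ℝ) (t : ℝ) : conv f h t = conv h f t := by
  rw [conv_eq_integral_comp_sub, conv]
  simp only [smul_eq_mul, mul_comm]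

lemma conv_congr {f f' : ℝ → ℝ} {h h' : ℝ → E} {t : ℝ} (ht : 0 ≤ t)
    (hf : ∀ s ∈ Ioo 0 t, f s = f' s) (hh : ∀ᵐ s, s ∈ Ioo 0 t → h s = h' s) :
    conv f h t = conv f' h' t := by
  refine intervalIntegral.integral_congr_ae ?_
  have h1 : ∀ᵐ s : ℝ, s ≠ t := by simp [ae_iff]
  filter_upwards [hh, h1] with s hs hst hs'
  rw [uIoc_of_le ht] at hs'
  have hs2 : s < t := lt_of_le_of_ne hs'.2 hst
  rw [hs ⟨hs'.1, hs2⟩, hf (t - s) ⟨by linarith, by linarith [hs'.1]⟩]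

/-- The possible singularities of the two factors sit at opposite ends of `[0, t]`. Cutting at `t /
2` leaves an integrable factor times a bounded one on each half. -/
lemma conv_intervalIntegrable {f : ℝ → ℝ} {h : ℝ → E} {t : ℝ} (ht : 0 < t)
    (hf : ContinuousOn f (Ioi 0)) (hfi : IntervalIntegrable f volume 0 t)
    (hh : IntervalIntegrable h volume 0 t)
    (hb : ∀ δ > 0, ∃ M, ∀ s ∈ Icc δ t, ‖h s‖ ≤ M) :
    IntervalIntegrable (fun s => f (t - s) • h s) volume 0 t := by
  have h2 : (0 : ℝ) < t / 2 := by linarith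
  have hfi' : IntervalIntegrable (fun s => f (t - s)) volume 0 t := by
    have := (hfi.comp_sub_left t).symm
    simpa using this
  refine IntervalIntegrable.trans (b := t / 2) ?_ ?_
  · have h3 : IntervalIntegrable h volume 0 (t / 2) := hh.mono_set (by
      rw [uIcc_of_le h2.le, uIcc_of_le ht.le]; exact Icc_subset_Icc_right (by linarith))
    refine h3.continuousOn_smul ?_
    refine hf.comp (by fun_prop) ?_
    intro s hs; rw [uIcc_of_le h2.le] at hs; simp only [mem_Ioi]; linarith [hs.2]
  · obtain ⟨M, hM⟩ := hb (t / 2) h2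
    have h4 : Ioc (t / 2) t ⊆ Ioc 0 t := Ioc_subset_Ioc_left h2.le
    rw [intervalIntegrable_iff_integrableOn_Ioc_of_le (by linarith)] at hfi' hh ⊢
    have h5 := hfi'.mono_set h4
    have h6 := hh.mono_set h4
    refine Integrable.mono' (h5.norm.mul_const M)
      (h5.aestronglyMeasurable.smul h6.aestronglyMeasurable) ?_
    filter_upwards [ae_restrict_mem measurableSet_Ioc] with s hs
    rw [norm_smul]
    exact mul_le_mul_of_nonneg_left (hM s ⟨hs.1.le, hs.2⟩) (norm_nonneg _)

/-- The convolution of a locally integrable function which is continuous on `(0, ∞)` with a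
locally integrable function which is locally bounded on `(0, ∞)` is continuous on `(0, ∞)`. -/
lemma conv_continuousOn {f : ℝ → ℝ} {h : ℝ → E}
    (hf : ContinuousOn f (Ioi 0)) (hfi : ∀ T > 0, IntervalIntegrable f volume 0 T)
    (hh : ∀ T > 0, IntervalIntegrable h volume 0 T)
    (hb : ∀ δ > 0, ∀ T, ∃ M, ∀ s ∈ Icc δ T, ‖h s‖ ≤ M) :
    ContinuousOn (conv f h) (Ioi 0) := by
  intro t₀ ht₀
  have ht₀ : 0 < t₀ := ht₀
  refine ContinuousAt.continuousWithinAt ?_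
  -- The approximants drop `s ∈ (t - η, t)`, where `f (t - s)` is singular. On that stretch `h` is
  -- bounded by `M`, so the error is at most `M ∫_0^η ‖f‖`, uniformly for `t` near `t₀`.
  refine continuousAt_of_locally_uniform_approx_of_continuousAt fun u hu => ?_
  obtain ⟨ε, hε, hεu⟩ := Metric.mem_uniformity_dist.1 hu
  obtain ⟨M, hM⟩ := hb (t₀ / 4) (by positivity) (2 * t₀)
  have hM0 : 0 ≤ M := (norm_nonneg _).trans (hM t₀ ⟨by linarith, by linarith⟩)
  have hfn : ∀ T > 0, IntervalIntegrable (fun x => ‖f x‖) volume 0 T := fun T hT => (hfi T hT).norm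
  have hlim : Tendsto (fun η => M * ∫ x in (0 : ℝ)..η, ‖f x‖) (𝓝[>] 0) (𝓝 0) := by
    have h1 : ContinuousOn (fun η => ∫ x in (0 : ℝ)..η, ‖f x‖) (uIcc 0 1) :=
      intervalIntegral.continuousOn_primitive_interval
        ((intervalIntegrable_iff_integrableOn_Icc_of_le zero_le_one).1 (hfn 1 one_pos) |>.mono_set
          (by rw [uIcc_of_le zero_le_one]))
    have h2 := (h1 0 (by simp)).tendsto
    rw [uIcc_of_le zero_le_one] at h2
    have h3 : Tendsto (fun η => ∫ x in (0 : ℝ)..η, ‖f x‖) (𝓝[>] 0) (𝓝 0) := by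
      have h4 : 𝓝[>] (0 : ℝ) ≤ 𝓝[Icc 0 1] 0 := by
        rw [← nhdsWithin_Ioc_eq_nhdsGT (zero_lt_one' ℝ)]
        exact nhdsWithin_mono _ Ioc_subset_Icc_self
      simpa using h2.mono_left h4
    simpa using h3.const_mul M
  obtain ⟨η, hη1, hη2⟩ := ((hlim.eventually (gt_mem_nhds hε)).and
    (Ioo_mem_nhdsGT (show (0 : ℝ) < t₀ / 4 by positivity))).exists
  obtain ⟨C, hC⟩ : ∃ C, ∀ x ∈ Icc η (2 * t₀), ‖f x‖ ≤ C :=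
    isCompact_Icc.exists_bound_of_continuousOn (hf.mono fun x hx => hη2.1.trans_le hx.1)
  have hC0 : 0 ≤ C := (norm_nonneg _).trans (hC t₀ ⟨by linarith [hη2.2], by linarith⟩)
  have hh2 := (intervalIntegrable_iff_integrableOn_Ioc_of_le (by linarith)).1
    (hh (2 * t₀) (by linarith))
  refine ⟨Ioo (t₀ / 2) (2 * t₀), Ioo_mem_nhds (by linarith) (by linarith),
    fun t => ∫ s in Ioc 0 (2 * t₀), (Iio (t - η)).indicator (fun s => f (t - s) • h s) s, ?_, ?_⟩
  · refine continuousAt_of_dominated (bound := fun s => C * ‖h s‖) ?_ ?_ (hh2.norm.const_mul C) ?_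
    · filter_upwards [Ioo_mem_nhds (show t₀ / 2 < t₀ by linarith) (show t₀ < 2 * t₀ by linarith)]
        with t ht
      rw [aestronglyMeasurable_indicator_iff measurableSet_Iio,
        Measure.restrict_restrict measurableSet_Iio]
      refine AEStronglyMeasurable.smul ?_ (hh2.aestronglyMeasurable.mono_set inter_subset_right)
      refine ContinuousOn.aestronglyMeasurable ?_ (measurableSet_Iio.inter measurableSet_Ioc)
      exact hf.comp (by fun_prop) fun s hs => by
        have := hs.1; simp only [mem_Iio] at this; simp only [mem_Ioi]; linarith [hη2.1]
    · filter_upwards [Ioo_mem_nhds (show t₀ / 2 < t₀ by linarith) (show t₀ < 2 * t₀ by linarith)]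
        with t ht
      filter_upwards [ae_restrict_mem measurableSet_Ioc] with s hs
      rw [indicator]
      split_ifs with h
      · rw [norm_smul]
        simp only [mem_Iio] at h
        exact mul_le_mul_of_nonneg_right
          (hC _ ⟨by linarith, by linarith [ht.2, hs.1]⟩) (norm_nonneg _)
      · simpa using mul_nonneg hC0 (norm_nonneg _)
    -- For fixed `s` the truncated integrand can jump in `t` at `t₀` only if `s = t₀ - η`.
    · have hne : ∀ᵐ s : ℝ, s ≠ t₀ - η := by simp [ae_iff]
      filter_upwards [ae_restrict_of_ae hne] with s hs
      rcases lt_or_gt_of_ne hs with h1 | h1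
      · have h2 : (fun t => f (t - s) • h s) =ᶠ[𝓝 t₀]
            fun t => (Iio (t - η)).indicator (fun s => f (t - s) • h s) s := by
          filter_upwards [lt_mem_nhds (show s + η < t₀ by linarith)] with t ht
          rw [indicator_of_mem]; simp only [mem_Iio]; linarith
        refine ContinuousAt.congr ?_ h2
        refine ContinuousAt.smul ?_ continuousAt_const
        have h3 : ContinuousAt f (t₀ - s) :=
          hf.continuousAt (Ioi_mem_nhds (by linarith [hη2.1]))
        exact ContinuousAt.comp (f := fun t => t - s) h3 (by fun_prop)
      · have h2 : (fun _ => (0 : E)) =ᶠ[𝓝 t₀]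
            fun t => (Iio (t - η)).indicator (fun s => f (t - s) • h s) s := by
          filter_upwards [gt_mem_nhds (show t₀ < s + η by linarith)] with t ht
          rw [indicator_of_notMem]; simp only [mem_Iio, not_lt]; linarith
        exact continuousAt_const.congr h2
  · intro t ht
    apply hεu
    have ht0 : 0 < t := by linarith [ht.1]
    have hint := conv_intervalIntegrable ht0 hf (hfi t ht0) (hh t ht0) (fun δ hδ => hb δ hδ t)
    have e1 : ∫ s in Ioc 0 (2 * t₀), (Iio (t - η)).indicator (fun s => f (t - s) • h s) s =
        ∫ s in (0 : ℝ)..(t - η), f (t - s) • h s := by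
      rw [integral_indicator measurableSet_Iio, Measure.restrict_restrict measurableSet_Iio,
        intervalIntegral.integral_of_le (by linarith [ht.1, hη2.2]), integral_Ioc_eq_integral_Ioo]
      congr 2
      ext s; simp only [mem_inter_iff, mem_Iio, mem_Ioc, mem_Ioo]
      exact ⟨fun ⟨a, b, _⟩ => ⟨b, a⟩, fun ⟨a, b⟩ => ⟨b, a, by linarith [ht.2, hη2.1]⟩⟩
    have hsub : ∀ x ∈ Icc 0 t, ∀ y ∈ Icc 0 t, IntervalIntegrable (fun s => f (t - s) • h s) volume x y :=
      fun x hx y hy => hint.mono_set (by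
        rw [uIcc_of_le ht0.le]; exact uIcc_subset_Icc hx hy)
    have hη0 := hη2.1
    have hη4 := hη2.2
    have m1 : t - η ∈ Icc 0 t := ⟨by linarith [ht.1], by linarith⟩
    beta_reduce
    rw [dist_eq_norm, e1, conv, intervalIntegral.integral_interval_sub_left
      (hsub 0 ⟨le_rfl, ht0.le⟩ t ⟨ht0.le, le_rfl⟩) (hsub 0 ⟨le_rfl, ht0.le⟩ _ m1)]
    refine lt_of_le_of_lt ?_ hη1
    have e2 : ∫ s in (t - η)..t, M * ‖f (t - s)‖ = M * ∫ x in (0 : ℝ)..η, ‖f x‖ := by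
      rw [intervalIntegral.integral_const_mul]
      have := intervalIntegral.integral_comp_sub_left (a := t - η) (b := t) (fun x => ‖f x‖) t
      rw [this]; simp
    rw [← e2]
    refine intervalIntegral.norm_integral_le_of_norm_le (by linarith) ?_ ?_
    · refine Eventually.of_forall fun s hs => ?_
      rw [norm_smul, mul_comm]
      exact mul_le_mul_of_nonneg_right
        (hM s ⟨by linarith [hs.1, ht.1], by linarith [hs.2, ht.2]⟩) (norm_nonneg _)
    · have h7 := ((hfn η hη0).comp_sub_left t).symm
      simp only [sub_zero] at h7
      exact h7.const_mul M

/-- Values of the convolution up to time `T` see the factors only on `(0, T]`, so both may be cut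
off there and `integrable_posConvolution` applies. The bilinear map is flipped because `conv`
evaluates its first argument at `t - s`. -/
lemma conv_integrable {f : ℝ → ℝ} {h : ℝ → E} {T : ℝ} (hT : 0 ≤ T)
    (hf : IntervalIntegrable f volume 0 T) (hh : IntervalIntegrable h volume 0 T) :
    IntervalIntegrable (conv f h) volume 0 T := by
  rw [intervalIntegrable_iff_integrableOn_Ioc_of_le hT] at hf hh ⊢
  have hf' : IntegrableOn ((Ioc 0 T).indicator f) (Ioi 0) :=
    ((integrable_indicator_iff measurableSet_Ioc).2 hf).integrableOn
  have hh' : IntegrableOn ((Ioc 0 T).indicator h) (Ioi 0) :=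
    ((integrable_indicator_iff measurableSet_Ioc).2 hh).integrableOn
  have := (integrable_posConvolution hh' hf' (ContinuousLinearMap.lsmul ℝ ℝ).flip).integrableOn
    (s := Ioc 0 T)
  refine this.congr_fun (fun x hx => ?_) measurableSet_Ioc
  rw [posConvolution, indicator_of_mem (mem_Ioi.2 hx.1), conv,
    intervalIntegral.integral_of_le hx.1.le, intervalIntegral.integral_of_le hx.1.le,
    integral_Ioc_eq_integral_Ioo, integral_Ioc_eq_integral_Ioo]
  refine setIntegral_congr_fun measurableSet_Ioo fun s hs => ?_
  have h1 : s ∈ Ioc 0 T := ⟨hs.1, by linarith [hs.2, hx.2]⟩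
  have h2 : x - s ∈ Ioc 0 T := ⟨by linarith [hs.2], by linarith [hs.1, hx.2]⟩
  simp [indicator_of_mem h1, indicator_of_mem h2]

variable [CompleteSpace E]

/-- Associativity of the one-sided convolution, at a point where the triple convolution of the
norms is finite. -/
lemma conv_assoc {a b : ℝ → ℝ} {h : ℝ → E} {t : ℝ} (ht : 0 ≤ t)
    (ha : Measurable a) (hb : Measurable b)
    (hh : AEStronglyMeasurable h (volume.restrict (Ioc 0 t)))
    (hab : ∀ r ∈ Ioo 0 t, IntervalIntegrable (fun w => a (r - w) * b w) volume 0 r)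
    (H : IntegrableOn (fun u => (∫ w in (0 : ℝ)..(t - u), ‖a (t - u - w) * b w‖) * ‖h u‖)
      (Ioc 0 t)) :
    conv a (conv b h) t = conv (conv a b) h t := by
  -- Extending the triangle `u ≤ s` by zero to the square `(0, t]²` lets the product-measure Fubini
  -- theorem exchange the integrals.
  set F : ℝ → ℝ → E := fun s u => if u ≤ s then (a (t - s) * b (s - u)) • h u else 0 with hF
  have key : ∀ u, ∀ G : ℝ → E, ∫ s in Ioc 0 t, (if u ≤ s then G s else 0) =
      ∫ s in Ioc 0 t ∩ Ici u, G s := by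
    intro u G
    rw [← Measure.restrict_restrict_of_subset (s := Ioc 0 t ∩ Ici u) (t := Ioc 0 t)
      inter_subset_left, Set.inter_comm, ← Measure.restrict_restrict measurableSet_Ici,
      Measure.restrict_restrict measurableSet_Ioc, inter_self, ← integral_indicator measurableSet_Ici]
    rfl
  have key2 : ∀ u ∈ Ioo 0 t, (Ioc 0 t ∩ Ici u) = Icc u t := by
    intro u hu; ext s; simp only [mem_inter_iff, mem_Ioc, mem_Ici, mem_Icc]
    constructor
    · rintro ⟨⟨_, h2⟩, h3⟩; exact ⟨h3, h2⟩
    · rintro ⟨h1, h2⟩; exact ⟨⟨hu.1.trans_le h1, h2⟩, h1⟩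
  have hIoo : ∀ᵐ u ∂(volume.restrict (Ioc 0 t)), u ∈ Ioo 0 t := by
    rw [← restrict_Ioo_eq_restrict_Ioc]; exact ae_restrict_mem measurableSet_Ioo
  have hmeas : AEStronglyMeasurable (Function.uncurry F)
      ((volume.restrict (Ioc 0 t)).prod (volume.restrict (Ioc 0 t))) := by
    have h1 : Measurable fun p : ℝ × ℝ => a (t - p.1) * b (p.1 - p.2) :=
      (ha.comp (by fun_prop)).mul (hb.comp (by fun_prop))
    have h2 : AEStronglyMeasurable (fun p : ℝ × ℝ => h p.2)
      ((volume.restrict (Ioc 0 t)).prod (volume.restrict (Ioc 0 t))) := hh.comp_snd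
    have h3 : MeasurableSet {p : ℝ × ℝ | p.2 ≤ p.1} := measurableSet_le measurable_snd measurable_fst
    have := (h1.aestronglyMeasurable.smul h2).indicator h3
    refine this.congr (Eventually.of_forall fun p => ?_)
    simp [Set.indicator, Function.uncurry, hF]
  have hint : Integrable (Function.uncurry F)
      ((volume.restrict (Ioc 0 t)).prod (volume.restrict (Ioc 0 t))) := by
    have hsub : ∀ u ∈ Ioo 0 t, IntervalIntegrable (fun s => a (t - s) * b (s - u)) volume u t := by
      intro u hu
      have := (hab (t - u) ⟨by linarith [hu.2], by linarith [hu.1]⟩).comp_sub_right u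
      simpa using this
    rw [integrable_prod_iff' hmeas]
    constructor
    · filter_upwards [hIoo] with u hu
      have h1 : IntegrableOn (fun s => a (t - s) * b (s - u)) (Icc u t) := by
        rw [integrableOn_Icc_iff_integrableOn_Ioc]
        exact (intervalIntegrable_iff_integrableOn_Ioc_of_le hu.2.le).1 (hsub u hu)
      have h2 := h1.smul_const (h u)
      have h3 : Integrable ((Ici u).indicator fun s => (a (t - s) * b (s - u)) • h u)
          (volume.restrict (Ioc 0 t)) := by
        rw [integrable_indicator_iff measurableSet_Ici, IntegrableOn,
          Measure.restrict_restrict measurableSet_Ici, inter_comm, key2 u hu]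
        exact h2
      exact h3
    · refine H.congr ?_
      filter_upwards [hIoo] with u hu
      have e1 : ∀ s, ‖Function.uncurry F (s, u)‖ =
          if u ≤ s then ‖a (t - s) * b (s - u)‖ * ‖h u‖ else 0 := by
        intro s; simp only [Function.uncurry, hF]; split_ifs <;> simp [norm_smul]
      have e2 : ∫ s in Ioc 0 t, ‖Function.uncurry F (s, u)‖ =
          ∫ s in Icc u t, ‖a (t - s) * b (s - u)‖ * ‖h u‖ := by
        simp_rw [e1]
        rw [← key2 u hu, ← Measure.restrict_restrict_of_subset (s := Ioc 0 t ∩ Ici u) (t := Ioc 0 t)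
          inter_subset_left, Set.inter_comm, ← Measure.restrict_restrict measurableSet_Ici,
          Measure.restrict_restrict measurableSet_Ioc, inter_self,
          ← integral_indicator measurableSet_Ici]
        rfl
      rw [e2, integral_Icc_eq_integral_Ioc, ← intervalIntegral.integral_of_le hu.2.le,
        intervalIntegral.integral_mul_const]
      congr 1
      have := intervalIntegral.integral_comp_sub_right (a := u) (b := t)
        (fun w => ‖a (t - u - w) * b w‖) u
      simpa using this.symm
  have swap := integral_integral_swap hint
  have L : conv a (conv b h) t = ∫ s in Ioc 0 t, ∫ u in Ioc 0 t, F s u := by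
    rw [conv, intervalIntegral.integral_of_le ht]
    refine setIntegral_congr_fun measurableSet_Ioc fun s hs => ?_
    have e : ∫ u in Ioc 0 t, F s u = ∫ u in Ioc 0 s, (a (t - s) * b (s - u)) • h u := by
      have : (F s) = (Iic s).indicator fun u => (a (t - s) * b (s - u)) • h u := by
        ext u; simp [hF, Set.indicator]
      rw [this, integral_indicator measurableSet_Iic, Measure.restrict_restrict measurableSet_Iic]
      congr 2
      ext u; simp only [mem_inter_iff, mem_Iic, mem_Ioc]
      exact ⟨fun ⟨h1, h2, _⟩ => ⟨h2, h1⟩, fun ⟨h1, h2⟩ => ⟨h2, h1, h2.trans hs.2⟩⟩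
    rw [e, conv, intervalIntegral.integral_of_le hs.1.le, ← integral_smul]
    simp only [mul_smul]
  have Rr : conv (conv a b) h t = ∫ u in Ioc 0 t, ∫ s in Ioc 0 t, F s u := by
    rw [conv, intervalIntegral.integral_of_le ht]
    refine integral_congr_ae ?_
    filter_upwards [hIoo] with u hu
    simp only [hF]
    rw [key u, key2 u hu, integral_Icc_eq_integral_Ioc, integral_smul_const,
      ← intervalIntegral.integral_of_le hu.2.le]
    congr 1
    have := intervalIntegral.integral_comp_sub_right (a := u) (b := t)
      (fun w => a (t - u - w) * b w) u
    simpa [conv] using this.symm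
  rw [L, Rr, swap]

/-- Associativity of the one-sided convolution when the convolution of the first two (nonnegative)
functions is bounded. -/
lemma conv_assoc_of_bounded {a b : ℝ → ℝ} {h : ℝ → E} {t M : ℝ} (ht : 0 ≤ t)
    (ha : Measurable a) (hb : Measurable b)
    (ha0 : ∀ x > 0, 0 ≤ a x) (hb0 : ∀ x > 0, 0 ≤ b x)
    (hab : ∀ r ∈ Ioo 0 t, IntervalIntegrable (fun w => a (r - w) * b w) volume 0 r)
    (hM : ∀ r ∈ Ioo 0 t, conv a b r ≤ M)
    (hh : IntervalIntegrable h volume 0 t) :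
    conv a (conv b h) t = conv (conv a b) h t := by
  have hh' := (intervalIntegrable_iff_integrableOn_Ioc_of_le ht).1 hh
  have hIoo : ∀ᵐ u ∂(volume.restrict (Ioc 0 t)), u ∈ Ioo 0 t := by
    rw [← restrict_Ioo_eq_restrict_Ioc]; exact ae_restrict_mem measurableSet_Ioo
  refine conv_assoc ht ha hb hh'.aestronglyMeasurable hab ?_
  have e : ∀ r ∈ Ioo 0 t, ∫ w in (0 : ℝ)..r, ‖a (r - w) * b w‖ = conv a b r := by
    intro r hr
    rw [conv, intervalIntegral.integral_of_le hr.1.le, intervalIntegral.integral_of_le hr.1.le,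
      integral_Ioc_eq_integral_Ioo, integral_Ioc_eq_integral_Ioo]
    refine setIntegral_congr_fun measurableSet_Ioo fun w hw => ?_
    simp only [smul_eq_mul]
    rw [Real.norm_of_nonneg (mul_nonneg (ha0 _ (by linarith [hw.2])) (hb0 _ hw.1))]
  have hmeasc : AEStronglyMeasurable (fun u => ∫ w in (0 : ℝ)..(t - u), ‖a (t - u - w) * b w‖)
      (volume.restrict (Ioc 0 t)) := by
    have h1 : StronglyMeasurable fun p : ℝ × ℝ =>
        (Ioc 0 (t - p.1)).indicator (fun w => ‖a (t - p.1 - w) * b w‖) p.2 := by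
      have h2 : Measurable fun p : ℝ × ℝ => ‖a (t - p.1 - p.2) * b p.2‖ :=
        ((ha.comp (by fun_prop)).mul (hb.comp (by fun_prop))).norm
      have h3 : MeasurableSet {p : ℝ × ℝ | 0 < p.2 ∧ p.2 ≤ t - p.1} :=
        (measurableSet_lt measurable_const measurable_snd).inter
          (measurableSet_le measurable_snd (by fun_prop))
      have h5 := (h2.indicator h3).stronglyMeasurable
      have h6 : (fun p : ℝ × ℝ =>
          (Ioc 0 (t - p.1)).indicator (fun w => ‖a (t - p.1 - w) * b w‖) p.2) =
          {p : ℝ × ℝ | 0 < p.2 ∧ p.2 ≤ t - p.1}.indicator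
            fun p : ℝ × ℝ => ‖a (t - p.1 - p.2) * b p.2‖ := by
        ext p; simp [Set.indicator]
      rw [h6]; exact h5
    have h4 := h1.integral_prod_right' (ν := volume)
    refine h4.aestronglyMeasurable.congr ?_
    filter_upwards [hIoo] with u hu
    rw [intervalIntegral.integral_of_le (by linarith [hu.2]), ← integral_indicator measurableSet_Ioc]
  refine Integrable.mono' (g := fun u => M * ‖h u‖) (hh'.norm.const_mul M)
    (hmeasc.mul hh'.aestronglyMeasurable.norm) ?_
  filter_upwards [hIoo] with u hu
  have hr : t - u ∈ Ioo 0 t := ⟨by linarith [hu.2], by linarith [hu.1]⟩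
  rw [e _ hr]
  have h0 : 0 ≤ conv a b (t - u) := by
    rw [← e _ hr]; exact intervalIntegral.integral_nonneg hr.1.le fun _ _ => norm_nonneg _
  rw [Real.norm_of_nonneg (mul_nonneg h0 (norm_nonneg _))]
  exact mul_le_mul_of_nonneg_right (hM _ hr) (norm_nonneg _)

end Convolution

/-! ### Uniqueness for the Laplace transform -/

/-- The integers `l = i + 1` suffice. In the variable `u = exp (-x)` they say that `exp (-x) * f x`
is orthogonal to all polynomials in `u`. By Weierstrass on `[0, 1]` it is then orthogonal to every
test function supported in `(0, ∞)`. -/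
lemma ae_eq_zero_of_laplace_eq_zero {f : ℝ → ℝ}
    (hi : ∀ l > 0, IntegrableOn (fun x => Real.exp (-l * x) * f x) (Ioi 0))
    (hz : ∀ l > 0, ∫ x in Ioi (0 : ℝ), Real.exp (-l * x) * f x = 0) :
    ∀ᵐ x : ℝ, x ∈ Ioi (0 : ℝ) → f x = 0 := by
  set h : ℝ → ℝ := fun x => Real.exp (-1 * x) * f x with hh
  have hhi : IntegrableOn h (Ioi 0) := hi 1 one_pos
  have hmono : ∀ (i : ℕ) x, Real.exp (-x) ^ i * h x = Real.exp (-((i : ℝ) + 1) * x) * f x := by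
    intro i x
    rw [hh, ← mul_assoc, ← Real.exp_nat_mul, ← Real.exp_add]
    congr 2; ring
  have hpos : ∀ i : ℕ, (0 : ℝ) < i + 1 := fun i => by positivity
  have hpi : ∀ p : Polynomial ℝ, IntegrableOn (fun x => p.eval (Real.exp (-x)) * h x) (Ioi 0) := by
    intro p
    simp_rw [Polynomial.eval_eq_sum_range, Finset.sum_mul, mul_assoc, hmono]
    exact integrable_finsetSum _ fun i _ => (hi _ (hpos i)).const_mul _
  have hpz : ∀ p : Polynomial ℝ, ∫ x in Ioi (0 : ℝ), p.eval (Real.exp (-x)) * h x = 0 := by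
    intro p
    simp_rw [Polynomial.eval_eq_sum_range, Finset.sum_mul, mul_assoc, hmono]
    rw [integral_finsetSum _ fun i _ => (hi _ (hpos i)).const_mul _]
    exact Finset.sum_eq_zero fun i _ => by rw [integral_const_mul, hz _ (hpos i), mul_zero]
  have key : ∀ᵐ x : ℝ, x ∈ Ioi (0 : ℝ) → h x = 0 := by
    refine isOpen_Ioi.ae_eq_zero_of_integral_contDiff_smul_eq_zero hhi.locallyIntegrableOn ?_
    intro g hg hgc hgs
    have hφ : ContinuousOn (fun u => g (-Real.log u)) (Icc 0 1) := by
      intro u hu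
      rcases eq_or_lt_of_le hu.1 with h0 | h0
      · subst h0
        have h1 : Tendsto (fun u => -Real.log u) (𝓝[>] 0) atTop :=
          tendsto_neg_atBot_atTop.comp Real.tendsto_log_nhdsGT_zero
        have h2 : ∀ᶠ y in (atTop : Filter ℝ), g y = 0 := by
          obtain ⟨R, hR⟩ := hgc.isCompact.isBounded.subset_closedBall 0
          filter_upwards [eventually_gt_atTop R, eventually_ge_atTop 0] with y hy hy0
          by_contra hne
          have := hR (subset_tsupport _ hne)
          rw [Metric.mem_closedBall, dist_zero_right, Real.norm_of_nonneg hy0] at this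
          linarith
        have h3 := h1.eventually h2
        -- Since `Real.log 0 = 0`, the value at `u = 0` is `g 0`. It vanishes as the support lies in
        -- `(0, ∞)`, and so agrees with the limit at `u → 0`, where `g` is evaluated near infinity.
        have hg0 : g 0 = 0 := by
          by_contra hne
          have := hgs (subset_tsupport _ hne)
          simp at this
        have h4 : (fun u => g (-Real.log u)) =ᶠ[𝓝[≥] 0] fun _ => 0 := by
          rw [← Ioi_insert, nhdsWithin_insert]
          exact eventually_sup.2 ⟨by simp [hg0], h3⟩
        have h5 : ContinuousWithinAt (fun u => g (-Real.log u)) (Ici 0) 0 :=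
          continuousWithinAt_const.congr_of_eventuallyEq h4 (by simp [hg0])
        exact h5.mono Icc_subset_Ici_self
      · exact (hg.continuous.continuousAt.comp
          (Real.continuousAt_log h0.ne').neg).continuousWithinAt
    have hghi : IntegrableOn (fun x => g x * h x) (Ioi 0) := by
      obtain ⟨C, hC⟩ := hgc.exists_bound_of_continuous hg.continuous
      exact hhi.bdd_mul hg.continuous.aestronglyMeasurable (Eventually.of_forall hC)
    have h1 : ∫ x, g x • h x = ∫ x in Ioi (0 : ℝ), g x * h x := by
      rw [setIntegral_eq_integral_of_forall_compl_eq_zero]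
      · rfl
      · intro x hx
        have : g x = 0 := by
          by_contra hne; exact hx (hgs (subset_tsupport _ hne))
        simp [this]
    rw [h1]
    set A := ∫ x in Ioi (0 : ℝ), ‖h x‖ with hA
    have hA0 : 0 ≤ A := integral_nonneg fun _ => norm_nonneg _
    have hle : ∀ ε > 0, ‖∫ x in Ioi (0 : ℝ), g x * h x‖ ≤ ε * A := by
      intro ε hε
      obtain ⟨p, hp⟩ := exists_polynomial_near_of_continuousOn 0 1 _ hφ ε hε
      have e : ∫ x in Ioi (0 : ℝ), g x * h x =
          ∫ x in Ioi (0 : ℝ), (g x * h x - p.eval (Real.exp (-x)) * h x) := by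
        rw [integral_sub hghi (hpi p), hpz, sub_zero]
      rw [e, hA, ← integral_const_mul]
      refine norm_integral_le_of_norm_le (hhi.norm.const_mul ε) ?_
      filter_upwards [ae_restrict_mem measurableSet_Ioi] with x hx
      have hx' : Real.exp (-x) ∈ Icc (0 : ℝ) 1 :=
        ⟨(Real.exp_pos _).le, Real.exp_le_one_iff.2 (by simpa using (mem_Ioi.1 hx).le)⟩
      have := hp _ hx'
      simp only [Real.log_exp, neg_neg] at this
      rw [← sub_mul, norm_mul]
      refine mul_le_mul_of_nonneg_right ?_ (norm_nonneg _)
      rw [Real.norm_eq_abs, abs_sub_comm]; exact this.le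
    refine norm_le_zero_iff.1 (le_of_forall_pos_le_add fun ε hε => ?_)
    -- The summand `1` covers the case `A = 0`.
    refine (hle (ε / (A + 1)) (by positivity)).trans ?_
    rw [zero_add, div_mul_eq_mul_div, div_le_iff₀ (by positivity)]
    nlinarith
  filter_upwards [key] with x hx hx0
  have := hx hx0
  rw [hh] at this
  simpa [(Real.exp_pos _).ne'] using this

/-! ### The Riemann-Liouville kernel -/

/-- The kernel `x ^ (α - 1) / (c Γ(α))`. -/
def kern (α c x : ℝ) : ℝ := x ^ (α - 1) / (c * Real.Gamma α)

/-- The primitive `∫_0^x r ^ (α - 1) / (c Γ(α)) dr` of the kernel. -/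
def kernInt (α c x : ℝ) : ℝ := ∫ r in (0 : ℝ)..x, kern α c r

section Kernel

variable {α b c : ℝ}

lemma kern_intervalIntegrable (hα0 : 0 < α) (x y : ℝ) :
    IntervalIntegrable (kern α c) volume x y := by
  unfold kern
  simp only [div_eq_mul_inv]
  exact (intervalIntegral.intervalIntegrable_rpow' (by linarith)).mul_const _

lemma measurable_kern : Measurable (kern α c) := by unfold kern; fun_prop

lemma kern_pos (hα0 : 0 < α) (hc : 0 < c) {x : ℝ} (hx : 0 < x) : 0 < kern α c x :=
  div_pos (Real.rpow_pos_of_pos hx _) (mul_pos hc (Real.Gamma_pos_of_pos hα0))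

lemma kern_continuousOn : ContinuousOn (kern α c) (Ioi 0) := by
  unfold kern
  exact (continuousOn_id.rpow_const fun x hx => Or.inl (ne_of_gt hx)).div_const _

lemma kernInt_continuous (hα0 : 0 < α) : Continuous (kernInt α c) :=
  intervalIntegral.continuous_primitive (fun x y => kern_intervalIntegrable hα0 x y) 0

lemma kernInt_eq (hα0 : 0 < α) (hc : 0 < c) {x : ℝ} (hx : 0 ≤ x) :
    kernInt α c x = x ^ α / (c * Real.Gamma (α + 1)) := by
  simp only [kernInt, kern]
  rw [intervalIntegral.integral_div, integral_rpow (Or.inl (by linarith)),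
    Real.Gamma_add_one hα0.ne']
  have := (Real.Gamma_pos_of_pos hα0).ne'
  simp only [sub_add_cancel]
  rw [Real.zero_rpow hα0.ne']
  field_simp
  ring

lemma kernInt_zero : kernInt α c 0 = 0 := by simp [kernInt]

lemma laplace_kern (hα0 : 0 < α) (hc : 0 < c) {l : ℝ} (hl : 0 < l) :
    ∫ x in Ioi (0 : ℝ), Real.exp (-l * x) * kern α c x = 1 / (c * l ^ α) := by
  have := Real.integral_rpow_mul_exp_neg_mul_Ioi hα0 hl
  have e : ∀ x, Real.exp (-l * x) * kern α c x =
      (x ^ (α - 1) * Real.exp (-(l * x))) * (c * Real.Gamma α)⁻¹ := by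
    intro x; rw [kern, div_eq_mul_inv, neg_mul]; ring
  simp_rw [e]
  rw [integral_mul_const, this, one_div, Real.inv_rpow hl.le]
  have h1 := (Real.Gamma_pos_of_pos hα0).ne'
  have h2 := (Real.rpow_pos_of_pos hl α).ne'
  field_simp

lemma laplace_kernInt (hα0 : 0 < α) (hc : 0 < c) {l : ℝ} (hl : 0 < l) :
    ∫ x in Ioi (0 : ℝ), Real.exp (-l * x) * kernInt α c x = 1 / (c * l ^ (1 + α)) := by
  have := Real.integral_rpow_mul_exp_neg_mul_Ioi (show 0 < α + 1 by linarith) hl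
  have e : ∀ x ∈ Ioi (0 : ℝ), Real.exp (-l * x) * kernInt α c x =
      (x ^ (α + 1 - 1) * Real.exp (-(l * x))) * (c * Real.Gamma (α + 1))⁻¹ := by
    intro x hx
    rw [kernInt_eq hα0 hc (mem_Ioi.1 hx).le, div_eq_mul_inv, neg_mul, add_sub_cancel_right]; ring
  rw [setIntegral_congr_fun measurableSet_Ioi e, integral_mul_const, this, one_div,
    Real.inv_rpow hl.le, add_comm 1 α]
  have h1 := (Real.Gamma_pos_of_pos (show 0 < α + 1 by linarith)).ne'
  have h2 := (Real.rpow_pos_of_pos hl (α + 1)).ne'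
  field_simp

/-- The Bochner integral of a non-integrable function is `0`. Thus each Laplace identity with a
positive right side carries its own integrability. -/
lemma integrable_of_integral_pos {f : ℝ → ℝ} {s : Set ℝ} (h : 0 < ∫ x in s, f x) :
    IntegrableOn f s := by
  by_contra hn
  rw [integral_undef hn] at h
  exact lt_irrefl _ h

/-- The resolvent equation of the scale function, almost everywhere. -/
lemma IsScaleFunction.ae_resolvent (hα0 : 0 < α) (hb : 0 ≤ b) (hc : 0 < c) {W : ℝ → ℝ}
    (hW : IsScaleFunction α b c W) :
    ∀ᵐ x : ℝ, x ∈ Ioi (0 : ℝ) → W x + b * conv (kern α c) W x - kernInt α c x = 0 := by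
  have hΦ : ∀ l > 0, 0 < laplaceExponent α b c l := fun l hl => by
    unfold laplaceExponent
    have := Real.rpow_pos_of_pos hl (1 + α)
    positivity
  have hWi : ∀ l > 0, IntegrableOn (fun x => Real.exp (-l * x) * W x) (Ioi 0) := fun l hl =>
    integrable_of_integral_pos (by rw [hW.laplace l hl]; exact one_div_pos.2 (hΦ l hl))
  have hp : ∀ l > 0, ∀ β : ℝ, 0 < 1 / (c * l ^ β) := fun l hl β => by
    have := Real.rpow_pos_of_pos hl β
    positivity
  have hKi : ∀ l > 0, IntegrableOn (fun x => Real.exp (-l * x) * kern α c x) (Ioi 0) := fun l hl =>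
    integrable_of_integral_pos (by rw [laplace_kern hα0 hc hl]; exact hp l hl α)
  have hIi : ∀ l > 0, IntegrableOn (fun x => Real.exp (-l * x) * kernInt α c x) (Ioi 0) :=
    fun l hl => integrable_of_integral_pos
      (by rw [laplace_kernInt hα0 hc hl]; exact hp l hl (1 + α))
  have hcv : ∀ l x, ∫ t in (0 : ℝ)..x, (ContinuousLinearMap.mul ℝ ℝ (Real.exp (-l * t) * W t))
      (Real.exp (-l * (x - t)) * kern α c (x - t)) = Real.exp (-l * x) * conv (kern α c) W x := by
    intro l x
    rw [conv, ← intervalIntegral.integral_const_mul]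
    refine intervalIntegral.integral_congr fun t _ => ?_
    have : Real.exp (-l * x) = Real.exp (-l * t) * Real.exp (-l * (x - t)) := by
      rw [← Real.exp_add]; congr 1; ring
    simp only [ContinuousLinearMap.mul_apply', smul_eq_mul, this]; ring
  have hCi : ∀ l > 0, IntegrableOn (fun x => Real.exp (-l * x) * conv (kern α c) W x) (Ioi 0) := by
    intro l hl
    have := integrable_posConvolution (hWi l hl) (hKi l hl) (ContinuousLinearMap.mul ℝ ℝ)
    rw [posConvolution, integrable_indicator_iff measurableSet_Ioi] at this
    simpa only [hcv] using this
  have hCe : ∀ l > 0, ∫ x in Ioi (0 : ℝ), Real.exp (-l * x) * conv (kern α c) W x =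
      1 / laplaceExponent α b c l * (1 / (c * l ^ α)) := by
    intro l hl
    have := integral_posConvolution (hWi l hl) (hKi l hl) (ContinuousLinearMap.mul ℝ ℝ)
    simp only [hcv] at this
    rw [this, hW.laplace l hl, laplace_kern hα0 hc hl]
    rfl
  have e : ∀ l x, Real.exp (-l * x) * (W x + b * conv (kern α c) W x - kernInt α c x) =
      Real.exp (-l * x) * W x + b * (Real.exp (-l * x) * conv (kern α c) W x)
        - Real.exp (-l * x) * kernInt α c x := fun l x => by ring
  -- The transform of a convolution is the product of the transforms, so the claim becomes `1/Φ + b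
  -- * (1/Φ) * 1/(c l^α) = 1/(c l^(1+α))`.
  refine ae_eq_zero_of_laplace_eq_zero (fun l hl => ?_) (fun l hl => ?_)
  · simp_rw [e]
    exact ((hWi l hl).add ((hCi l hl).const_mul b)).sub (hIi l hl)
  · simp_rw [e]
    rw [integral_sub, integral_add, integral_const_mul, hW.laplace l hl, hCe l hl,
      laplace_kernInt hα0 hc hl]
    · have h1 := (hΦ l hl).ne'
      have h2 := (Real.rpow_pos_of_pos hl α).ne'
      have h3 : l ^ (1 + α) = l * l ^ α := by rw [Real.rpow_add hl, Real.rpow_one]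
      rw [h3]
      have h4 : laplaceExponent α b c l = b * l + c * (l * l ^ α) := by rw [laplaceExponent, h3]
      field_simp
      rw [h4]; ring
    · exact hWi l hl
    · exact (hCi l hl).const_mul b
    · exact (hWi l hl).add ((hCi l hl).const_mul b)
    · exact hIi l hl

end Kernel

/-! ### The scale function -/

lemma bounded_of_continuousOn_Ioi {E : Type*} [NormedAddCommGroup E] {f : ℝ → E}
    (hf : ContinuousOn f (Ioi 0)) {δ : ℝ} (hδ : 0 < δ) (T : ℝ) :
    ∃ M, ∀ s ∈ Icc δ T, ‖f s‖ ≤ M :=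
  isCompact_Icc.exists_bound_of_continuousOn (hf.mono fun _ hx => hδ.trans_le hx.1)

/-- Absolute continuity only involves sums of distances of increments. The lemma serves for `W`
against `K`, for real and imaginary parts, and for complex primitives against the primitive of the
norm. -/
lemma absolutelyContinuousOnInterval_of_dist_le {X Y : Type*} [PseudoMetricSpace X]
    [PseudoMetricSpace Y] {f : ℝ → X} {g : ℝ → Y} {x y : ℝ}
    (hf : AbsolutelyContinuousOnInterval f x y)
    (h : ∀ u ∈ uIcc x y, ∀ v ∈ uIcc x y, dist (g u) (g v) ≤ dist (f u) (f v)) :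
    AbsolutelyContinuousOnInterval g x y := by
  rw [absolutelyContinuousOnInterval_iff] at hf ⊢
  intro ε hε
  obtain ⟨δ, hδ, h'⟩ := hf ε hε
  exact ⟨δ, hδ, fun E hE hE' => lt_of_le_of_lt (Finset.sum_le_sum fun i hi =>
    h _ (hE.1 i hi).1 _ (hE.1 i hi).2) (h' E hE hE')⟩

lemma conv_one_left {E : Type*} [NormedAddCommGroup E] [NormedSpace ℝ E] (h : ℝ → E) (t : ℝ) :
    conv (fun _ => 1) h t = ∫ s in (0 : ℝ)..t, h s := by simp [conv]

section Kernel

variable {α b c : ℝ}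

lemma conv_kern_one (t : ℝ) : conv (kern α c) (fun _ => (1 : ℝ)) t = kernInt α c t := by
  rw [conv_comm, conv_one_left, kernInt]

/-- The Riemann-Liouville kernels of orders `1 - α` and `α` convolve to the constant `1`. -/
lemma conv_kern_kern (hα0 : 0 < α) (hα1 : α < 1) (hc : 0 < c) {t : ℝ} (ht : 0 < t) :
    conv (kern (1 - α) (1 / c)) (kern α c) t = 1 := by
  have h := Complex.betaIntegral_scaled (α : ℂ) ((1 - α : ℝ) : ℂ) ht
  have hg := Complex.Gamma_mul_Gamma_eq_betaIntegral (s := (α : ℂ)) (t := ((1 - α : ℝ) : ℂ))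
    (by simpa using hα0) (by simpa using hα1)
  -- The two orders add up to `1`, so the scaled Beta integral loses its power of `t` and equals
  -- `Γ(α) Γ(1 - α) / Γ(1)`.
  have e1 : (α : ℂ) + ((1 - α : ℝ) : ℂ) = 1 := by push_cast; ring
  rw [e1, Complex.Gamma_one, one_mul] at hg
  rw [e1, sub_self, Complex.cpow_zero, one_mul, ← hg, Complex.Gamma_ofReal, Complex.Gamma_ofReal] at h
  have e2 : ∫ x in (0 : ℝ)..t, (x : ℂ) ^ ((α : ℂ) - 1) * ((t : ℂ) - x) ^ (((1 - α : ℝ) : ℂ) - 1) =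
      ((∫ x in (0 : ℝ)..t, x ^ (α - 1) * (t - x) ^ (1 - α - 1) : ℝ) : ℂ) := by
    rw [← intervalIntegral.integral_ofReal]
    refine intervalIntegral.integral_congr fun x hx => ?_
    rw [uIcc_of_le ht.le] at hx
    rw [Complex.ofReal_mul, Complex.ofReal_cpow hx.1, Complex.ofReal_cpow (by linarith [hx.2])]
    push_cast
    rfl
  rw [e2] at h
  have h' : ∫ x in (0 : ℝ)..t, x ^ (α - 1) * (t - x) ^ (1 - α - 1) =
      Real.Gamma α * Real.Gamma (1 - α) := by exact_mod_cast h
  have e3 : ∀ x, kern (1 - α) (1 / c) (t - x) • kern α c x =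
      (x ^ (α - 1) * (t - x) ^ (1 - α - 1)) * (Real.Gamma α * Real.Gamma (1 - α))⁻¹ := by
    intro x
    simp only [kern, smul_eq_mul]
    field_simp
  have g1 := Real.Gamma_pos_of_pos hα0
  have g2 := Real.Gamma_pos_of_pos (show 0 < 1 - α by linarith)
  rw [conv]
  simp_rw [e3]
  rw [intervalIntegral.integral_mul_const, h', mul_inv_cancel₀ (by positivity)]

lemma intervalIntegrable_kern_mul {h : ℝ → ℝ} (hα0 : 0 < α) {t : ℝ} (ht : 0 < t)
    (hh : IntervalIntegrable h volume 0 t) (hb : ∀ δ > 0, ∃ M, ∀ s ∈ Icc δ t, ‖h s‖ ≤ M) :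
    IntervalIntegrable (fun s => kern α c (t - s) * h s) volume 0 t :=
  conv_intervalIntegrable ht kern_continuousOn (kern_intervalIntegrable hα0 _ _) hh hb

lemma kernInt_hasDerivAt (hα0 : 0 < α) {x : ℝ} (hx : 0 < x) :
    HasDerivAt (kernInt α c) (kern α c x) x :=
  intervalIntegral.integral_hasDerivAt_right (kern_intervalIntegrable hα0 _ _)
    measurable_kern.stronglyMeasurable.stronglyMeasurableAtFilter
    (kern_continuousOn.continuousAt (Ioi_mem_nhds hx))

lemma kernInt_mono (hα0 : 0 < α) (hc : 0 < c) {x y : ℝ} (hx : 0 ≤ x) (hxy : x ≤ y) :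
    kernInt α c x ≤ kernInt α c y := by
  rw [kernInt_eq hα0 hc hx, kernInt_eq hα0 hc (hx.trans hxy)]
  have := Real.Gamma_pos_of_pos (show 0 < α + 1 by linarith)
  gcongr

end Kernel

namespace IsScaleFunction

variable {α b c : ℝ} {W : ℝ → ℝ}

lemma intervalIntegrable (hW : IsScaleFunction α b c W) {T : ℝ} (hT : 0 ≤ T) :
    IntervalIntegrable W volume 0 T :=
  (hW.continuousOn.mono (by rw [uIcc_of_le hT]; exact Icc_subset_Ici_self)).intervalIntegrable

lemma bounded (hW : IsScaleFunction α b c W) (T : ℝ) : ∃ M, ∀ s ∈ Icc 0 T, ‖W s‖ ≤ M :=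
  isCompact_Icc.exists_bound_of_continuousOn (hW.continuousOn.mono Icc_subset_Ici_self)

/-- Both sides are continuous on `(0, ∞)`, hence the almost everywhere identity holds at every
point. -/
lemma resolvent_of_pos (hα0 : 0 < α) (hb : 0 ≤ b) (hc : 0 < c) (hW : IsScaleFunction α b c W)
    {x : ℝ} (hx : 0 < x) : W x + b * conv (kern α c) W x = kernInt α c x := by
  have h1 := hW.ae_resolvent hα0 hb hc
  have hcc : ContinuousOn (conv (kern α c) W) (Ioi 0) :=
    conv_continuousOn kern_continuousOn (fun T _ => kern_intervalIntegrable hα0 _ _)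
      (fun T hT => hW.intervalIntegrable hT.le)
      (fun δ hδ T => bounded_of_continuousOn_Ioi (hW.continuousOn.mono Ioi_subset_Ici_self) hδ T)
  have h2 : EqOn (fun x => W x + b * conv (kern α c) W x - kernInt α c x) (fun _ => 0) (Ioi 0) := by
    refine Measure.eqOn_open_of_ae_eq (μ := volume) ?_ isOpen_Ioi ?_ continuousOn_const
    · rw [EventuallyEq, ae_restrict_iff' measurableSet_Ioi]; exact h1
    · exact ((hW.continuousOn.mono Ioi_subset_Ici_self).add (hcc.const_smul b)).sub
        (kernInt_continuous hα0).continuousOn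
  exact sub_eq_zero.1 (h2 hx)

/-- Let `x → 0+` in the resolvent equation: `K x → 0`, and `k * W` is bounded by a multiple of `K`,
since `W` is bounded on `[0, 1]`. -/
lemma map_zero (hα0 : 0 < α) (hb : 0 ≤ b) (hc : 0 < c) (hW : IsScaleFunction α b c W) :
    W 0 = 0 := by
  obtain ⟨M, hM⟩ := hW.bounded 1
  have h1 : Tendsto W (𝓝[>] 0) (𝓝 (W 0)) :=
    ((hW.continuousOn 0 self_mem_Ici).mono Ioi_subset_Ici_self).tendsto
  have hK : Tendsto (kernInt α c) (𝓝[>] 0) (𝓝 0) := by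
    have := ((kernInt_continuous (c := c) hα0).tendsto 0).mono_left
      (nhdsWithin_le_nhds (s := Ioi 0))
    rwa [kernInt_zero] at this
  have hC : Tendsto (conv (kern α c) W) (𝓝[>] 0) (𝓝 0) := by
    refine squeeze_zero_norm' (a := fun x => M * kernInt α c x) ?_ (by simpa using hK.const_mul M)
    filter_upwards [Ioc_mem_nhdsGT (zero_lt_one' ℝ)] with x hx
    rw [conv_eq_integral_comp_sub, kernInt, ← intervalIntegral.integral_const_mul]
    refine intervalIntegral.norm_integral_le_of_norm_le hx.1.le ?_
      ((kern_intervalIntegrable hα0 _ _).const_mul M)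
    refine Eventually.of_forall fun s hs => ?_
    rw [norm_smul, Real.norm_of_nonneg (kern_pos hα0 hc hs.1).le, mul_comm]
    exact mul_le_mul_of_nonneg_right (hM _ ⟨by linarith [hs.2], by linarith [hs.1, hx.2]⟩)
      (kern_pos hα0 hc hs.1).le
  have h2 : Tendsto W (𝓝[>] 0) (𝓝 0) := by
    have : Tendsto (fun x => kernInt α c x - b * conv (kern α c) W x) (𝓝[>] 0) (𝓝 0) := by
      simpa using hK.sub (hC.const_mul b)
    refine this.congr' ?_
    filter_upwards [self_mem_nhdsWithin] with x hx
    rw [← hW.resolvent_of_pos hα0 hb hc hx]; ring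
  exact tendsto_nhds_unique h1 h2

lemma resolvent (hα0 : 0 < α) (hb : 0 ≤ b) (hc : 0 < c) (hW : IsScaleFunction α b c W)
    {x : ℝ} (hx : 0 ≤ x) : W x + b * conv (kern α c) W x = kernInt α c x := by
  rcases hx.eq_or_lt with rfl | hx
  · simp [hW.map_zero hα0 hb hc, conv, kernInt_zero]
  · exact hW.resolvent_of_pos hα0 hb hc hx

lemma nonneg (hα0 : 0 < α) (hb : 0 ≤ b) (hc : 0 < c) (hW : IsScaleFunction α b c W) (x : ℝ) :
    0 ≤ W x := by
  rcases lt_or_ge x 0 with hx | hx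
  · exact (hW.zero_of_neg x hx).ge
  · rw [← hW.map_zero hα0 hb hc]
    exact hW.strictMonoOn.monotoneOn self_mem_Ici hx hx

lemma monotone (hα0 : 0 < α) (hb : 0 ≤ b) (hc : 0 < c) (hW : IsScaleFunction α b c W) :
    Monotone W := by
  intro x y hxy
  rcases lt_or_ge x 0 with hx | hx
  · rw [hW.zero_of_neg x hx]; exact hW.nonneg hα0 hb hc y
  · exact hW.strictMonoOn.monotoneOn hx (hx.trans hxy) hxy

lemma continuous (hα0 : 0 < α) (hb : 0 ≤ b) (hc : 0 < c) (hW : IsScaleFunction α b c W) :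
    Continuous W := by
  rw [← continuousOn_univ, ← Iic_union_Ici (a := (0 : ℝ))]
  refine ContinuousOn.union_of_isClosed ?_ hW.continuousOn isClosed_Iic isClosed_Ici
  refine continuousOn_const.congr (f := fun _ => (0 : ℝ)) fun x hx => ?_
  rcases (mem_Iic.1 hx).eq_or_lt with rfl | hx
  · exact hW.map_zero hα0 hb hc
  · exact hW.zero_of_neg x hx

/-- The increments of the scale function are dominated by those of the kernel primitive. -/
lemma sub_le (hα0 : 0 < α) (hb : 0 ≤ b) (hc : 0 < c) (hW : IsScaleFunction α b c W)
    {x y : ℝ} (hx : 0 ≤ x) (hxy : x ≤ y) : W y - W x ≤ kernInt α c y - kernInt α c x := by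
  rw [← hW.resolvent hα0 hb hc hx, ← hW.resolvent hα0 hb hc (hx.trans hxy)]
  have hi : ∀ z u v : ℝ, IntervalIntegrable (fun s => kern α c s • W (z - s)) volume u v :=
    fun z u v => (kern_intervalIntegrable hα0 _ _).mul_continuousOn
      ((hW.continuous hα0 hb hc).comp (by fun_prop)).continuousOn
  -- Once the difference is moved onto `W`, the convolution increases with time because `k ≥ 0` and
  -- `W` is nonnegative and monotone. The term with `b` in the resolvent equation can therefore only
  -- lower the increment of `W`.
  have hm : conv (kern α c) W x ≤ conv (kern α c) W y := by
    rw [conv_eq_integral_comp_sub, conv_eq_integral_comp_sub,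
      ← intervalIntegral.integral_add_adjacent_intervals (hi y 0 x) (hi y x y)]
    have h1 : ∫ s in (0 : ℝ)..x, kern α c s • W (x - s) ≤
        ∫ s in (0 : ℝ)..x, kern α c s • W (y - s) := by
      refine intervalIntegral.integral_mono_on_of_le_Ioo hx (hi _ _ _) (hi _ _ _) fun s hs => ?_
      exact mul_le_mul_of_nonneg_left (hW.monotone hα0 hb hc (by linarith))
        (kern_pos hα0 hc hs.1).le
    have h2 : 0 ≤ ∫ s in x..y, kern α c s • W (y - s) := by
      rw [intervalIntegral.integral_of_le hxy]
      refine setIntegral_nonneg measurableSet_Ioc fun s hs => ?_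
      exact mul_nonneg (kern_pos hα0 hc (hx.trans_lt hs.1)).le (hW.nonneg hα0 hb hc _)
    linarith
  have := mul_le_mul_of_nonneg_left hm hb
  linarith

lemma absolutelyContinuous (hα0 : 0 < α) (hb : 0 ≤ b) (hc : 0 < c) (hW : IsScaleFunction α b c W)
    {T : ℝ} (hT : 0 ≤ T) : AbsolutelyContinuousOnInterval W 0 T := by
  have hK : AbsolutelyContinuousOnInterval (kernInt α c) 0 T :=
    (kern_intervalIntegrable hα0 0 T).absolutelyContinuousOnInterval_intervalIntegral (by simp)
  have hw : ∀ x y : ℝ, 0 ≤ x → 0 ≤ y → dist (W x) (W y) ≤ dist (kernInt α c x) (kernInt α c y) := by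
    intro x y hx hy
    wlog hxy : x ≤ y generalizing x y
    · rw [dist_comm, dist_comm (kernInt α c x)]; exact this y x hy hx (le_of_not_ge hxy)
    rw [dist_comm, dist_comm (kernInt α c x), Real.dist_eq, Real.dist_eq,
      abs_of_nonneg (sub_nonneg.2 (hW.monotone hα0 hb hc hxy)),
      abs_of_nonneg (sub_nonneg.2 (kernInt_mono hα0 hc hx hxy))]
    exact hW.sub_le hα0 hb hc hx hxy
  refine absolutelyContinuousOnInterval_of_dist_le hK fun x hx y hy => ?_
  rw [uIcc_of_le hT] at hx hy
  exact hw _ _ hx.1 hy.1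

lemma deriv_intervalIntegrable (hα0 : 0 < α) (hb : 0 ≤ b) (hc : 0 < c)
    (hW : IsScaleFunction α b c W) {T : ℝ} (hT : 0 ≤ T) :
    IntervalIntegrable (deriv W) volume 0 T :=
  (hW.absolutelyContinuous hα0 hb hc hT).intervalIntegrable_deriv

lemma integral_deriv (hα0 : 0 < α) (hb : 0 ≤ b) (hc : 0 < c)
    (hW : IsScaleFunction α b c W) {T : ℝ} (hT : 0 ≤ T) :
    ∫ s in (0 : ℝ)..T, deriv W s = W T := by
  rw [(hW.absolutelyContinuous hα0 hb hc hT).integral_deriv_eq_sub, hW.map_zero hα0 hb hc, sub_zero]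

lemma deriv_nonneg (hα0 : 0 < α) (hb : 0 ≤ b) (hc : 0 < c) (hW : IsScaleFunction α b c W) (x : ℝ) :
    0 ≤ deriv W x := (hW.monotone hα0 hb hc).deriv_nonneg

/-- `K - W` is nondecreasing on `[0, ∞)`. Where `W` might fail to be differentiable, `deriv` is `0`
and the bound is trivial; it is needed before differentiability is known, to bound `W'` away from
`0`. -/
lemma deriv_le (hα0 : 0 < α) (hb : 0 ≤ b) (hc : 0 < c) (hW : IsScaleFunction α b c W) {x : ℝ}
    (hx : 0 < x) : deriv W x ≤ kern α c x := by
  by_cases hd : DifferentiableAt ℝ W x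
  · have h1 := ((kernInt_hasDerivAt (c := c) hα0 hx).sub hd.hasDerivAt)
    have h2 : MonotoneOn (kernInt α c - W) (Ici 0) := by
      intro u hu v hv huv
      have := hW.sub_le hα0 hb hc hu huv
      simp only [Pi.sub_apply]; linarith
    have h3 : 0 ≤ derivWithin (kernInt α c - W) (Ici 0) x := h2.derivWithin_nonneg
    rw [derivWithin_of_mem_nhds (Ici_mem_nhds hx), h1.deriv] at h3
    linarith
  · rw [deriv_zero_of_not_differentiableAt hd]; exact (kern_pos hα0 hc hx).le

lemma deriv_bounded (hα0 : 0 < α) (hb : 0 ≤ b) (hc : 0 < c) (hW : IsScaleFunction α b c W)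
    {δ : ℝ} (hδ : 0 < δ) (T : ℝ) : ∃ M, ∀ s ∈ Icc δ T, ‖deriv W s‖ ≤ M := by
  obtain ⟨M, hM⟩ := bounded_of_continuousOn_Ioi (kern_continuousOn (α := α) (c := c)) hδ T
  refine ⟨M, fun s hs => ?_⟩
  rw [Real.norm_of_nonneg (hW.deriv_nonneg hα0 hb hc s)]
  exact (hW.deriv_le hα0 hb hc (hδ.trans_le hs.1)).trans ((le_abs_self _).trans (hM s hs))

lemma conv_kern_deriv_continuousOn (hα0 : 0 < α) (hb : 0 ≤ b) (hc : 0 < c)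
    (hW : IsScaleFunction α b c W) : ContinuousOn (conv (kern α c) (deriv W)) (Ioi 0) :=
  conv_continuousOn kern_continuousOn (fun _ _ => kern_intervalIntegrable hα0 _ _)
    (fun _ hT => hW.deriv_intervalIntegrable hα0 hb hc hT.le)
    (fun _ hδ T => hW.deriv_bounded hα0 hb hc hδ T)

lemma conv_kern_deriv_intervalIntegrable (hα0 : 0 < α) (hb : 0 ≤ b) (hc : 0 < c)
    (hW : IsScaleFunction α b c W) {T : ℝ} (hT : 0 ≤ T) :
    IntervalIntegrable (conv (kern α c) (deriv W)) volume 0 T :=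
  conv_integrable hT (kern_intervalIntegrable hα0 _ _) (hW.deriv_intervalIntegrable hα0 hb hc hT)

/-- Write `W = 1 * W'` and move the factor `1` to the front by associativity. This shows `k * W` as
the primitive of `k * W'`, which is continuous on `(0, ∞)`, and so makes the resolvent equation
differentiable at each positive time. -/
lemma conv_kern (hα0 : 0 < α) (hb : 0 ≤ b) (hc : 0 < c)
    (hW : IsScaleFunction α b c W) {t : ℝ} (ht : 0 ≤ t) :
    conv (kern α c) W t = ∫ s in (0 : ℝ)..t, conv (kern α c) (deriv W) s := by
  have hR := hW.deriv_intervalIntegrable hα0 hb hc ht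
  have hbd : ∀ r ∈ Ioo 0 t, kernInt α c r ≤ kernInt α c t := fun r hr =>
    kernInt_mono hα0 hc hr.1.le hr.2.le
  have h1 : conv (kern α c) W t = conv (kern α c) (conv (fun _ => 1) (deriv W)) t :=
    conv_congr ht (fun _ _ => rfl) (Eventually.of_forall fun s hs => by
      rw [conv_one_left, hW.integral_deriv hα0 hb hc hs.1.le])
  rw [h1, ← conv_one_left, conv_assoc_of_bounded (M := kernInt α c t) ht measurable_kern
    measurable_const (fun x hx => (kern_pos hα0 hc hx).le) (fun _ _ => zero_le_one) ?_ ?_ hR,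
    conv_assoc_of_bounded (M := kernInt α c t) ht
    measurable_const measurable_kern (fun _ _ => zero_le_one)
    (fun x hx => (kern_pos hα0 hc hx).le) ?_ ?_ hR]
  · exact conv_congr ht (fun s _ => conv_comm _ _ _) (Eventually.of_forall fun _ _ => rfl)
  · intro r _; exact (kern_intervalIntegrable hα0 _ _).const_mul 1
  · intro r hr; rw [conv_comm, conv_kern_one]; exact hbd r hr
  · intro r _
    have := ((kern_intervalIntegrable (c := c) hα0 0 r).comp_sub_left r).symm
    simpa using this
  · intro r hr; rw [conv_kern_one]; exact hbd r hr

lemma hasDerivAt (hα0 : 0 < α) (hb : 0 ≤ b) (hc : 0 < c)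
    (hW : IsScaleFunction α b c W) {t : ℝ} (ht : 0 < t) :
    HasDerivAt W (kern α c t - b * conv (kern α c) (deriv W) t) t := by
  have hcont : ContinuousOn (conv (kern α c) (deriv W)) (Ioi 0) :=
    hW.conv_kern_deriv_continuousOn hα0 hb hc
  have h1 : HasDerivAt (fun t => ∫ s in (0 : ℝ)..t, conv (kern α c) (deriv W) s)
      (conv (kern α c) (deriv W) t) t :=
    intervalIntegral.integral_hasDerivAt_right
      (hW.conv_kern_deriv_intervalIntegrable hα0 hb hc ht.le)
      (hcont.stronglyMeasurableAtFilter isOpen_Ioi t ht)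
      (hcont.continuousAt (Ioi_mem_nhds ht))
  refine ((kernInt_hasDerivAt hα0 ht).sub (h1.const_mul b)).congr_of_eventuallyEq ?_
  filter_upwards [Ioi_mem_nhds ht] with x hx
  simp only [Pi.sub_apply]
  rw [← hW.conv_kern hα0 hb hc (mem_Ioi.1 hx).le, ← hW.resolvent hα0 hb hc (mem_Ioi.1 hx).le]
  ring

/-- The derivative of the scale function is the resolvent of the kernel. -/
lemma deriv_eq (hα0 : 0 < α) (hb : 0 ≤ b) (hc : 0 < c)
    (hW : IsScaleFunction α b c W) {t : ℝ} (ht : 0 < t) :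
    deriv W t = kern α c t - b * conv (kern α c) (deriv W) t :=
  (hW.hasDerivAt hα0 hb hc ht).deriv

lemma deriv_continuousOn (hα0 : 0 < α) (hb : 0 ≤ b) (hc : 0 < c)
    (hW : IsScaleFunction α b c W) : ContinuousOn (deriv W) (Ioi 0) :=
  (kern_continuousOn.sub ((hW.conv_kern_deriv_continuousOn hα0 hb hc).const_smul b)).congr
    fun _ hx => hW.deriv_eq hα0 hb hc hx

/-- Otherwise `W 1 = ∫_0^1 W' = 0`, against strict monotonicity. Such a point allows division by
`W'` in `SolvesVolterra.source_intervalIntegrable`. -/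
lemma exists_deriv_pos (hα0 : 0 < α) (hb : 0 ≤ b) (hc : 0 < c)
    (hW : IsScaleFunction α b c W) : ∃ x > 0, 0 < deriv W x := by
  by_contra! h
  have h1 := hW.integral_deriv hα0 hb hc zero_le_one
  have h2 : ∫ s in (0 : ℝ)..1, deriv W s = 0 := by
    rw [intervalIntegral.integral_of_le zero_le_one]
    refine integral_eq_zero_of_ae ?_
    filter_upwards [ae_restrict_mem measurableSet_Ioc] with s hs
    exact le_antisymm (h s hs.1) (hW.deriv_nonneg hα0 hb hc s)
  have h3 := hW.strictMonoOn self_mem_Ici (mem_Ici.2 zero_le_one) one_pos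
  rw [hW.map_zero hα0 hb hc, ← h1, h2] at h3
  exact lt_irrefl _ h3

/-- The fractional integral of order `1 - α` of the derivative of the scale function. -/
lemma conv_kern_compl_deriv (hα0 : 0 < α) (hα1 : α < 1) (hb : 0 ≤ b) (hc : 0 < c)
    (hW : IsScaleFunction α b c W) {t : ℝ} (ht : 0 < t) :
    conv (kern (1 - α) (1 / c)) (deriv W) t = 1 - b * W t := by
  have hα' : 0 < 1 - α := by linarith
  have hc' : 0 < 1 / c := by positivity
  have hR := hW.deriv_intervalIntegrable hα0 hb hc ht.le
  have h1 : conv (kern (1 - α) (1 / c)) (deriv W) t =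
      conv (kern (1 - α) (1 / c)) (fun s => kern α c s - b * conv (kern α c) (deriv W) s) t :=
    conv_congr ht.le (fun _ _ => rfl)
      (Eventually.of_forall fun s hs => hW.deriv_eq hα0 hb hc hs.1)
  -- Associativity and `κ * k = 1` turn the left side into `1 * W'`.
  have h2 : conv (kern (1 - α) (1 / c)) (conv (kern α c) (deriv W)) t = W t := by
    rw [conv_assoc_of_bounded (M := 1) ht.le measurable_kern measurable_kern
      (fun x hx => (kern_pos hα' hc' hx).le) (fun x hx => (kern_pos hα0 hc hx).le) ?_ ?_ hR]
    · rw [← hW.integral_deriv hα0 hb hc ht.le, ← conv_one_left]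
      exact conv_congr ht.le (fun s hs => conv_kern_kern hα0 hα1 hc hs.1)
        (Eventually.of_forall fun _ _ => rfl)
    · intro r hr
      exact intervalIntegrable_kern_mul hα' hr.1 (kern_intervalIntegrable hα0 _ _)
        fun δ hδ => bounded_of_continuousOn_Ioi kern_continuousOn hδ _
    · intro r hr; exact (conv_kern_kern hα0 hα1 hc hr.1).le
  rw [h1, ← h2, conv]
  simp_rw [smul_eq_mul, mul_sub]
  rw [intervalIntegral.integral_sub]
  · congr 1
    · exact conv_kern_kern hα0 hα1 hc ht
    · rw [conv, ← intervalIntegral.integral_const_mul]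
      refine intervalIntegral.integral_congr fun s _ => ?_
      simp only [smul_eq_mul]; ring
  · exact intervalIntegrable_kern_mul hα' ht (kern_intervalIntegrable hα0 _ _)
      fun δ hδ => bounded_of_continuousOn_Ioi kern_continuousOn hδ _
  · refine intervalIntegrable_kern_mul hα' ht
      ((hW.conv_kern_deriv_intervalIntegrable hα0 hb hc ht.le).const_mul b) fun δ hδ => ?_
    exact bounded_of_continuousOn_Ioi
      ((hW.conv_kern_deriv_continuousOn hα0 hb hc).const_smul b) hδ _

/-- The convolution of the derivative of the scale function with the kernel primitive. -/
lemma conv_deriv_kernInt (hα0 : 0 < α) (hb : 0 ≤ b) (hc : 0 < c)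
    (hW : IsScaleFunction α b c W) {t : ℝ} (ht : 0 ≤ t) :
    conv (deriv W) (kernInt α c) t = conv (kern α c) W t := by
  have hint : ∀ r ∈ Ioo 0 t, IntervalIntegrable (fun w => deriv W (r - w) * 1) volume 0 r := by
    intro r hr
    have := ((hW.deriv_intervalIntegrable hα0 hb hc hr.1.le).comp_sub_left r).symm
    simpa using this
  have e : ∀ s, 0 ≤ s → conv (deriv W) (fun _ => (1 : ℝ)) s = W s := fun s hs => by
    rw [conv_comm, conv_one_left, hW.integral_deriv hα0 hb hc hs]
  have h1 : conv (deriv W) (kernInt α c) t = conv (deriv W) (conv (fun _ => 1) (kern α c)) t :=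
    conv_congr ht (fun _ _ => rfl) (Eventually.of_forall fun s _ => by rw [conv_one_left, kernInt])
  rw [h1, conv_assoc_of_bounded (M := W t) ht (measurable_deriv W) measurable_const
    (fun x _ => hW.deriv_nonneg hα0 hb hc x) (fun _ _ => zero_le_one) hint ?_
    (kern_intervalIntegrable hα0 _ _), conv_comm (kern α c)]
  · exact conv_congr ht (fun s hs => e s hs.1.le) (Eventually.of_forall fun _ _ => rfl)
  · intro r hr; rw [e r hr.1.le]; exact hW.monotone hα0 hb hc hr.2.le

end IsScaleFunction

/-! ### The Levy measure and the operator `𝒱_α` -/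

section Levy

variable {α c : ℝ}

lemma measurable_levyDensity : Measurable fun y : ℝ =>
    ENNReal.ofReal (c * α * (α + 1) / Real.Gamma (1 - α) * y ^ (-α - 2)) := by fun_prop

lemma ae_levyMeasure_pos : ∀ᵐ y ∂(levyMeasure α c), 0 < y :=
  (withDensity_absolutelyContinuous _ _).ae_le (ae_restrict_mem measurableSet_Ioi)

instance : SigmaFinite (levyMeasure α c) := by
  unfold levyMeasure; infer_instance

/-- The value of `∫ min(y, r)^2 ν_α(dy)`, up to a factor `r ^ (1 - α)`. -/
def levyConst (α c : ℝ) : ℝ :=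
  c * α * (α + 1) / Real.Gamma (1 - α) * (1 / (1 - α) + 1 / (α + 1))

lemma levyFactor_nonneg (hα0 : 0 < α) (hα1 : α < 1) (hc : 0 < c) :
    0 ≤ c * α * (α + 1) / Real.Gamma (1 - α) := by
  have := Real.Gamma_pos_of_pos (show 0 < 1 - α by linarith)
  positivity

/-- Up to the constant of the density, the integrand is `y ^ (-α)` on `(0, r]`, integrable because
`α < 1`, and `r ^ 2 * y ^ (-α - 2)` beyond `r`. Both pieces scale like `r ^ (1 - α)`. -/
lemma levy_min_sq (hα0 : 0 < α) (hα1 : α < 1) (hc : 0 < c) {r : ℝ} (hr : 0 < r) :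
    Integrable (fun y => (min y r) ^ 2) (levyMeasure α c) ∧
      ∫ y, (min y r) ^ 2 ∂(levyMeasure α c) = levyConst α c * r ^ (1 - α) := by
  set C := c * α * (α + 1) / Real.Gamma (1 - α) with hC
  have hC0 : 0 ≤ C := levyFactor_nonneg hα0 hα1 hc
  have hfin : ∀ᵐ y : ℝ ∂(volume.restrict (Ioi 0)), ENNReal.ofReal (C * y ^ (-α - 2)) < ∞ :=
    Eventually.of_forall fun _ => ENNReal.ofReal_lt_top
  have e1 : EqOn (fun y : ℝ => (ENNReal.ofReal (C * y ^ (-α - 2))).toReal • (min y r) ^ 2)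
      (fun y => C * y ^ (-α)) (Ioc 0 r) := by
    intro y hy
    simp only [smul_eq_mul]
    rw [ENNReal.toReal_ofReal (mul_nonneg hC0 (Real.rpow_nonneg hy.1.le _)), min_eq_left hy.2,
      mul_assoc, ← Real.rpow_natCast y 2, ← Real.rpow_add hy.1]
    congr 2; push_cast; ring
  have e2 : EqOn (fun y : ℝ => (ENNReal.ofReal (C * y ^ (-α - 2))).toReal • (min y r) ^ 2)
      (fun y => C * r ^ 2 * y ^ (-α - 2)) (Ioi r) := by
    intro y hy
    have hy0 : 0 < y := hr.trans hy
    simp only [smul_eq_mul]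
    rw [ENNReal.toReal_ofReal (mul_nonneg hC0 (Real.rpow_nonneg hy0.le _)),
      min_eq_right (mem_Ioi.1 hy).le]
    ring
  have i1 : IntegrableOn (fun y : ℝ => C * y ^ (-α)) (Ioc 0 r) :=
    (intervalIntegrable_iff_integrableOn_Ioc_of_le hr.le).1
      ((intervalIntegral.intervalIntegrable_rpow' (by linarith)).const_mul C)
  have i2 : IntegrableOn (fun y : ℝ => C * r ^ 2 * y ^ (-α - 2)) (Ioi r) :=
    (integrableOn_Ioi_rpow_of_lt (by linarith) hr).const_mul _
  have j1 := i1.congr_fun e1.symm measurableSet_Ioc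
  have j2 := i2.congr_fun e2.symm measurableSet_Ioi
  constructor
  · rw [levyMeasure, integrable_withDensity_iff_integrable_smul' measurable_levyDensity hfin,
      ← Ioc_union_Ioi_eq_Ioi hr.le]
    exact j1.union j2
  · rw [levyMeasure, integral_withDensity_eq_integral_toReal_smul measurable_levyDensity hfin,
      ← Ioc_union_Ioi_eq_Ioi hr.le, setIntegral_union (by
        rw [Set.disjoint_left]; intro x hx hx'; exact absurd hx.2 (not_le.2 hx'))
        measurableSet_Ioi j1 j2, setIntegral_congr_fun measurableSet_Ioc e1,
      setIntegral_congr_fun measurableSet_Ioi e2, integral_const_mul, integral_const_mul,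
      ← intervalIntegral.integral_of_le hr.le, integral_rpow (Or.inl (by linarith)),
      integral_Ioi_rpow_of_lt (by linarith) hr, levyConst, ← hC,
      Real.zero_rpow (by linarith)]
    have h1 : r ^ (1 - α) = r ^ 2 * r ^ (-α - 2 + 1) := by
      rw [← Real.rpow_natCast r 2, ← Real.rpow_add hr]; congr 1; push_cast; ring
    have h2 : (-α + 1) = 1 - α := by ring
    have h3 : (-α - 2 + 1) = -(α + 1) := by ring
    rw [h2, h1, h3]
    have : (1 - α) ≠ 0 := by linarith
    have : (α + 1) ≠ 0 := by linarith
    field_simp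
    ring

end Levy

/-- The primitive of `v` which vanishes on the negative half line. -/
def primitive (v : ℝ → ℂ) (x : ℝ) : ℂ := ∫ r in (0 : ℝ)..(max x 0), v r

namespace IsAdmissible

variable {v : ℝ → ℂ}

lemma intervalIntegrable (hv : IsAdmissible v) {x y : ℝ} (hx : 0 ≤ x) (hy : 0 ≤ y) :
    IntervalIntegrable v volume x y := by
  have h0 : (0 : ℝ) < max x y + 1 := by positivity
  refine (hv.integrable _ h0).mono_set ?_
  rw [uIcc_of_le h0.le]
  exact uIcc_subset_Icc ⟨hx, by linarith [le_max_left x y]⟩ ⟨hy, by linarith [le_max_right x y]⟩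

lemma primitive_continuous (hv : IsAdmissible v) : Continuous (primitive v) := by
  have h : ContinuousOn (fun x => ∫ r in (0 : ℝ)..x, v r) (Ici 0) := by
    intro x hx
    have hx : 0 ≤ x := hx
    have h1 : ContinuousOn (fun x => ∫ r in (0 : ℝ)..x, v r) (uIcc 0 (x + 1)) := by
      refine intervalIntegral.continuousOn_primitive_interval ?_
      rw [uIcc_of_le (by linarith)]
      exact (intervalIntegrable_iff_integrableOn_Icc_of_le (by linarith)).1
        (hv.intervalIntegrable le_rfl (by linarith))
    rw [uIcc_of_le (by linarith)] at h1
    refine (h1 x ⟨hx, by linarith⟩).mono_of_mem_nhdsWithin ?_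
    rw [← Ici_inter_Iic]
    exact inter_mem self_mem_nhdsWithin
      (mem_nhdsWithin_of_mem_nhds (Iic_mem_nhds (by linarith)))
  exact h.comp_continuous (by fun_prop) fun x => mem_Ici.2 (le_max_right x 0)

lemma integral_eq (hv : IsAdmissible v) {t : ℝ} (ht : 0 ≤ t) (y : ℝ) :
    ∫ r in (max (t - y) 0)..t, v r = primitive v t - primitive v (t - y) := by
  rw [primitive, primitive, max_eq_left ht, intervalIntegral.integral_interval_sub_left
    (hv.intervalIntegrable le_rfl ht) (hv.intervalIntegrable le_rfl (le_max_right _ _))]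

/-- The function `𝒱_α v` is continuous on `(0, ∞)`. -/
lemma opV_continuousOn {α c : ℝ} (hα0 : 0 < α) (hα1 : α < 1) (hc : 0 < c) (hv : IsAdmissible v) :
    ContinuousOn (opV α c v) (Ioi 0) := by
  set φ : ℂ → ℂ := fun z => Complex.exp z - 1 - z with hφ
  have hφc : Continuous φ := by fun_prop
  have hφb : ∀ z, ‖φ z‖ ≤ ‖z‖ ^ 2 * Real.exp ‖z‖ := by
    intro z
    have := Complex.norm_exp_sub_sum_le_norm_mul_exp z 2
    simpa [Finset.sum_range_succ, hφ, sub_sub] using this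
  have hP := hv.primitive_continuous
  have heq : EqOn (opV α c v)
      (fun t => ∫ y, φ (primitive v t - primitive v (t - y)) ∂(levyMeasure α c)) (Ioi 0) := by
    intro t ht
    simp only [opV, hφ]
    simp_rw [hv.integral_eq (mem_Ioi.1 ht).le]
  refine ContinuousOn.congr ?_ heq
  intro t₀ ht₀
  have ht₀ : 0 < t₀ := ht₀
  refine ContinuousAt.continuousWithinAt ?_
  obtain ⟨C, hC⟩ := bounded_of_continuousOn_Ioi hv.continuousOn
    (show 0 < t₀ / 4 by positivity) (2 * t₀)
  set I := ∫ r in (0 : ℝ)..(2 * t₀), ‖v r‖ with hI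
  have hI0 : 0 ≤ I := intervalIntegral.integral_nonneg (by linarith) fun _ _ => norm_nonneg _
  have hPI : ∀ x ≤ 2 * t₀, ‖primitive v x‖ ≤ I := by
    intro x hx
    refine (intervalIntegral.norm_integral_le_integral_norm (le_max_right x 0)).trans ?_
    refine intervalIntegral.integral_mono_interval le_rfl (le_max_right x 0)
      (max_le hx (by linarith)) (Eventually.of_forall fun _ => norm_nonneg _)
      (hv.intervalIntegrable le_rfl (by linarith)).norm
  -- For `y ≤ t₀ / 4` the interval `(t - y, t)` stays above `t₀ / 4`, where `v` is bounded by `C`.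
  -- For larger `y` the increment of the primitive is at most `2 * I`. So `D * min y (t₀ / 4)`
  -- bounds both cases, and `‖exp z - 1 - z‖ ≤ ‖z‖² exp ‖z‖` yields a dominating function that is
  -- integrable for the Levy measure.
  set D := max C (2 * I / (t₀ / 4)) with hD
  have hD0 : 0 ≤ D := le_max_of_le_right (by positivity)
  have hnear : ∀ᶠ t in 𝓝 t₀, t ∈ Ioo (t₀ / 2) (2 * t₀) :=
    Ioo_mem_nhds (by linarith) (by linarith)
  have hbound : ∀ t ∈ Ioo (t₀ / 2) (2 * t₀), ∀ y > 0,
      ‖primitive v t - primitive v (t - y)‖ ≤ D * min y (t₀ / 4) := by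
    intro t ht y hy
    rcases le_total y (t₀ / 4) with h | h
    · rw [min_eq_left h, ← hv.integral_eq (by linarith [ht.1]), max_eq_left (by linarith [ht.1])]
      refine (intervalIntegral.norm_integral_le_of_norm_le_const (C := D) fun x hx => ?_).trans
        (le_of_eq ?_)
      · rw [uIoc_of_le (by linarith)] at hx
        exact (hC x ⟨by linarith [hx.1, ht.1], by linarith [hx.2, ht.2]⟩).trans (le_max_left _ _)
      · congr 1
        rw [sub_sub_cancel, abs_of_pos hy]
    · rw [min_eq_right h]
      calc ‖primitive v t - primitive v (t - y)‖ ≤ I + I :=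
            (norm_sub_le _ _).trans (add_le_add (hPI _ ht.2.le) (hPI _ (by linarith [ht.2])))
        _ = 2 * I / (t₀ / 4) * (t₀ / 4) := by field_simp; ring
        _ ≤ D * (t₀ / 4) := mul_le_mul_of_nonneg_right (le_max_right _ _) (by positivity)
  have hint := ((levy_min_sq hα0 hα1 hc (show 0 < t₀ / 4 by positivity)).1.const_mul
    (D ^ 2 * Real.exp (D * (t₀ / 4))))
  refine continuousAt_of_dominated (Eventually.of_forall fun t => ?_) ?_ hint ?_
  · exact (hφc.comp (by fun_prop)).aestronglyMeasurable
  · filter_upwards [hnear] with t ht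
    filter_upwards [ae_levyMeasure_pos] with y hy
    have h1 := hbound t ht y hy
    have h0 : 0 ≤ min y (t₀ / 4) := le_min hy.le (by positivity)
    refine (hφb _).trans ?_
    calc _ ≤ (D * min y (t₀ / 4)) ^ 2 * Real.exp (D * (t₀ / 4)) := by
          gcongr
          exact h1.trans (mul_le_mul_of_nonneg_left (min_le_right _ _) hD0)
      _ = _ := by ring
  · refine Eventually.of_forall fun y => ?_
    exact (hφc.comp (by fun_prop)).continuousAt

end IsAdmissible

/-! ### The Volterra equation and the fractional Riccati equation -/

lemma rlIntegral_eq_conv (ρ a : ℝ) (v : ℝ → ℂ) : rlIntegral ρ a v = conv (kern ρ a) v := by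
  ext t
  rw [rlIntegral, conv, ← intervalIntegral.integral_const_mul]
  refine intervalIntegral.integral_congr fun s _ => ?_
  simp only [kern, Complex.real_smul]
  push_cast
  ring

lemma rlDeriv_eq_deriv (α : ℝ) {c : ℝ} (hc : 0 < c) (v : ℝ → ℂ) (t : ℝ) :
    rlDeriv α c v t = deriv (rlIntegral (1 - α) (1 / c) v) t := by
  have e : rlIntegral (1 - α) (1 / c) v = fun r => ((c / Real.Gamma (1 - α) : ℝ) : ℂ) *
      ∫ s in (0 : ℝ)..r, (((r - s) ^ (-α) : ℝ) : ℂ) * v s := by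
    ext r
    rw [rlIntegral]
    have h1 : 1 - α - 1 = -α := by ring
    have h2 : 1 / (1 / c * Real.Gamma (1 - α)) = c / Real.Gamma (1 - α) := by field_simp
    rw [h1, h2]
  rw [e, rlDeriv, deriv_const_mul_field]

/-- The increments are dominated by those of the real primitive of `‖f‖`. -/
lemma absolutelyContinuous_complex_integral {f : ℝ → ℂ} {T : ℝ}
    (hf : IntervalIntegrable f volume 0 T) (hT : 0 ≤ T) (z : ℂ) :
    AbsolutelyContinuousOnInterval (fun x => z + ∫ s in (0 : ℝ)..x, f s) 0 T := by
  have hn := hf.norm.absolutelyContinuousOnInterval_intervalIntegral (c := 0) (by simp)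
  refine absolutelyContinuousOnInterval_of_dist_le hn fun u hu w hw => ?_
  wlog h : u ≤ w generalizing u w
  · rw [dist_comm, dist_comm (∫ v in (0 : ℝ)..u, ‖f v‖)]; exact this w hw u hu (le_of_not_ge h)
  rw [uIcc_of_le hT] at hu hw
  have hsub : ∀ x ∈ Icc 0 T, IntervalIntegrable f volume 0 x := fun x hx =>
    hf.mono_set (by rw [uIcc_of_le hT, uIcc_of_le hx.1]; exact Icc_subset_Icc_right hx.2)
  rw [dist_comm, dist_comm (∫ v in (0 : ℝ)..u, ‖f v‖), dist_add_left, dist_eq_norm, dist_eq_norm,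
    intervalIntegral.integral_interval_sub_left (hsub _ hw) (hsub _ hu),
    intervalIntegral.integral_interval_sub_left (hsub _ hw).norm (hsub _ hu).norm]
  exact (intervalIntegral.norm_integral_le_integral_norm h).trans (Real.le_norm_self _)

/-- The real fundamental theorem applies to the real and imaginary parts, which inherit absolute
continuity and are differentiable almost everywhere. -/
lemma AbsolutelyContinuousOnInterval.complex_deriv {f : ℝ → ℂ} {T : ℝ}
    (hf : AbsolutelyContinuousOnInterval f 0 T) :
    IntervalIntegrable (deriv f) volume 0 T ∧ ∫ s in (0 : ℝ)..T, deriv f s = f T - f 0 := by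
  have hre : AbsolutelyContinuousOnInterval (fun x => (f x).re) 0 T :=
    absolutelyContinuousOnInterval_of_dist_le hf fun u _ w _ => by
      rw [Real.dist_eq, ← Complex.sub_re, dist_eq_norm]; exact Complex.abs_re_le_norm _
  have him : AbsolutelyContinuousOnInterval (fun x => (f x).im) 0 T :=
    absolutelyContinuousOnInterval_of_dist_le hf fun u _ w _ => by
      rw [Real.dist_eq, ← Complex.sub_im, dist_eq_norm]; exact Complex.abs_im_le_norm _
  have hae : ∀ᵐ x : ℝ, x ∈ uIoc 0 T → ((deriv (fun x => (f x).re) x : ℝ) : ℂ) +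
      ((deriv (fun x => (f x).im) x : ℝ) : ℂ) * Complex.I = deriv f x := by
    filter_upwards [hre.ae_differentiableAt, him.ae_differentiableAt] with x h1 h2 hx
    have hx' := uIoc_subset_uIcc hx
    have d1 := (h1 hx').hasDerivAt.ofReal_comp
    have d2 := ((h2 hx').hasDerivAt.ofReal_comp).mul_const Complex.I
    have := d1.add d2
    have e : ((fun y => (((f y).re : ℝ) : ℂ)) + fun y => (((f y).im : ℝ) : ℂ) * Complex.I) = f := by
      ext y; exact Complex.re_add_im _
    rw [e] at this
    exact this.deriv.symm
  have i1 : IntervalIntegrable (fun x => ((deriv (fun x => (f x).re) x : ℝ) : ℂ)) volume 0 T :=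
    ⟨hre.intervalIntegrable_deriv.1.ofReal, hre.intervalIntegrable_deriv.2.ofReal⟩
  have i2 : IntervalIntegrable (fun x => ((deriv (fun x => (f x).im) x : ℝ) : ℂ) * Complex.I)
    volume 0 T := IntervalIntegrable.mul_const
      ⟨him.intervalIntegrable_deriv.1.ofReal, him.intervalIntegrable_deriv.2.ofReal⟩ _
  constructor
  · refine (i1.add i2).congr_ae ?_
    rw [EventuallyEq, ae_restrict_iff' measurableSet_uIoc]
    exact hae
  · rw [← intervalIntegral.integral_congr_ae hae, intervalIntegral.integral_add i1 i2,
      intervalIntegral.integral_mul_const, intervalIntegral.integral_ofReal,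
      intervalIntegral.integral_ofReal, hre.integral_deriv_eq_sub, him.integral_deriv_eq_sub]
    apply Complex.ext <;> simp

lemma eqOn_of_integral_eq {f h : ℝ → ℂ} (hf : ContinuousOn f (Ioi 0)) (hh : ContinuousOn h (Ioi 0))
    (hfi : ∀ T > 0, IntervalIntegrable f volume 0 T)
    (hhi : ∀ T > 0, IntervalIntegrable h volume 0 T)
    (he : ∀ t > 0, ∫ s in (0 : ℝ)..t, f s = ∫ s in (0 : ℝ)..t, h s) :
    EqOn f h (Ioi 0) := by
  intro t ht
  have d : ∀ {k : ℝ → ℂ}, ContinuousOn k (Ioi 0) → (∀ T > 0, IntervalIntegrable k volume 0 T) →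
      HasDerivAt (fun x => ∫ s in (0 : ℝ)..x, k s) (k t) t := fun hk hki =>
    intervalIntegral.integral_hasDerivAt_right (hki t ht)
      (hk.stronglyMeasurableAtFilter isOpen_Ioi t ht) (hk.continuousAt (Ioi_mem_nhds ht))
  refine (d hf hfi).unique ((d hh hhi).congr_of_eventuallyEq ?_)
  filter_upwards [Ioi_mem_nhds ht] with x hx using he x hx

section Integrated

variable {α b c : ℝ} {W : ℝ → ℝ} {lam : ℂ} {F v : ℝ → ℂ}

namespace IsScaleFunction

lemma conv_deriv_one (hα0 : 0 < α) (hb : 0 ≤ b) (hc : 0 < c) (hW : IsScaleFunction α b c W)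
    {t : ℝ} (ht : 0 ≤ t) : conv (deriv W) (fun _ => (1 : ℝ)) t = W t := by
  rw [conv_comm, conv_one_left, hW.integral_deriv hα0 hb hc ht]

lemma integral_conv_deriv (hα0 : 0 < α) (hb : 0 ≤ b) (hc : 0 < c) (hW : IsScaleFunction α b c W)
    {t : ℝ} (ht : 0 ≤ t) (hF : IntervalIntegrable F volume 0 t) :
    ∫ s in (0 : ℝ)..t, conv (deriv W) F s = conv W F t := by
  rw [← conv_one_left, conv_assoc_of_bounded (M := W t) ht measurable_const (measurable_deriv W)
    (fun _ _ => zero_le_one) (fun x _ => hW.deriv_nonneg hα0 hb hc x) ?_ ?_ hF]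
  · refine conv_congr ht (fun s hs => ?_) (Eventually.of_forall fun _ _ => rfl)
    rw [conv_one_left, hW.integral_deriv hα0 hb hc hs.1.le]
  · intro r hr; exact (hW.deriv_intervalIntegrable hα0 hb hc hr.1.le).const_mul 1
  · intro r hr
    rw [conv_one_left, hW.integral_deriv hα0 hb hc hr.1.le]
    exact hW.monotone hα0 hb hc hr.2.le

lemma conv_deriv_integral (hα0 : 0 < α) (hb : 0 ≤ b) (hc : 0 < c) (hW : IsScaleFunction α b c W)
    {t : ℝ} (ht : 0 ≤ t) (hF : IntervalIntegrable F volume 0 t) :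
    conv (deriv W) (fun s => ∫ r in (0 : ℝ)..s, F r) t = conv W F t := by
  have h1 : (fun s => ∫ r in (0 : ℝ)..s, F r) = conv (fun _ => 1) F := by
    ext s; rw [conv_one_left]
  rw [h1, conv_assoc_of_bounded (M := W t) ht (measurable_deriv W) measurable_const
    (fun x _ => hW.deriv_nonneg hα0 hb hc x) (fun _ _ => zero_le_one) ?_ ?_ hF]
  · refine conv_congr ht (fun s hs => ?_) (Eventually.of_forall fun _ _ => rfl)
    rw [hW.conv_deriv_one hα0 hb hc hs.1.le]
  · intro r hr
    have := ((hW.deriv_intervalIntegrable hα0 hb hc hr.1.le).comp_sub_left r).symm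
    simpa using this
  · intro r hr
    rw [hW.conv_deriv_one hα0 hb hc hr.1.le]
    exact hW.monotone hα0 hb hc hr.2.le

lemma integrable_conv (hα0 : 0 < α) (hb : 0 ≤ b) (hc : 0 < c) (hW : IsScaleFunction α b c W)
    {t : ℝ} (hF : IntervalIntegrable F volume 0 t) :
    IntervalIntegrable (fun s => W (t - s) • F s) volume 0 t :=
  hF.continuousOn_smul ((hW.continuous hα0 hb hc).comp (by fun_prop)).continuousOn

lemma integral_smul_deriv (hα0 : 0 < α) (hb : 0 ≤ b) (hc : 0 < c) (hW : IsScaleFunction α b c W)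
    {t : ℝ} (ht : 0 ≤ t) (z : ℂ) : ∫ s in (0 : ℝ)..t, deriv W s • z = W t • z := by
  rw [intervalIntegral.integral_smul_const, hW.integral_deriv hα0 hb hc ht]

lemma conv_deriv_const (hα0 : 0 < α) (hb : 0 ≤ b) (hc : 0 < c) (hW : IsScaleFunction α b c W)
    {t : ℝ} (ht : 0 ≤ t) (z : ℂ) : conv (deriv W) (fun _ => z) t = W t • z := by
  rw [conv_eq_integral_comp_sub, hW.integral_smul_deriv hα0 hb hc ht]

/-- Both orders of the triple convolution reduce to `(κ * W') * F = (1 - b W) * F`; associativity is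
available since `κ * W' ≤ 1`. The first order serves the passage from the Volterra equation to the
integrated one, the second the converse. -/
lemma conv_kern_compl_conv_deriv (hα0 : 0 < α) (hα1 : α < 1) (hb : 0 ≤ b) (hc : 0 < c)
    (hW : IsScaleFunction α b c W) {t : ℝ} (ht : 0 < t) (hF : IntervalIntegrable F volume 0 t) :
    conv (kern (1 - α) (1 / c)) (conv (deriv W) F) t =
      (∫ s in (0 : ℝ)..t, F s) - b • conv W F t ∧
    conv (deriv W) (conv (kern (1 - α) (1 / c)) F) t =
      (∫ s in (0 : ℝ)..t, F s) - b • conv W F t := by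
  have hα' : 0 < 1 - α := by linarith
  have hc' : 0 < 1 / c := by positivity
  have e : ∀ f : ℝ → ℝ, (∀ s ∈ Ioo 0 t, f s = 1 - b * W s) →
      conv f F t = (∫ s in (0 : ℝ)..t, F s) - b • conv W F t := by
    intro f hf
    rw [conv_congr (f' := fun s => 1 - b * W s) ht.le hf (Eventually.of_forall fun _ _ => rfl),
      conv, conv]
    simp_rw [sub_smul, one_smul, mul_smul]
    have hbF : IntervalIntegrable (fun s => b • W (t - s) • F s) volume 0 t :=
      (hW.integrable_conv hα0 hb hc hF).smul b
    rw [intervalIntegral.integral_sub hF hbF, intervalIntegral.integral_smul]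
  have hle : ∀ r, 1 - b * W r ≤ 1 := fun r => by
    have := mul_nonneg hb (hW.nonneg hα0 hb hc r); linarith
  constructor
  · rw [conv_assoc_of_bounded (M := 1) ht.le measurable_kern (measurable_deriv W)
      (fun x hx => (kern_pos hα' hc' hx).le) (fun x _ => hW.deriv_nonneg hα0 hb hc x) ?_ ?_ hF]
    · exact e _ fun s hs => hW.conv_kern_compl_deriv hα0 hα1 hb hc hs.1
    · intro r hr
      exact intervalIntegrable_kern_mul hα' hr.1 (hW.deriv_intervalIntegrable hα0 hb hc hr.1.le)
        fun δ hδ => hW.deriv_bounded hα0 hb hc hδ _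
    · intro r hr; rw [hW.conv_kern_compl_deriv hα0 hα1 hb hc hr.1]; exact hle r
  · rw [conv_assoc_of_bounded (M := 1) ht.le (measurable_deriv W) measurable_kern
      (fun x _ => hW.deriv_nonneg hα0 hb hc x) (fun x hx => (kern_pos hα' hc' hx).le) ?_ ?_ hF]
    · exact e _ fun s hs => by rw [conv_comm, hW.conv_kern_compl_deriv hα0 hα1 hb hc hs.1]
    · intro r hr
      exact conv_intervalIntegrable hr.1 (hW.deriv_continuousOn hα0 hb hc)
        (hW.deriv_intervalIntegrable hα0 hb hc hr.1.le) (kern_intervalIntegrable hα' _ _)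
        fun δ hδ => bounded_of_continuousOn_Ioi kern_continuousOn hδ _
    · intro r hr; rw [conv_comm, hW.conv_kern_compl_deriv hα0 hα1 hb hc hr.1]; exact hle r

/-- The linear Volterra equation is equivalent to its fractional integral of order `1 - α`. -/
lemma volterra_iff (hα0 : 0 < α) (hα1 : α < 1) (hb : 0 ≤ b) (hc : 0 < c)
    (hW : IsScaleFunction α b c W) (hv : IsAdmissible v)
    (hF : ∀ T > 0, IntervalIntegrable F volume 0 T)
    (hFb : ∀ δ > 0, ∀ T, ∃ M, ∀ s ∈ Icc δ T, ‖F s‖ ≤ M) :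
    (∀ t > 0, v t = deriv W t • lam + conv (deriv W) F t) ↔
      ∀ t > 0, conv (kern (1 - α) (1 / c)) v t = lam + ∫ s in (0 : ℝ)..t, (F s - b • v s) := by
  have hα' : 0 < 1 - α := by linarith
  have hR : ∀ T > 0, IntervalIntegrable (deriv W) volume 0 T := fun T hT =>
    hW.deriv_intervalIntegrable hα0 hb hc hT.le
  have hRc := hW.deriv_continuousOn hα0 hb hc
  have hRFc : ContinuousOn (conv (deriv W) F) (Ioi 0) := conv_continuousOn hRc hR hF hFb
  have hRFi : ∀ T > 0, IntervalIntegrable (conv (deriv W) F) volume 0 T := fun T hT =>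
    conv_integrable hT.le (hR T hT) (hF T hT)
  have hRl : ∀ T > 0, IntervalIntegrable (fun s => deriv W s • lam) volume 0 T := fun T hT =>
    ⟨(hR T hT).1.smul_const lam, (hR T hT).2.smul_const lam⟩
  have hsumi : ∀ t > 0, ∫ s in (0 : ℝ)..t, (deriv W s • lam + conv (deriv W) F s) =
      W t • lam + conv W F t := fun t ht => by
    rw [intervalIntegral.integral_add (hRl t ht) (hRFi t ht), hW.integral_smul_deriv hα0 hb hc ht.le,
      hW.integral_conv_deriv hα0 hb hc ht.le (hF t ht)]
  constructor
  -- Convolving with `κ` gives `(1 - b W) λ + ∫ F - b (W * F)`, while integrating the equation gives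
  -- `∫ v = W λ + W * F`; the terms with `b` combine to `-b ∫ v`.
  · intro h t ht
    have hvi := hv.integrable t ht
    have e1 : conv (kern (1 - α) (1 / c)) v t = (1 - b * W t) • lam +
        conv (kern (1 - α) (1 / c)) (conv (deriv W) F) t := by
      rw [conv_congr (h' := fun s => deriv W s • lam + conv (deriv W) F s) ht.le (fun _ _ => rfl)
        (Eventually.of_forall fun s hs => h s hs.1)]
      rw [conv]
      simp_rw [smul_add]
      rw [intervalIntegral.integral_add]
      · congr 1
        rw [← hW.conv_kern_compl_deriv hα0 hα1 hb hc ht, conv,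
          ← intervalIntegral.integral_smul_const]
        simp only [smul_assoc]
      · exact conv_intervalIntegrable ht kern_continuousOn (kern_intervalIntegrable hα' _ _)
          (hRl t ht) fun δ hδ => bounded_of_continuousOn_Ioi (hRc.smul continuousOn_const) hδ _
      · exact conv_intervalIntegrable ht kern_continuousOn (kern_intervalIntegrable hα' _ _)
          (hRFi t ht) fun δ hδ => bounded_of_continuousOn_Ioi hRFc hδ _
    have e2 : ∫ s in (0 : ℝ)..t, v s = W t • lam + conv W F t := by
      rw [← hsumi t ht]
      refine intervalIntegral.integral_congr_ae (Eventually.of_forall fun s hs => ?_)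
      rw [uIoc_of_le ht.le] at hs
      exact h s hs.1
    have hbv : IntervalIntegrable (fun s => b • v s) volume 0 t := hvi.smul b
    rw [e1, (hW.conv_kern_compl_conv_deriv hα0 hα1 hb hc ht (hF t ht)).1,
      intervalIntegral.integral_sub (hF t ht) hbv, intervalIntegral.integral_smul, e2]
    simp only [Complex.real_smul]; push_cast; ring
  -- Convolving with `W'` gives `∫ v - b (W * v) = W λ + W * F - b (W * v)`. After cancellation both
  -- sides are primitives of functions continuous on `(0, ∞)`, so the integrands agree.
  · intro h
    refine fun t ht => eqOn_of_integral_eq (h := fun s => deriv W s • lam + conv (deriv W) F s)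
      hv.continuousOn ((hRc.smul continuousOn_const).add hRFc) hv.integrable
      (fun T hT => (hRl T hT).add (hRFi T hT)) (fun t ht => ?_) ht
    have hvi := hv.integrable t ht
    have hG : IntervalIntegrable (fun s => F s - b • v s) volume 0 t :=
      (hF t ht).sub (hvi.smul b)
    rw [hsumi t ht]
    have e1 := (hW.conv_kern_compl_conv_deriv hα0 hα1 hb hc ht hvi).2
    rw [conv_congr (h' := fun t => lam + ∫ s in (0 : ℝ)..t, (F s - b • v s)) ht.le (fun _ _ => rfl)
        (Eventually.of_forall fun s hs => h s hs.1)] at e1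
    have e2 : conv (deriv W) (fun t => lam + ∫ s in (0 : ℝ)..t, (F s - b • v s)) t =
        W t • lam + conv W (fun s => F s - b • v s) t := by
      rw [← hW.conv_deriv_const hα0 hb hc ht.le lam, ← hW.conv_deriv_integral hα0 hb hc ht.le hG]
      simp only [conv, smul_add]
      have hRr : IntervalIntegrable (fun s => deriv W (t - s)) volume 0 t := by
        have := ((hR t ht).comp_sub_left t).symm
        simpa using this
      refine intervalIntegral.integral_add ⟨hRr.1.smul_const lam, hRr.2.smul_const lam⟩
        (hRr.smul_continuousOn ?_)
      refine intervalIntegral.continuousOn_primitive_interval ?_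
      rw [uIcc_of_le ht.le]
      exact (intervalIntegrable_iff_integrableOn_Icc_of_le ht.le).1 hG
    have e3 : conv W (fun s => F s - b • v s) t = conv W F t - b • conv W v t := by
      simp only [conv, smul_sub]
      rw [intervalIntegral.integral_sub (hW.integrable_conv hα0 hb hc (hF t ht)),
        ← intervalIntegral.integral_smul]
      · simp only [smul_comm b]
      · exact hW.integrable_conv hα0 hb hc (hvi.smul b)
    rw [e2, e3] at e1
    linear_combination (-1 : ℂ) * e1

end IsScaleFunction

lemma intervalIntegrable_of_near_zero {f : ℝ → ℂ} {d : ℝ} (hd : 0 < d)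
    (h0 : IntervalIntegrable f volume 0 d) (hm : AEStronglyMeasurable f (volume.restrict (Ioi 0)))
    (hb : ∀ δ > 0, ∀ T, ∃ M, ∀ s ∈ Icc δ T, ‖f s‖ ≤ M) (T : ℝ) (hT : 0 < T) :
    IntervalIntegrable f volume 0 T := by
  have h1 : IntervalIntegrable f volume d (max d T) := by
    rw [intervalIntegrable_iff_integrableOn_Ioc_of_le (le_max_left _ _)]
    obtain ⟨M, hM⟩ := hb d hd (max d T)
    refine Integrable.mono' (g := fun _ => M) (integrable_const M)
      (hm.mono_measure (Measure.restrict_mono (fun x hx => hd.trans hx.1) le_rfl)) ?_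
    filter_upwards [ae_restrict_mem measurableSet_Ioc] with s hs
    exact hM s ⟨hs.1.le, hs.2⟩
  refine (h0.trans h1).mono_set ?_
  rw [uIcc_of_le hT.le, uIcc_of_le (hd.le.trans (le_max_left _ _))]
  exact Icc_subset_Icc_right (le_max_right _ _)

end Integrated

/-! ### Reduction of both nonlinear equations to one integrated equation -/

section Riccati

variable {α b c : ℝ} {W : ℝ → ℝ} {lam : ℂ} {g v : ℝ → ℂ}

lemma source_bounded (hα0 : 0 < α) (hα1 : α < 1) (hc : 0 < c)
    (hgb : ∃ M : ℝ, ∀ t ≥ 0, ‖g t‖ ≤ M) (hv : IsAdmissible v) {δ : ℝ} (hδ : 0 < δ) (T : ℝ) :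
    ∃ M, ∀ s ∈ Icc δ T, ‖g s + opV α c v s‖ ≤ M := by
  obtain ⟨M, hM⟩ := hgb
  obtain ⟨M', hM'⟩ := bounded_of_continuousOn_Ioi (hv.opV_continuousOn hα0 hα1 hc) hδ T
  exact ⟨M + M', fun s hs => (norm_add_le _ _).trans
    (add_le_add (hM s (hδ.le.trans hs.1)) (hM' s hs))⟩

lemma source_aestronglyMeasurable (hα0 : 0 < α) (hα1 : α < 1) (hc : 0 < c)
    (hg : Measurable g) (hv : IsAdmissible v) :
    AEStronglyMeasurable (fun s => g s + opV α c v s) (volume.restrict (Ioi 0)) :=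
  hg.aestronglyMeasurable.add
    ((hv.opV_continuousOn hα0 hα1 hc).aestronglyMeasurable measurableSet_Ioi)

lemma conv_deriv_source_eq (t : ℝ) :
    ∫ s in (0 : ℝ)..t, (g (t - s) + opV α c v (t - s)) * ((deriv W s : ℝ) : ℂ) =
      conv (deriv W) (fun s => g s + opV α c v s) t := by
  rw [conv_eq_integral_comp_sub]
  simp only [Complex.real_smul, mul_comm]

/-- Near a time `x` with `W' x > 0` the factor `W'` may be divided out. Convergence of the
convolution at that single time then makes the source integrable near `0`; away from `0` it is
locally bounded. -/
lemma SolvesVolterra.source_intervalIntegrable (hα0 : 0 < α) (hα1 : α < 1) (hb : 0 ≤ b)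
    (hc : 0 < c) (hW : IsScaleFunction α b c W) (hg : Measurable g)
    (hgb : ∃ M : ℝ, ∀ t ≥ 0, ‖g t‖ ≤ M) (h : SolvesVolterra α c W lam g v) (T : ℝ) (hT : 0 < T) :
    IntervalIntegrable (fun s => g s + opV α c v s) volume 0 T := by
  have hv := h.admissible
  obtain ⟨x, hx, hRx⟩ := hW.exists_deriv_pos hα0 hb hc
  have hRc := hW.deriv_continuousOn hα0 hb hc
  have hev : ∀ᶠ y in 𝓝 x, 0 < deriv W y :=
    (hRc.continuousAt (Ioi_mem_nhds hx)).eventually (lt_mem_nhds hRx)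
  obtain ⟨d, hd, hd'⟩ := Metric.eventually_nhds_iff.1 hev
  set e := min (d / 2) (x / 2) with he
  have he0 : 0 < e := by positivity
  have hed : e < d := (min_le_left _ _).trans_lt (by linarith)
  have hex : e < x := (min_le_right _ _).trans_lt (by linarith)
  refine intervalIntegrable_of_near_zero he0 ?_ (source_aestronglyMeasurable hα0 hα1 hc hg hv)
    (fun δ hδ T => source_bounded hα0 hα1 hc hgb hv hδ T) T hT
  have h1 : IntervalIntegrable
      (fun s => (g (x - s) + opV α c v (x - s)) * ((deriv W s : ℝ) : ℂ)) volume (x - e) x :=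
    (h.integrable x hx).mono_set (by
      rw [uIcc_of_le (by linarith), uIcc_of_le hx.le]; exact Icc_subset_Icc_left (by linarith))
  have hpos : ∀ s ∈ Icc (x - e) x, 0 < deriv W s := fun s hs => hd' (by
    rw [Real.dist_eq, abs_sub_comm, abs_of_nonneg (by linarith [hs.2])]; linarith [hs.1])
  have h2 : IntervalIntegrable (fun s => g (x - s) + opV α c v (x - s)) volume (x - e) x := by
    have h3 : ContinuousOn (fun s => (((deriv W s : ℝ) : ℂ))⁻¹) (uIcc (x - e) x) := by
      rw [uIcc_of_le (by linarith)]
      refine ContinuousOn.inv₀ ?_ fun s hs => ?_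
      · exact Complex.continuous_ofReal.comp_continuousOn
          (hRc.mono fun s hs => by simp only [mem_Ioi]; linarith [hs.1])
      · exact_mod_cast (hpos s hs).ne'
    refine (h1.mul_continuousOn h3).congr ?_
    intro s hs
    rw [uIoc_of_le (by linarith)] at hs
    have := (hpos s ⟨hs.1.le, hs.2⟩).ne'
    have h4 : ((deriv W s : ℝ) : ℂ) ≠ 0 := by exact_mod_cast this
    simp only []
    rw [mul_assoc, mul_inv_cancel₀ h4, mul_one]
  have h5 := (h2.comp_sub_left x).symm
  simpa using h5

/-- The right side is the meeting point of the two formulations and no longer mentions `W`. Once the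
source is known to be locally integrable, this is `IsScaleFunction.volterra_iff`. -/
lemma solvesVolterra_iff (hα0 : 0 < α) (hα1 : α < 1) (hb : 0 ≤ b)
    (hc : 0 < c) (hW : IsScaleFunction α b c W) (hg : Measurable g)
    (hgb : ∃ M : ℝ, ∀ t ≥ 0, ‖g t‖ ≤ M) :
    SolvesVolterra α c W lam g v ↔ IsAdmissible v ∧
      (∀ T > 0, IntervalIntegrable (fun s => g s + opV α c v s) volume 0 T) ∧
      ∀ t > 0, conv (kern (1 - α) (1 / c)) v t =
        lam + ∫ s in (0 : ℝ)..t, (g s + opV α c v s - b • v s) := by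
  constructor
  · intro h
    have hv := h.admissible
    have hF := h.source_intervalIntegrable hα0 hα1 hb hc hW hg hgb
    refine ⟨hv, hF, (hW.volterra_iff hα0 hα1 hb hc hv hF
      (fun δ hδ T => source_bounded hα0 hα1 hc hgb hv hδ T)).1 fun t ht => ?_⟩
    rw [h.equation t ht, conv_deriv_source_eq, Complex.real_smul, mul_comm]
  · rintro ⟨hv, hF, h⟩
    have hFb : ∀ δ > 0, ∀ T, ∃ M, ∀ s ∈ Icc δ T, ‖g s + opV α c v s‖ ≤ M :=
      fun δ hδ T => source_bounded hα0 hα1 hc hgb hv hδ T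
    refine ⟨hv, fun t ht => ?_, fun t ht => ?_⟩
    · have h1 := conv_intervalIntegrable ht (hW.deriv_continuousOn hα0 hb hc)
        (hW.deriv_intervalIntegrable hα0 hb hc ht.le) (hF t ht) (fun δ hδ => hFb δ hδ t)
      have h2 := (h1.comp_sub_left t).symm
      simp only [sub_zero, sub_self, sub_sub_cancel] at h2
      simpa only [Complex.real_smul, mul_comm] using h2
    · rw [(hW.volterra_iff hα0 hα1 hb hc hv hF hFb).2 h t ht, conv_deriv_source_eq,
        Complex.real_smul, mul_comm]

/-- At a continuity point of `g` the integrand of the integrated equation is continuous, so the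
derivative exists classically. -/
lemma conv_kern_compl_hasDerivAt (hα0 : 0 < α) (hα1 : α < 1)
    (hc : 0 < c) (hg : Measurable g) (hv : IsAdmissible v)
    (hF : ∀ T > 0, IntervalIntegrable (fun s => g s + opV α c v s) volume 0 T)
    (h : ∀ t > 0, conv (kern (1 - α) (1 / c)) v t =
        lam + ∫ s in (0 : ℝ)..t, (g s + opV α c v s - b • v s))
    {t : ℝ} (ht : 0 < t) (hgt : ContinuousAt g t) :
    HasDerivAt (conv (kern (1 - α) (1 / c)) v) (g t + opV α c v t - b • v t) t := by
  have hm : AEStronglyMeasurable (fun s => g s + opV α c v s - b • v s)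
      (volume.restrict (Ioi 0)) :=
    (source_aestronglyMeasurable hα0 hα1 hc hg hv).sub
      ((hv.continuousOn.aestronglyMeasurable measurableSet_Ioi).const_smul b)
  have h1 : HasDerivAt (fun x => ∫ s in (0 : ℝ)..x, (g s + opV α c v s - b • v s))
      (g t + opV α c v t - b • v t) t :=
    intervalIntegral.integral_hasDerivAt_right ((hF t ht).sub ((hv.integrable t ht).smul b))
      ⟨Ioi 0, Ioi_mem_nhds ht, hm⟩
      ((hgt.add ((hv.opV_continuousOn hα0 hα1 hc).continuousAt (Ioi_mem_nhds ht))).sub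
        ((hv.continuousOn.continuousAt (Ioi_mem_nhds ht)).const_smul b))
  refine (h1.const_add lam).congr_of_eventuallyEq ?_
  filter_upwards [Ioi_mem_nhds ht] with x hx using h x hx

/-- An absolutely continuous function is the integral of its derivative; here the derivative is `F -
b v` almost everywhere, which also gives the integrability of the source `F`. Conversely a primitive
is absolutely continuous and is differentiable with the right derivative almost everywhere. -/
lemma solvesFractionalRiccati_iff (hc : 0 < c) :
    SolvesFractionalRiccati α b c lam g v ↔ IsAdmissible v ∧
      (∀ T > 0, IntervalIntegrable (fun s => g s + opV α c v s) volume 0 T) ∧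
      ∀ t > 0, conv (kern (1 - α) (1 / c)) v t =
        lam + ∫ s in (0 : ℝ)..t, (g s + opV α c v s - b • v s) := by
  constructor
  · intro h
    have hv := h.admissible
    set u := Function.update (rlIntegral (1 - α) (1 / c) v) 0 lam with hu
    have hud : ∀ t > 0, deriv u t = rlDeriv α c v t := fun t ht => by
      rw [rlDeriv_eq_deriv α hc]
      refine EventuallyEq.deriv_eq ?_
      filter_upwards [Ioi_mem_nhds ht] with x hx
      exact Function.update_of_ne (mem_Ioi.1 hx).ne' _ _
    have hae : ∀ T > 0, ∀ᵐ t : ℝ, t ∈ uIoc 0 T → deriv u t = g t + opV α c v t - b • v t := by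
      intro T hT
      have := (ae_restrict_iff' measurableSet_Ioi).1 h.equation
      filter_upwards [this] with t ht htT
      rw [uIoc_of_le hT.le] at htT
      rw [hud t htT.1, ht htT.1, Complex.real_smul]; ring
    have hac := fun T (hT : T > 0) =>
      AbsolutelyContinuousOnInterval.complex_deriv (h.absolutelyContinuous T hT)
    refine ⟨hv, fun T hT => ?_, fun t ht => ?_⟩
    · refine ((hac T hT).1.add ((hv.integrable T hT).smul b)).congr_ae ?_
      rw [EventuallyEq, ae_restrict_iff' measurableSet_uIoc]
      filter_upwards [hae T hT] with t ht htT
      rw [ht htT]; simp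
    · rw [← intervalIntegral.integral_congr_ae (hae t ht), (hac t ht).2,
        Function.update_self, Function.update_of_ne ht.ne', rlIntegral_eq_conv]
      ring
  · rintro ⟨hv, hF, h⟩
    have hG : ∀ T > 0, IntervalIntegrable (fun s => g s + opV α c v s - b • v s) volume 0 T :=
      fun T hT => (hF T hT).sub ((hv.integrable T hT).smul b)
    have hac := fun T (hT : T > 0) => absolutelyContinuous_complex_integral (hG T hT) hT.le lam
    refine ⟨hv, ?_, fun T hT => ?_, ?_⟩
    · rw [rlIntegral_eq_conv]
      have h1 := ((hac 1 one_pos).continuousOn 0 (by simp)).tendsto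
      rw [uIcc_of_le zero_le_one] at h1
      have h4 : 𝓝[>] (0 : ℝ) ≤ 𝓝[Icc 0 1] 0 := by
        rw [← nhdsWithin_Ioc_eq_nhdsGT (zero_lt_one' ℝ)]
        exact nhdsWithin_mono _ Ioc_subset_Icc_self
      have h2 := h1.mono_left h4
      simp only [intervalIntegral.integral_same, add_zero] at h2
      refine h2.congr' ?_
      filter_upwards [self_mem_nhdsWithin] with t ht using (h t ht).symm
    · refine absolutelyContinuousOnInterval_of_dist_le (hac T hT) ?_
      have e : ∀ x ∈ uIcc 0 T, Function.update (rlIntegral (1 - α) (1 / c) v) 0 lam x =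
          lam + ∫ s in (0 : ℝ)..x, (g s + opV α c v s - b • v s) := by
        intro x hx
        rw [uIcc_of_le hT.le] at hx
        rcases hx.1.eq_or_lt with rfl | hx0
        · simp
        · rw [Function.update_of_ne hx0.ne', rlIntegral_eq_conv, h x hx0]
      intro x hx y hy
      rw [e x hx, e y hy]
    · rw [ae_restrict_iff' measurableSet_Ioi]
      -- Lebesgue differentiation is stated on a bounded interval; the intervals `[0, n + 1]`
      -- exhaust the half line and contribute countably many null sets.
      have := ae_all_iff.2 fun n : ℕ => (hG (n + 1) (by positivity)).ae_hasDerivAt_integral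
      filter_upwards [this] with t ht ht0
      have ht0 : 0 < t := ht0
      obtain ⟨n, hn⟩ := exists_nat_gt t
      have hm : ∀ x, 0 ≤ x → x ≤ t → x ∈ uIcc (0 : ℝ) (n + 1) := fun x hx hxt => by
        rw [uIcc_of_le (by positivity)]; exact ⟨hx, by linarith⟩
      have h1 := (ht n (hm t ht0.le le_rfl) 0 (hm 0 le_rfl ht0.le)).const_add lam
      rw [rlDeriv_eq_deriv α hc, rlIntegral_eq_conv]
      have h2 : conv (kern (1 - α) (1 / c)) v =ᶠ[𝓝 t]
          fun x => lam + ∫ s in (0 : ℝ)..x, (g s + opV α c v s - b • v s) := by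
        filter_upwards [Ioi_mem_nhds ht0] with x hx using h x hx
      rw [h2.deriv_eq, h1.deriv, Complex.real_smul]; ring

/-- The Volterra equation and the fractional Riccati equation have the same solutions. -/
theorem solvesVolterra_iff_solvesFractionalRiccati (hα0 : 0 < α) (hα1 : α < 1) (hb : 0 ≤ b)
    (hc : 0 < c) (hW : IsScaleFunction α b c W) (hg : Measurable g)
    (hgb : ∃ M : ℝ, ∀ t ≥ 0, ‖g t‖ ≤ M) :
    SolvesVolterra α c W lam g v ↔ SolvesFractionalRiccati α b c lam g v := by
  rw [solvesVolterra_iff hα0 hα1 hb hc hW hg hgb, solvesFractionalRiccati_iff hc]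

theorem SolvesVolterra.differentiableAt (hα0 : 0 < α) (hα1 : α < 1) (hb : 0 ≤ b)
    (hc : 0 < c) (hW : IsScaleFunction α b c W) (hg : Measurable g)
    (hgb : ∃ M : ℝ, ∀ t ≥ 0, ‖g t‖ ≤ M) (h : SolvesVolterra α c W lam g v)
    {t : ℝ} (ht : 0 < t) (hgt : ContinuousAt g t) :
    DifferentiableAt ℝ (rlIntegral (1 - α) (1 / c) v) t ∧
      rlDeriv α c v t = -(b : ℂ) * v t + g t + opV α c v t := by
  obtain ⟨hv, hF, he⟩ := (solvesVolterra_iff hα0 hα1 hb hc hW hg hgb).1 h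
  have := conv_kern_compl_hasDerivAt hα0 hα1 hc hg hv hF he ht hgt
  rw [rlDeriv_eq_deriv α hc, rlIntegral_eq_conv]
  refine ⟨this.differentiableAt, ?_⟩
  rw [this.deriv, Complex.real_smul]; ring

end Riccati

/-! ### The time axis -/

/-- Lebesgue measure on `[0, ∞)`. -/
abbrev timeMeasure : Measure ℝ≥0 := (volume : Measure ℝ).comap ((↑) : ℝ≥0 → ℝ)

lemma measurableEmbedding_coe_nnreal : MeasurableEmbedding ((↑) : ℝ≥0 → ℝ) :=
  MeasurableEmbedding.subtype_coe (s := {r : ℝ | 0 ≤ r}) measurableSet_Ici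

lemma map_timeMeasure : timeMeasure.map ((↑) : ℝ≥0 → ℝ) = volume.restrict (Ici 0) := by
  rw [timeMeasure, measurableEmbedding_coe_nnreal.map_comap]
  congr 1
  exact Subtype.range_coe (s := {r : ℝ | 0 ≤ r})

lemma lintegral_timeMeasure (f : ℝ → ℝ≥0∞) :
    ∫⁻ s : ℝ≥0, f s ∂timeMeasure = ∫⁻ s in Ici (0 : ℝ), f s := by
  rw [← map_timeMeasure, measurableEmbedding_coe_nnreal.lintegral_map]

lemma timeMeasure_Iic_lt_top (t : ℝ≥0) : timeMeasure (Iic t) < ∞ := by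
  rw [timeMeasure, measurableEmbedding_coe_nnreal.comap_apply]
  refine (measure_mono (t := Icc (0 : ℝ) t) ?_).trans_lt (by simp)
  rintro _ ⟨s, hs, rfl⟩
  exact ⟨s.2, hs⟩

instance : SigmaFinite timeMeasure := by
  refine ⟨⟨⟨fun n => Iic (n : ℝ≥0), fun _ => trivial, fun n => timeMeasure_Iic_lt_top _, ?_⟩⟩⟩
  ext s
  simp only [mem_iUnion, mem_Iic, mem_univ, iff_true]
  exact exists_nat_ge s

lemma timeMeasure_singleton (t : ℝ≥0) : timeMeasure {t} = 0 := by
  rw [timeMeasure, measurableEmbedding_coe_nnreal.comap_apply]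
  simp

/-! ### Moments of the Poisson distribution -/

section Poisson

variable (r : ℝ≥0)

/-- After a shift of the index, `n / n!` becomes `1 / (n - 1)!`, so the series is `r` times the
total mass. The same shift turns the second moment into `r` times the mean of `n + 1`. -/
lemma hasSum_poisson_mul :
    HasSum (fun n : ℕ => Real.exp (-r) * r ^ n / n.factorial * (n : ℝ)) r := by
  rw [← hasSum_nat_add_iff' 1]
  have h := (hasSum_one_poissonMeasure r).mul_left (r : ℝ)
  simp only [Finset.range_one, Finset.sum_singleton, Nat.cast_zero, mul_zero, sub_zero]
  rw [mul_one] at h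
  refine h.congr_fun fun n => ?_
  rw [Nat.factorial_succ]
  push_cast
  field_simp
  ring

lemma hasSum_poisson_mul_sq :
    HasSum (fun n : ℕ => Real.exp (-r) * r ^ n / n.factorial * (n : ℝ) ^ 2) (r * (r + 1)) := by
  rw [← hasSum_nat_add_iff' 1]
  have h := ((hasSum_poisson_mul r).add (hasSum_one_poissonMeasure r)).mul_left (r : ℝ)
  simp only [Finset.range_one, Finset.sum_singleton, Nat.cast_zero, ne_eq, OfNat.ofNat_ne_zero,
    not_false_eq_true, zero_pow, mul_zero, sub_zero]
  refine h.congr_fun fun n => ?_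
  rw [Nat.factorial_succ]
  push_cast
  field_simp
  ring

lemma integrable_poisson_sq : Integrable (fun n : ℕ => (n : ℝ) ^ 2) (poissonMeasure r) := by
  rw [integrable_poissonMeasure_iff]
  simpa using (hasSum_poisson_mul_sq r).summable

lemma integral_poisson_id : ∫ n : ℕ, (n : ℝ) ∂(poissonMeasure r) = r := by
  have hi : Integrable (fun n : ℕ => (n : ℝ)) (poissonMeasure r) := by
    rw [integrable_poissonMeasure_iff]
    simpa using (hasSum_poisson_mul r).summable
  exact (hasSum_integral_poissonMeasure hi).unique (by simpa using hasSum_poisson_mul r)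

lemma integral_poisson_sq : ∫ n : ℕ, (n : ℝ) ^ 2 ∂(poissonMeasure r) = r * (r + 1) :=
  (hasSum_integral_poissonMeasure (integrable_poisson_sq r)).unique
    (by simpa using hasSum_poisson_mul_sq r)

end Poisson

/-! ### Poisson random measures -/

section PRM


variable {Ω : Type u} [mΩ : MeasurableSpace Ω] {P : Measure Ω}
  {ℱ : Filtration ℝ≥0 mΩ} {μ : Measure (ℝ≥0 × ℝ × ℝ)} {N : Ω → Measure (ℝ≥0 × ℝ × ℝ)}
  {A B : Set (ℝ≥0 × ℝ × ℝ)}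

/-- The compensated mass of a set. -/
def compMass (μ : Measure (ℝ≥0 × ℝ × ℝ)) (N : Ω → Measure (ℝ≥0 × ℝ × ℝ))
    (A : Set (ℝ≥0 × ℝ × ℝ)) (ω : Ω) : ℝ := (N ω).real A - μ.real A

lemma measurable_compMass_future {Ω : Type*} (μ : Measure (ℝ≥0 × ℝ × ℝ)) (N : Ω → Measure (ℝ≥0 × ℝ × ℝ))
    {t : ℝ≥0} {A : Set (ℝ≥0 × ℝ × ℝ)} (hA : MeasurableSet A) (hAt : A ⊆ {e | t < e.1}) :
    Measurable[⨆ (A : Set (ℝ≥0 × ℝ × ℝ)) (_ : MeasurableSet A ∧ A ⊆ {e | t < e.1}),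
      MeasurableSpace.comap (fun ω => N ω A) inferInstance] (compMass μ N A) := by
  have h1 : Measurable[MeasurableSpace.comap (fun ω => N ω A) inferInstance]
      (fun ω => N ω A) := comap_measurable _
  have h2 := h1.mono (le_iSup₂_of_le (f := fun (A : Set (ℝ≥0 × ℝ × ℝ))
    (_ : MeasurableSet A ∧ A ⊆ {e | t < e.1}) =>
      MeasurableSpace.comap (fun ω => N ω A) inferInstance) A ⟨hA, hAt⟩ le_rfl) le_rfl
  exact h2.ennreal_toReal.sub_const _

namespace IsPoissonRandomMeasure

lemma measurable_mass (h : IsPoissonRandomMeasure P ℱ μ N) (hA : MeasurableSet A) :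
    Measurable fun ω => N ω A := (Measure.measurable_coe hA).comp h.measurable

lemma measurable_compMass_past (h : IsPoissonRandomMeasure P ℱ μ N) {t : ℝ≥0}
    (hA : MeasurableSet A) (hAt : A ⊆ {e | e.1 ≤ t}) : Measurable[ℱ t] (compMass μ N A) :=
  (h.adapted t A hA hAt).ennreal_toReal.sub_const _

lemma ae_lt_top (h : IsPoissonRandomMeasure P ℱ μ N) (hA : MeasurableSet A) (hA' : μ A ≠ ∞) :
    ∀ᵐ ω ∂P, N ω A < ∞ := by
  have h1 : ∀ᵐ x ∂(P.map fun ω => N ω A), x < ∞ := by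
    rw [h.law A hA hA', ae_map_iff (by fun_prop) measurableSet_Iio]
    exact Eventually.of_forall fun n => ENNReal.natCast_lt_top n
  exact ae_of_ae_map (h.measurable_mass hA).aemeasurable h1

lemma integral_comp (h : IsPoissonRandomMeasure P ℱ μ N) (hA : MeasurableSet A) (hA' : μ A ≠ ∞)
    {f : ℝ → ℝ} (hf : Measurable f) :
    ∫ ω, f ((N ω).real A) ∂P = ∫ n : ℕ, f n ∂(poissonMeasure (μ A).toNNReal) := by
  have hf' : Measurable fun x : ℝ≥0∞ => f x.toReal := hf.comp ENNReal.measurable_toReal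
  have h1 := integral_map (h.measurable_mass hA).aemeasurable (μ := P)
    (hf'.aestronglyMeasurable (μ := P.map fun ω => N ω A))
  rw [h.law A hA hA', integral_map (by fun_prop) hf'.aestronglyMeasurable] at h1
  simpa [measureReal_def] using h1.symm

lemma integrable_comp (h : IsPoissonRandomMeasure P ℱ μ N) (hA : MeasurableSet A) (hA' : μ A ≠ ∞)
    {f : ℝ → ℝ} (hf : Measurable f)
    (hfi : Integrable (fun n : ℕ => f n) (poissonMeasure (μ A).toNNReal)) :
    Integrable (fun ω => f ((N ω).real A)) P := by
  have hf' : Measurable fun x : ℝ≥0∞ => f x.toReal := hf.comp ENNReal.measurable_toReal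
  have h1 := integrable_map_measure (μ := P) (f := fun ω => N ω A)
    (hf'.aestronglyMeasurable (μ := P.map fun ω => N ω A)) (h.measurable_mass hA).aemeasurable
  rw [h.law A hA hA', integrable_map_measure hf'.aestronglyMeasurable (by fun_prop)] at h1
  have h2 : ((fun x : ℝ≥0∞ => f x.toReal) ∘ fun k : ℕ => (k : ℝ≥0∞)) = fun n : ℕ => f n := by
    ext n; simp
  rw [h2] at h1
  exact h1.1 hfi

lemma memLp_mass (h : IsPoissonRandomMeasure P ℱ μ N) (hA : MeasurableSet A) (hA' : μ A ≠ ∞) :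
    MemLp (fun ω => (N ω).real A) 2 P := by
  refine (memLp_two_iff_integrable_sq
    (h.measurable_mass hA).ennreal_toReal.aestronglyMeasurable).2 ?_
  exact h.integrable_comp hA hA' (f := fun x => x ^ 2) (by fun_prop) (integrable_poisson_sq _)

/-- Past and future are independent. -/
lemma integral_mul_of_past_future (h : IsPoissonRandomMeasure P ℱ μ N) {t : ℝ≥0}
    {f g : Ω → ℝ} (hf : Measurable[ℱ t] f)
    (hg : Measurable[⨆ (A : Set (ℝ≥0 × ℝ × ℝ)) (_ : MeasurableSet A ∧ A ⊆ {e | t < e.1}),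
      MeasurableSpace.comap (fun ω => N ω A) inferInstance] g) :
    ∫ ω, f ω * g ω ∂P = (∫ ω, f ω ∂P) * ∫ ω, g ω ∂P := by
  have hle : (⨆ (A : Set (ℝ≥0 × ℝ × ℝ)) (_ : MeasurableSet A ∧ A ⊆ {e | t < e.1}),
      MeasurableSpace.comap (fun ω => N ω A) inferInstance) ≤ mΩ :=
    iSup₂_le fun A hA => (h.measurable_mass hA.1).comap_le
  have hi : IndepFun f g P := by
    rw [IndepFun_iff_Indep]
    exact (indep_of_indep_of_le_right (indep_of_indep_of_le_left (h.indep_future t) hg.comap_le)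
      hf.comap_le).symm
  exact hi.integral_fun_mul_eq_mul_integral (hf.mono (ℱ.le t) le_rfl).aestronglyMeasurable
    (hg.mono hle le_rfl).aestronglyMeasurable

lemma integral_mass (h : IsPoissonRandomMeasure P ℱ μ N) (hA : MeasurableSet A)
    (hA' : μ A ≠ ∞) : ∫ ω, (N ω).real A ∂P = μ.real A := by
  exact (h.integral_comp hA hA' measurable_id).trans (integral_poisson_id _)

lemma ae_compMass_union (h : IsPoissonRandomMeasure P ℱ μ N) (hA : MeasurableSet A)
    (hA' : μ A ≠ ∞) (hB : MeasurableSet B) (hB' : μ B ≠ ∞) (hd : Disjoint A B) :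
    ∀ᵐ ω ∂P, compMass μ N (A ∪ B) ω = compMass μ N A ω + compMass μ N B ω := by
  filter_upwards [h.ae_lt_top hA hA', h.ae_lt_top hB hB'] with ω h1 h2
  unfold compMass
  rw [measureReal_union hd hB h1.ne h2.ne, measureReal_union hd hB hA' hB']
  ring

variable [IsProbabilityMeasure P]

lemma memLp_compMass (h : IsPoissonRandomMeasure P ℱ μ N) (hA : MeasurableSet A)
    (hA' : μ A ≠ ∞) : MemLp (compMass μ N A) 2 P :=
  (h.memLp_mass hA hA').sub (memLp_const _)

lemma integral_compMass (h : IsPoissonRandomMeasure P ℱ μ N) (hA : MeasurableSet A)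
    (hA' : μ A ≠ ∞) : ∫ ω, compMass μ N A ω ∂P = 0 := by
  unfold compMass
  rw [integral_sub ((h.memLp_mass hA hA').integrable one_le_two) (integrable_const _),
    h.integral_mass hA hA']
  simp

lemma integral_compMass_sq (h : IsPoissonRandomMeasure P ℱ μ N) (hA : MeasurableSet A)
    (hA' : μ A ≠ ∞) : ∫ ω, compMass μ N A ω ^ 2 ∂P = μ.real A := by
  have i1 := (h.memLp_mass hA hA').integrable one_le_two
  have i2 := (h.memLp_mass hA hA').integrable_sq
  have e : ∀ ω, compMass μ N A ω ^ 2 =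
      (N ω).real A ^ 2 - 2 * μ.real A * (N ω).real A + μ.real A ^ 2 := fun ω => by
    unfold compMass; ring
  have e2 : ∫ ω, (N ω).real A ^ 2 ∂P = μ.real A * (μ.real A + 1) := by
    rw [h.integral_comp hA hA' (f := fun x => x ^ 2) (by fun_prop)]
    exact integral_poisson_sq _
  simp_rw [e]
  rw [integral_add (i2.sub' (i1.const_mul _)) (integrable_const _),
    integral_sub i2 (i1.const_mul _), integral_const_mul, h.integral_mass hA hA', e2]
  simp
  ring

lemma ae_null (h : IsPoissonRandomMeasure P ℱ μ N) (hA : MeasurableSet A) (hA' : μ A = 0) :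
    ∀ᵐ ω ∂P, N ω A = 0 := by
  have hA'' : μ A ≠ ∞ := by simp [hA']
  have h1 := h.integral_mass hA hA''
  rw [measureReal_def, hA', ENNReal.toReal_zero] at h1
  have h2 := (integral_eq_zero_iff_of_nonneg (fun _ => measureReal_nonneg)
    ((h.memLp_mass hA hA'').integrable one_le_two)).1 h1
  filter_upwards [h2, h.ae_lt_top hA hA''] with ω h3 h4
  exact ((ENNReal.toReal_eq_zero_iff _).1 h3).resolve_right h4.ne

/-- Polarization: the variances of `A`, `B` and `A ∪ B` are their intensities, which add up, so the
cross term vanishes. -/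
lemma integral_compMass_mul_of_disjoint (h : IsPoissonRandomMeasure P ℱ μ N)
    (hA : MeasurableSet A) (hA' : μ A ≠ ∞) (hB : MeasurableSet B) (hB' : μ B ≠ ∞)
    (hd : Disjoint A B) : ∫ ω, compMass μ N A ω * compMass μ N B ω ∂P = 0 := by
  have hU : μ (A ∪ B) ≠ ∞ := (measure_union_lt_top hA'.lt_top hB'.lt_top).ne
  have h1 := h.integral_compMass_sq (hA.union hB) hU
  have i1 := (h.memLp_compMass hA hA').integrable_sq
  have i2 := (h.memLp_compMass hB hB').integrable_sq
  have i3 := (h.memLp_compMass hA hA').integrable_mul (h.memLp_compMass hB hB')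
  have e : ∫ ω, compMass μ N (A ∪ B) ω ^ 2 ∂P = ∫ ω, (compMass μ N A ω ^ 2 +
      compMass μ N B ω ^ 2 + 2 * (compMass μ N A * compMass μ N B) ω) ∂P := by
    refine integral_congr_ae ?_
    filter_upwards [h.ae_compMass_union hA hA' hB hB' hd] with ω hω
    rw [hω, Pi.mul_apply]; ring
  rw [e, integral_add (i1.fun_add i2) (i3.const_mul 2), integral_add i1 i2, integral_const_mul,
    h.integral_compMass_sq hA hA', h.integral_compMass_sq hB hB',
    measureReal_union hd hB hA' hB'] at h1
  simp only [Pi.mul_apply] at h1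
  linarith

/-- Splitting both sets along `A ∩ B` leaves only products over disjoint sets, apart from the square
of the common part. -/
lemma integral_compMass_mul (h : IsPoissonRandomMeasure P ℱ μ N)
    (hA : MeasurableSet A) (hA' : μ A ≠ ∞) (hB : MeasurableSet B) (hB' : μ B ≠ ∞) :
    ∫ ω, compMass μ N A ω * compMass μ N B ω ∂P = μ.real (A ∩ B) := by
  have hI := hA.inter hB
  have hI' : μ (A ∩ B) ≠ ∞ := measure_ne_top_of_subset inter_subset_left hA'
  have hAd := hA.diff hB
  have hAd' : μ (A \ B) ≠ ∞ := measure_ne_top_of_subset sdiff_subset hA'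
  have hBd := hB.diff hA
  have hBd' : μ (B \ A) ≠ ∞ := measure_ne_top_of_subset sdiff_subset hB'
  have d1 : Disjoint (A ∩ B) (A \ B) := disjoint_inf_sdiff
  have d2 : Disjoint (A ∩ B) (B \ A) := by rw [inter_comm]; exact disjoint_inf_sdiff
  have d3 : Disjoint (A \ B) (B \ A) := disjoint_sdiff_sdiff
  have m := fun {C : Set (ℝ≥0 × ℝ × ℝ)} (hC : MeasurableSet C) (hC' : μ C ≠ ∞) =>
    h.memLp_compMass hC hC'
  have u1 := h.ae_compMass_union hI hI' hAd hAd' d1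
  have u2 := h.ae_compMass_union hI hI' hBd hBd' d2
  rw [inter_union_sdiff] at u1
  rw [inter_comm, inter_union_sdiff, inter_comm] at u2
  have e : ∫ ω, compMass μ N A ω * compMass μ N B ω ∂P = ∫ ω, (compMass μ N (A ∩ B) ω ^ 2 +
      (compMass μ N (A ∩ B) * compMass μ N (B \ A)) ω +
      (compMass μ N (A ∩ B) * compMass μ N (A \ B)) ω +
      (compMass μ N (A \ B) * compMass μ N (B \ A)) ω) ∂P := by
    refine integral_congr_ae ?_
    filter_upwards [u1, u2] with ω h1 h2
    rw [h1, h2]; simp only [Pi.mul_apply]; ring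
  have i1 := (m hI hI').integrable_sq
  have i2 := (m hI hI').integrable_mul (m hBd hBd')
  have i3 := (m hI hI').integrable_mul (m hAd hAd')
  have i4 := (m hAd hAd').integrable_mul (m hBd hBd')
  rw [e, integral_add ((i1.fun_add i2).fun_add i3) i4, integral_add (i1.fun_add i2) i3, integral_add i1 i2,
    h.integral_compMass_sq hI hI']
  simp only [Pi.mul_apply]
  rw [h.integral_compMass_mul_of_disjoint hI hI' hBd hBd' d2,
    h.integral_compMass_mul_of_disjoint hI hI' hAd hAd' d1,
    h.integral_compMass_mul_of_disjoint hAd hAd' hBd hBd' d3]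
  simp

end IsPoissonRandomMeasure

end PRM

/-! ### A kernel version of the random measure -/

/-- The masses of the sets `S n` are finite for each `ω` but not uniformly. Cutting the space into
disjoint pieces `T n`, and `Ω` according to the integer part of the mass of `T n`, gives countably
many finite kernels. -/
lemma isSFiniteKernel_of_lt_top {Ω E : Type*} [MeasurableSpace Ω] [MeasurableSpace E]
    (κ : Kernel Ω E) {S : ℕ → Set E} (hS : ∀ n, MeasurableSet (S n)) (hU : ⋃ n, S n = univ)
    (hfin : ∀ ω n, κ ω (S n) < ∞) : IsSFiniteKernel κ := by
  classical
  set T := disjointed S with hT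
  have hTm : ∀ n, MeasurableSet (T n) := fun n => MeasurableSet.disjointed hS n
  have hTfin : ∀ ω n, κ ω (T n) < ∞ := fun ω n =>
    (measure_mono (disjointed_subset S n)).trans_lt (hfin ω n)
  have hs : ∀ p : ℕ × ℕ, MeasurableSet {ω | (p.2 : ℝ≥0∞) ≤ κ ω (T p.1) ∧
      κ ω (T p.1) < p.2 + 1} := fun p =>
    (measurableSet_le measurable_const (κ.measurable_coe (hTm _))).inter
      (measurableSet_lt (κ.measurable_coe (hTm _)) measurable_const)
  let η : ℕ × ℕ → Kernel Ω E := fun p => Kernel.piecewise (hs p) (κ.restrict (hTm p.1)) 0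
  have hη : ∀ p, IsFiniteKernel (η p) := fun p => by
    refine ⟨⟨p.2 + 1, by exact_mod_cast ENNReal.natCast_lt_top (p.2 + 1), fun ω => ?_⟩⟩
    simp only [η, Kernel.piecewise_apply]
    split_ifs with h
    · rw [Kernel.restrict_apply, Measure.restrict_apply_univ]; exact h.2.le
    · simp
  have key : κ = Kernel.sum η := by
    ext ω A hA
    rw [Kernel.sum_apply' _ _ hA, ENNReal.tsum_prod']
    have h1 : ∀ n, ∑' k, η (n, k) ω A = κ ω (A ∩ T n) := by
      intro n
      set x := κ ω (T n) with hx
      have hx' : x ≠ ∞ := (hTfin ω n).ne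
      rw [tsum_eq_single ⌊x.toReal⌋₊]
      · simp only [η, Kernel.piecewise_apply]
        rw [if_pos, Kernel.restrict_apply, Measure.restrict_apply hA]
        simp only [mem_ofPred_eq, ← hx]
        constructor
        · rw [← ENNReal.ofReal_natCast, ENNReal.ofReal_le_iff_le_toReal hx']
          exact Nat.floor_le ENNReal.toReal_nonneg
        · rw [← Nat.cast_add_one, ← ENNReal.ofReal_natCast, ENNReal.lt_ofReal_iff_toReal_lt hx']
          push_cast
          exact Nat.lt_floor_add_one _
      · intro k hk
        simp only [η, Kernel.piecewise_apply]
        rw [if_neg]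
        · simp
        · simp only [mem_ofPred_eq, ← hx]
          rintro ⟨h2, h3⟩
          apply hk
          symm
          rw [Nat.floor_eq_iff ENNReal.toReal_nonneg]
          rw [← ENNReal.ofReal_toReal hx', ← ENNReal.ofReal_natCast] at h2
          have h4 : x < ENNReal.ofReal (k + 1) := by
            rw [ENNReal.ofReal_add (by positivity) zero_le_one]; simpa using h3
          exact ⟨(ENNReal.ofReal_le_ofReal_iff ENNReal.toReal_nonneg).1 h2,
            (ENNReal.lt_ofReal_iff_toReal_lt hx').1 h4⟩
    simp_rw [h1]
    rw [← measure_iUnion]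
    · rw [← inter_iUnion, hT, iUnion_disjointed, hU, inter_univ]
    · intro i j hij
      exact ((disjoint_disjointed S) hij).mono inter_subset_right inter_subset_right
    · exact fun n => hA.inter (hTm n)
  rw [key]
  infer_instance

section PRM

variable {Ω : Type u}

/-- The section of a subset of the marked space at `ω`. -/
def slice (A : Set ((ℝ≥0 × Ω) × (ℝ × ℝ))) (ω : Ω) : Set (ℝ≥0 × ℝ × ℝ) :=
  {e | ((e.1, ω), e.2) ∈ A}

lemma slice_inter (A B : Set ((ℝ≥0 × Ω) × (ℝ × ℝ))) (ω : Ω) :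
    slice (A ∩ B) ω = slice A ω ∩ slice B ω := rfl

variable [mΩ : MeasurableSpace Ω] {P : Measure Ω} {ℱ : Filtration ℝ≥0 mΩ}
  {N : Ω → Measure (ℝ≥0 × ℝ × ℝ)} {μ : Measure (ℝ≥0 × ℝ × ℝ)} [SigmaFinite μ]

lemma measurable_place : Measurable fun p : Ω × (ℝ≥0 × ℝ × ℝ) => ((p.2.1, p.1), p.2.2) := by
  fun_prop

lemma measurable_place_right (ω : Ω) :
    Measurable fun e : ℝ≥0 × ℝ × ℝ => ((e.1, ω), e.2) := by fun_prop

lemma measurableSet_slice {A : Set ((ℝ≥0 × Ω) × (ℝ × ℝ))} (hA : MeasurableSet A) (ω : Ω) :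
    MeasurableSet (slice A ω) := measurable_place_right ω hA

lemma predictable_le (ℱ : Filtration ℝ≥0 mΩ) : ℱ.predictable ≤ Prod.instMeasurableSpace :=
  measurableSpace_le_predictable_of_measurableSet
    (fun A hA => (measurableSet_singleton _).prod (ℱ.le _ A hA))
    (fun i A hA => measurableSet_Ioi.prod (ℱ.le i A hA))

lemma predictable_prod_le (ℱ : Filtration ℝ≥0 mΩ) :
    ℱ.predictable.prod (inferInstance : MeasurableSpace (ℝ × ℝ)) ≤ Prod.instMeasurableSpace :=
  sup_le_sup (MeasurableSpace.comap_mono (predictable_le ℱ)) le_rfl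

lemma IsPredictableIntegrand.measurable {H : (ℝ≥0 × Ω) × (ℝ × ℝ) → ℝ}
    (hH : IsPredictableIntegrand ℱ H) : Measurable H := hH.mono (predictable_prod_le ℱ) le_rfl

namespace IsPoissonRandomMeasure

lemma ae_spanningSets_lt_top (h : IsPoissonRandomMeasure P ℱ μ N) :
    ∀ᵐ ω ∂P, ∀ n, N ω (spanningSets μ n) < ∞ :=
  ae_all_iff.2 fun n => h.ae_lt_top (measurableSet_spanningSets μ n)
    (measure_spanningSets_lt_top μ n).ne

/-- The random measure agrees almost surely with an s-finite kernel. -/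
lemma exists_kernel (h : IsPoissonRandomMeasure P ℱ μ N) :
    ∃ κ : Kernel Ω (ℝ≥0 × ℝ × ℝ), IsSFiniteKernel κ ∧ ∀ᵐ ω ∂P, κ ω = N ω := by
  classical
  have hG : MeasurableSet {ω | ∀ n, N ω (spanningSets μ n) < ∞} := by
    rw [ofPred_forall]
    exact MeasurableSet.iInter fun n =>
      measurableSet_lt (h.measurable_mass (measurableSet_spanningSets μ n)) measurable_const
  let κ : Kernel Ω (ℝ≥0 × ℝ × ℝ) := Kernel.piecewise hG ⟨N, h.measurable⟩ 0
  have hκ : ∀ ω, κ ω = if ω ∈ {ω | ∀ n, N ω (spanningSets μ n) < ∞} then N ω else 0 := fun ω => by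
    simp only [κ, Kernel.piecewise_apply]; rfl
  refine ⟨κ, isSFiniteKernel_of_lt_top κ (S := spanningSets μ)
    (measurableSet_spanningSets μ) (iUnion_spanningSets μ)
    (fun ω n => ?_), ?_⟩
  · rw [hκ]; split_ifs with hω
    · exact hω n
    · simp
  · filter_upwards [h.ae_spanningSets_lt_top] with ω hω
    rw [hκ]; exact if_pos hω

/-- The set being measured depends on `ω`, so measurability of `N` on fixed sets is not enough. The
s-finite kernel version supplies the joint measurability. -/
lemma aemeasurable_slice (h : IsPoissonRandomMeasure P ℱ μ N)
    {A : Set ((ℝ≥0 × Ω) × (ℝ × ℝ))} (hA : MeasurableSet A) {S : Set (ℝ≥0 × ℝ × ℝ)}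
    (hS : MeasurableSet S) : AEMeasurable (fun ω => N ω (slice A ω ∩ S)) P := by
  obtain ⟨κ, hκ, hκN⟩ := h.exists_kernel
  have h1 : MeasurableSet {p : Ω × (ℝ≥0 × ℝ × ℝ) | ((p.2.1, p.1), p.2.2) ∈ A ∧ p.2 ∈ S} :=
    (measurable_place hA).inter (measurable_snd hS)
  refine (Kernel.measurable_kernel_prodMk_left (κ := κ) h1).aemeasurable.congr ?_
  filter_upwards [hκN] with ω hω
  rw [hω]; rfl

end IsPoissonRandomMeasure

lemma measurable_measure_slice {A : Set ((ℝ≥0 × Ω) × (ℝ × ℝ))} (hA : MeasurableSet A)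
    {S : Set (ℝ≥0 × ℝ × ℝ)} (hS : MeasurableSet S) :
    Measurable fun ω => μ (slice A ω ∩ S) := by
  have h1 : MeasurableSet {p : Ω × (ℝ≥0 × ℝ × ℝ) | ((p.2.1, p.1), p.2.2) ∈ A ∧ p.2 ∈ S} :=
    (measurable_place hA).inter (measurable_snd hS)
  exact measurable_measure_prodMk_left h1

/-! ### The covariance of the compensated measure on predictable sets -/

/-- The covariance formula for the compensated masses of `A` and `B` inside `S`. -/
def HasCov (P : Measure Ω) (μ : Measure (ℝ≥0 × ℝ × ℝ)) (N : Ω → Measure (ℝ≥0 × ℝ × ℝ))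
    (S : Set (ℝ≥0 × ℝ × ℝ)) (A B : Set ((ℝ≥0 × Ω) × (ℝ × ℝ))) : Prop :=
  ∫ ω, compMass μ N (slice A ω ∩ S) ω * compMass μ N (slice B ω ∩ S) ω ∂P =
    ∫ ω, μ.real (slice A ω ∩ slice B ω ∩ S) ∂P

omit [SigmaFinite μ] in
lemma HasCov.symm {S : Set (ℝ≥0 × ℝ × ℝ)}
    {A B : Set ((ℝ≥0 × Ω) × (ℝ × ℝ))} (h : HasCov P μ N S A B) : HasCov P μ N S B A := by
  unfold HasCov at h ⊢
  simp_rw [mul_comm (compMass μ N (slice B _ ∩ S) _), inter_comm (slice B _) (slice A _)]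
  exact h

namespace IsPoissonRandomMeasure

variable {S : Set (ℝ≥0 × ℝ × ℝ)} {A B : Set ((ℝ≥0 × Ω) × (ℝ × ℝ))}

lemma aestronglyMeasurable_compMass_slice
    (h : IsPoissonRandomMeasure P ℱ μ N) (hS : MeasurableSet S)
    (hA : MeasurableSet A) :
    AEStronglyMeasurable (fun ω => compMass μ N (slice A ω ∩ S) ω) P :=
  ((h.aemeasurable_slice hA hS).ennreal_toReal.sub
    (measurable_measure_slice hA hS).ennreal_toReal.aemeasurable).aestronglyMeasurable

omit [SigmaFinite μ] in
-- The quantifier over sets stands inside the almost sure statement, so random slices may be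
-- substituted.
lemma ae_abs_compMass_slice_le
    (h : IsPoissonRandomMeasure P ℱ μ N) (hS : MeasurableSet S)
    (hS' : μ S ≠ ∞) : ∀ᵐ ω ∂P, ∀ A : Set (ℝ≥0 × ℝ × ℝ),
    |compMass μ N (A ∩ S) ω| ≤
      (N ω).real (A ∩ S) + μ.real (A ∩ S) ∧
    (N ω).real (A ∩ S) + μ.real (A ∩ S) ≤
      (N ω).real S + μ.real S := by
  filter_upwards [h.ae_lt_top hS hS'] with ω hω A
  constructor
  · refine (abs_sub _ _).trans ?_
    rw [abs_of_nonneg measureReal_nonneg, abs_of_nonneg measureReal_nonneg]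
  · exact add_le_add (measureReal_mono inter_subset_right hω.ne)
      (measureReal_mono inter_subset_right hS')

variable [IsProbabilityMeasure P]

omit [SigmaFinite μ] in
lemma memLp_bound (h : IsPoissonRandomMeasure P ℱ μ N) (hS : MeasurableSet S)
    (hS' : μ S ≠ ∞) :
    MemLp (fun ω => (N ω).real S + μ.real S) 2 P :=
  (h.memLp_mass hS hS').add (memLp_const _)

lemma memLp_compMass_slice (h : IsPoissonRandomMeasure P ℱ μ N)
    (hS : MeasurableSet S) (hS' : μ S ≠ ∞) (hA : MeasurableSet A) :
    MemLp (fun ω => compMass μ N (slice A ω ∩ S) ω) 2 P := by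
  refine (h.memLp_bound hS hS').mono (h.aestronglyMeasurable_compMass_slice hS hA) ?_
  filter_upwards [h.ae_abs_compMass_slice_le hS hS'] with ω hω
  have := hω (slice A ω)
  rw [Real.norm_eq_abs]
  exact (this.1.trans this.2).trans (le_abs_self _)

lemma integrable_measure_slice (hS : MeasurableSet S)
    (hS' : μ S ≠ ∞) (hA : MeasurableSet A) :
    Integrable (fun ω => μ.real (slice A ω ∩ S)) P := by
  refine Integrable.mono' (g := fun _ => μ.real S) (integrable_const _)
    (measurable_measure_slice hA hS).ennreal_toReal.aestronglyMeasurable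
    (Eventually.of_forall fun ω => ?_)
  rw [Real.norm_of_nonneg measureReal_nonneg]
  exact measureReal_mono inter_subset_right hS'

lemma integrable_measure_slice_inter (hS : MeasurableSet S) (hS' : μ S ≠ ∞)
    (hA : MeasurableSet A) (hB : MeasurableSet B) :
    Integrable (fun ω => μ.real (slice A ω ∩ slice B ω ∩ S)) P := by
  simp_rw [← slice_inter]
  exact integrable_measure_slice hS hS' (hA.inter hB)

omit [IsProbabilityMeasure P] [SigmaFinite μ] in
lemma hasSum_measureReal_slice {ν : Measure (ℝ≥0 × ℝ × ℝ)} (hS : MeasurableSet S)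
    (hS' : ν S ≠ ∞) {f : ℕ → Set (ℝ≥0 × ℝ × ℝ)} (hf : ∀ i, MeasurableSet (f i))
    (hd : Pairwise (Function.onFun Disjoint f)) :
    HasSum (fun i => ν.real (f i ∩ S)) (ν.real ((⋃ i, f i) ∩ S)) := by
  have h1 : ν ((⋃ i, f i) ∩ S) = ∑' i, ν (f i ∩ S) := by
    rw [iUnion_inter]
    exact measure_iUnion (fun i j hij => (hd hij).mono inter_subset_left inter_subset_left)
      fun i => (hf i).inter hS
  have h2 : ∑' i, ν (f i ∩ S) ≠ ∞ := by
    rw [← h1]; exact measure_ne_top_of_subset inter_subset_right hS'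
  have := ENNReal.hasSum_toReal h2
  rw [measureReal_def, h1, ENNReal.tsum_toReal_eq fun i => ENNReal.ne_top_of_tsum_ne_top h2 i]
  exact this

omit mΩ [SigmaFinite μ] in
lemma slice_iUnion (f : ℕ → Set ((ℝ≥0 × Ω) × (ℝ × ℝ))) (ω : Ω) :
    slice (⋃ i, f i) ω = ⋃ i, slice (f i) ω := by
  ext e; simp [slice]

omit mΩ [SigmaFinite μ] in
lemma pairwise_disjoint_slice {f : ℕ → Set ((ℝ≥0 × Ω) × (ℝ × ℝ))}
    (hd : Pairwise (Function.onFun Disjoint f)) (ω : Ω) :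
    Pairwise (Function.onFun Disjoint fun i => slice (f i) ω) := fun _ _ hij =>
  Set.disjoint_left.2 fun _ he he' => Set.disjoint_left.1 (hd hij) he he'

omit [SigmaFinite μ] [IsProbabilityMeasure P] in
lemma hasSum_mass_slice (ω : Ω) (hω : N ω S < ∞) (hS : MeasurableSet S) (hS' : μ S ≠ ∞)
    {f : ℕ → Set ((ℝ≥0 × Ω) × (ℝ × ℝ))} (hd : Pairwise (Function.onFun Disjoint f))
    (hf : ∀ i, MeasurableSet (f i)) :
    HasSum (fun i => (N ω).real (slice (f i) ω ∩ S) + μ.real (slice (f i) ω ∩ S))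
      ((N ω).real (slice (⋃ i, f i) ω ∩ S) + μ.real (slice (⋃ i, f i) ω ∩ S)) ∧
    HasSum (fun i => compMass μ N (slice (f i) ω ∩ S) ω)
      (compMass μ N (slice (⋃ i, f i) ω ∩ S) ω) := by
  have hsd := pairwise_disjoint_slice hd ω
  have hsm := fun i => measurableSet_slice (hf i) ω
  have h1 := hasSum_measureReal_slice hS hω.ne hsm hsd
  have h2 := hasSum_measureReal_slice hS hS' hsm hsd
  rw [← slice_iUnion] at h1 h2
  exact ⟨h1.add h2, h1.sub h2⟩

/-- Dominated convergence for series: the bounds sum to at most `(N S + μ S)²`, which is integrable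
because a Poisson variable has a second moment. -/
lemma hasSum_integral_compMass_mul (h : IsPoissonRandomMeasure P ℱ μ N)
    (hS : MeasurableSet S) (hS' : μ S ≠ ∞) (hB : MeasurableSet B)
    {f : ℕ → Set ((ℝ≥0 × Ω) × (ℝ × ℝ))} (hd : Pairwise (Function.onFun Disjoint f))
    (hf : ∀ i, MeasurableSet (f i)) :
    HasSum (fun i => ∫ ω, compMass μ N (slice (f i) ω ∩ S) ω *
      compMass μ N (slice B ω ∩ S) ω ∂P)
      (∫ ω, compMass μ N (slice (⋃ i, f i) ω ∩ S) ω * compMass μ N (slice B ω ∩ S) ω ∂P) := by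
  refine hasSum_integral_of_dominated_convergence
    (bound := fun i ω => ((N ω).real (slice (f i) ω ∩ S) + μ.real (slice (f i) ω ∩ S)) *
      ((N ω).real S + μ.real S)) (fun i => ?_) (fun i => ?_) ?_ ?_ ?_
  · exact (h.aestronglyMeasurable_compMass_slice hS (hf i)).mul
      (h.aestronglyMeasurable_compMass_slice hS hB)
  · filter_upwards [h.ae_abs_compMass_slice_le hS hS'] with ω hω
    rw [norm_mul, Real.norm_eq_abs, Real.norm_eq_abs]
    have h1 := hω (slice B ω)
    exact mul_le_mul (hω (slice (f i) ω)).1 (h1.1.trans h1.2) (abs_nonneg _)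
      (add_nonneg measureReal_nonneg measureReal_nonneg)
  · filter_upwards [h.ae_lt_top hS hS'] with ω hω
    exact ((hasSum_mass_slice ω hω hS hS' hd hf).1.mul_right _).summable
  · have e : (fun ω => ((N ω).real (slice (⋃ i, f i) ω ∩ S) +
        μ.real (slice (⋃ i, f i) ω ∩ S)) * ((N ω).real S + μ.real S)) =ᵐ[P]
        fun ω => ∑' i, ((N ω).real (slice (f i) ω ∩ S) + μ.real (slice (f i) ω ∩ S)) *
          ((N ω).real S + μ.real S) := by
      filter_upwards [h.ae_lt_top hS hS'] with ω hω
      exact ((hasSum_mass_slice ω hω hS hS' hd hf).1.mul_right _).tsum_eq.symm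
    refine Integrable.congr ?_ e
    refine Integrable.mono' (h.memLp_bound hS hS').integrable_sq ?_ ?_
    · refine AEMeasurable.aestronglyMeasurable ?_
      refine AEMeasurable.mul (AEMeasurable.add ?_ ?_) ?_
      · exact (h.aemeasurable_slice (MeasurableSet.iUnion hf) hS).ennreal_toReal
      · exact (measurable_measure_slice (MeasurableSet.iUnion hf) hS).ennreal_toReal.aemeasurable
      · exact ((h.measurable_mass hS).ennreal_toReal.add_const _).aemeasurable
    · filter_upwards [h.ae_abs_compMass_slice_le hS hS'] with ω hω
      have h0 : 0 ≤ (N ω).real S + μ.real S := add_nonneg measureReal_nonneg measureReal_nonneg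
      rw [Real.norm_of_nonneg (mul_nonneg
        (add_nonneg measureReal_nonneg measureReal_nonneg) h0), sq]
      exact mul_le_mul_of_nonneg_right (hω _).2 h0
  · filter_upwards [h.ae_lt_top hS hS'] with ω hω
    exact (hasSum_mass_slice ω hω hS hS' hd hf).2.mul_right _

lemma hasSum_integral_measure_slice (hS : MeasurableSet S) (hS' : μ S ≠ ∞)
    (hB : MeasurableSet B) {f : ℕ → Set ((ℝ≥0 × Ω) × (ℝ × ℝ))}
    (hd : Pairwise (Function.onFun Disjoint f)) (hf : ∀ i, MeasurableSet (f i)) :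
    HasSum (fun i => ∫ ω, μ.real (slice (f i) ω ∩ slice B ω ∩ S) ∂P)
      (∫ ω, μ.real (slice (⋃ i, f i) ω ∩ slice B ω ∩ S) ∂P) := by
  have hR : ∀ ω, HasSum (fun i => μ.real (slice (f i) ω ∩ slice B ω ∩ S))
      (μ.real (slice (⋃ i, f i) ω ∩ slice B ω ∩ S)) := fun ω => by
    have := hasSum_measureReal_slice ((measurableSet_slice hB ω).inter hS)
      (measure_ne_top_of_subset inter_subset_right hS')
      (fun i => measurableSet_slice (hf i) ω) (pairwise_disjoint_slice hd ω)
    simpa only [inter_assoc, slice_iUnion] using this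
  refine hasSum_integral_of_dominated_convergence
    (bound := fun i ω => μ.real (slice (f i) ω ∩ slice B ω ∩ S))
    (fun i => (integrable_measure_slice_inter hS hS' (hf i) hB).aestronglyMeasurable) (fun i => Eventually.of_forall fun ω => ?_)
    (Eventually.of_forall fun ω => (hR ω).summable) ?_ (Eventually.of_forall hR)
  · rw [Real.norm_of_nonneg measureReal_nonneg]
  · exact (integrable_measure_slice_inter hS hS' (MeasurableSet.iUnion hf) hB).congr
      (Eventually.of_forall fun ω => (hR ω).tsum_eq.symm)

/-- Together with `hasCov_compl` this makes the sets with the correct covariance against a fixed `B`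
stable under the operations of the π-λ argument. -/
lemma hasCov_iUnion (h : IsPoissonRandomMeasure P ℱ μ N)
    (hS : MeasurableSet S) (hS' : μ S ≠ ∞) (hB : MeasurableSet B)
    {f : ℕ → Set ((ℝ≥0 × Ω) × (ℝ × ℝ))} (hd : Pairwise (Function.onFun Disjoint f))
    (hf : ∀ i, MeasurableSet (f i)) (hc : ∀ i, HasCov P μ N S (f i) B) :
    HasCov P μ N S (⋃ i, f i) B := by
  have h1 := h.hasSum_integral_compMass_mul hS hS' hB hd hf
  unfold HasCov at hc ⊢
  simp_rw [hc] at h1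
  exact h1.unique (hasSum_integral_measure_slice hS hS' hB hd hf)

lemma hasCov_compl (h : IsPoissonRandomMeasure P ℱ μ N)
    (hS : MeasurableSet S) (hS' : μ S ≠ ∞) (hB : MeasurableSet B)
    (hA : MeasurableSet A) (hU : HasCov P μ N S univ B)
    (hc : HasCov P μ N S A B) :
    HasCov P μ N S Aᶜ B := by
  have mem : ∀ {C : Set ((ℝ≥0 × Ω) × (ℝ × ℝ))}, MeasurableSet C → Integrable (fun ω =>
      compMass μ N (slice C ω ∩ S) ω * compMass μ N (slice B ω ∩ S) ω) P := fun hC =>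
    (h.memLp_compMass_slice hS hS' hC).integrable_mul (h.memLp_compMass_slice hS hS' hB)
  have e1 : ∀ᵐ ω ∂P, compMass μ N (slice Aᶜ ω ∩ S) ω * compMass μ N (slice B ω ∩ S) ω =
      compMass μ N (slice univ ω ∩ S) ω * compMass μ N (slice B ω ∩ S) ω -
        compMass μ N (slice A ω ∩ S) ω * compMass μ N (slice B ω ∩ S) ω := by
    filter_upwards [h.ae_lt_top hS hS'] with ω hω
    have h1 : ∀ {ν : Measure (ℝ≥0 × ℝ × ℝ)}, ν S ≠ ∞ →
        ν.real (slice univ ω ∩ S) = ν.real (slice A ω ∩ S) + ν.real (slice Aᶜ ω ∩ S) := by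
      intro ν hν
      rw [← measureReal_union _ ((measurableSet_slice hA.compl ω).inter hS)
        (measure_ne_top_of_subset inter_subset_right hν)
        (measure_ne_top_of_subset inter_subset_right hν)]
      · congr 1; ext e; simp only [slice, mem_inter_iff, mem_union, mem_ofPred_eq, mem_compl_iff,
          mem_univ, true_and]; tauto
      · exact Set.disjoint_left.2 fun e he he' => he'.1 he.1
    unfold compMass
    rw [h1 hω.ne, h1 hS']; ring
  have e2 : ∀ ω, μ.real (slice Aᶜ ω ∩ slice B ω ∩ S) =
      μ.real (slice univ ω ∩ slice B ω ∩ S) - μ.real (slice A ω ∩ slice B ω ∩ S) := by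
    intro ω
    have hSB' : μ (slice B ω ∩ S) ≠ ∞ := measure_ne_top_of_subset inter_subset_right hS'
    have h2 : slice univ ω ∩ slice B ω ∩ S =
        (slice A ω ∩ slice B ω ∩ S) ∪ (slice Aᶜ ω ∩ slice B ω ∩ S) := by
      ext e; simp only [slice, mem_inter_iff, mem_union, mem_ofPred_eq, mem_compl_iff,
          mem_univ, true_and]; tauto
    rw [h2, measureReal_union (Set.disjoint_left.2 fun e he he' => he'.1.1 he.1.1)
      (((measurableSet_slice hA.compl ω).inter (measurableSet_slice hB ω)).inter hS)
      (measure_ne_top_of_subset inter_subset_right hS')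
      (measure_ne_top_of_subset inter_subset_right hS')]
    ring
  unfold HasCov at hc hU ⊢
  rw [integral_congr_ae e1, integral_sub (mem .univ) (mem hA), hU, hc]
  simp_rw [e2]
  rw [integral_sub (integrable_measure_slice_inter hS hS' .univ hB)
    (integrable_measure_slice_inter hS hS' hA hB)]

end IsPoissonRandomMeasure

end PRM

section Covariance

variable {Ω : Type u} [mΩ : MeasurableSpace Ω] {P : Measure Ω} {ℱ : Filtration ℝ≥0 mΩ}
  {N : Ω → Measure (ℝ≥0 × ℝ × ℝ)} {μ : Measure (ℝ≥0 × ℝ × ℝ)}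
  {S : Set (ℝ≥0 × ℝ × ℝ)} {A B : Set ((ℝ≥0 × Ω) × (ℝ × ℝ))}

/-- The product of the predictable σ-algebra and the Borel σ-algebra of the marks. -/
abbrev predictableProd (ℱ : Filtration ℝ≥0 mΩ) : MeasurableSpace ((ℝ≥0 × Ω) × (ℝ × ℝ)) :=
  ℱ.predictable.prod (inferInstance : MeasurableSpace (ℝ × ℝ))

/-- The generators of the predictable σ-algebra. -/
def predictableGen (ℱ : Filtration ℝ≥0 mΩ) : Set (Set (ℝ≥0 × Ω)) :=
  {s | ∃ A, MeasurableSet[ℱ ⊥] A ∧ s = {⊥} ×ˢ A} ∪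
    {s | ∃ i A, MeasurableSet[ℱ i] A ∧ s = Ioi i ×ˢ A}

/-- The predictable rectangles. -/
def predictableRect (ℱ : Filtration ℝ≥0 mΩ) : Set (Set ((ℝ≥0 × Ω) × (ℝ × ℝ))) :=
  image2 (· ×ˢ ·) (predictableGen ℱ) {D | MeasurableSet D}

/-- Two generators of different type never meet, because the bottom time lies in no open ray. -/
lemma isPiSystem_predictableGen (ℱ : Filtration ℝ≥0 mΩ) : IsPiSystem (predictableGen ℱ) := by
  rintro _ (⟨A, hA, rfl⟩ | ⟨i, A, hA, rfl⟩) _ (⟨B, hB, rfl⟩ | ⟨j, B, hB, rfl⟩) hne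
  · exact Or.inl ⟨A ∩ B, hA.inter hB, by rw [prod_inter_prod, inter_self]⟩
  · exfalso
    obtain ⟨⟨x, y⟩, h1, h2⟩ := hne
    simp only [mem_prod, mem_singleton_iff, mem_Ioi] at h1 h2
    rw [h1.1] at h2
    exact not_lt_bot h2.1
  · exfalso
    obtain ⟨⟨x, y⟩, h1, h2⟩ := hne
    simp only [mem_prod, mem_singleton_iff, mem_Ioi] at h1 h2
    rw [h2.1] at h1
    exact not_lt_bot h1.1
  · refine Or.inr ⟨max i j, A ∩ B, ?_, ?_⟩
    · exact (ℱ.mono (le_max_left i j) _ hA).inter (ℱ.mono (le_max_right i j) _ hB)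
    · rw [prod_inter_prod, Ioi_inter_Ioi]

lemma predictableProd_eq_generateFrom (ℱ : Filtration ℝ≥0 mΩ) :
    predictableProd ℱ = MeasurableSpace.generateFrom (predictableRect ℱ) := by
  have h1 : IsCountablySpanning (predictableGen ℱ) := by
    refine ⟨fun n => if n = 0 then {⊥} ×ˢ univ else Ioi ⊥ ×ˢ univ, fun n => ?_, ?_⟩
    · by_cases hn : n = 0
      · simp only [hn, if_true]; exact Or.inl ⟨univ, MeasurableSet.univ, rfl⟩
      · simp only [hn, if_false]; exact Or.inr ⟨⊥, univ, MeasurableSet.univ, rfl⟩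
    · ext p
      simp only [mem_iUnion, mem_univ, iff_true]
      by_cases hp : p.1 = ⊥
      · exact ⟨0, by simp [hp]⟩
      · exact ⟨1, by simpa using bot_lt_iff_ne_bot.2 hp⟩
  have h2 := generateFrom_prod_eq h1 (isCountablySpanning_measurableSet (α := ℝ × ℝ))
  rw [MeasurableSpace.generateFrom_measurableSet] at h2
  exact h2

lemma measurableSet_of_predictableRect {t : Set ((ℝ≥0 × Ω) × (ℝ × ℝ))}
    (ht : t ∈ predictableRect ℱ) : MeasurableSet t := by
  refine predictable_prod_le ℱ _ ?_
  change MeasurableSet[predictableProd ℱ] t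
  rw [predictableProd_eq_generateFrom]
  exact MeasurableSpace.measurableSet_generateFrom ht

/-- Induction principle for the covariance formula. -/
lemma IsPoissonRandomMeasure.hasCov_of_rect [IsProbabilityMeasure P] [SigmaFinite μ]
    (h : IsPoissonRandomMeasure P ℱ μ N) (hS : MeasurableSet S) (hS' : μ S ≠ ∞)
    (hB : MeasurableSet B) (hU : HasCov P μ N S univ B)
    (hR : ∀ t ∈ predictableRect ℱ, HasCov P μ N S t B)
    (hA : MeasurableSet[predictableProd ℱ] A) : HasCov P μ N S A B := by
  have le := predictable_prod_le ℱ
  refine MeasurableSpace.induction_on_inter (m := predictableProd ℱ)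
    (C := fun t _ => HasCov P μ N S t B)
    (predictableProd_eq_generateFrom ℱ)
    ((isPiSystem_predictableGen ℱ).prod MeasurableSpace.isPiSystem_measurableSet) ?_ hR ?_ ?_ A hA
  · simp [HasCov, slice, compMass]
  · intro t ht hc
    exact h.hasCov_compl hS hS' hB (le _ ht) hU hc
  · intro f hd hf hc
    exact h.hasCov_iUnion hS hS' hB hd (fun i => le _ (hf i)) hc

/-- Cut `T₁` at the later time `t`. The part up to `t`, times the indicator of `F ∩ G`, is known at
`t` and hence independent of the centred mass of `T₂`: it contributes zero. The part after `t` forms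
with `T₂` a product independent of `F ∩ G`, whose mean is the intensity of the intersection. -/
lemma IsPoissonRandomMeasure.integral_compMass_pair [IsProbabilityMeasure P]
    (h : IsPoissonRandomMeasure P ℱ μ N) {T₁ T₂ : Set (ℝ≥0 × ℝ × ℝ)} (h₁ : MeasurableSet T₁)
    (h₁' : μ T₁ ≠ ∞) (h₂ : MeasurableSet T₂) (h₂' : μ T₂ ≠ ∞) {s t : ℝ≥0} (hst : s ≤ t)
    (hT : T₂ ⊆ {e | t < e.1}) {F G : Set Ω} (hF : MeasurableSet[ℱ s] F)
    (hG : MeasurableSet[ℱ t] G) :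
    ∫ ω, (F ∩ G).indicator (fun ω => compMass μ N T₁ ω * compMass μ N T₂ ω) ω ∂P =
      ∫ ω, (F ∩ G).indicator (fun _ => μ.real (T₁ ∩ T₂)) ω ∂P := by
  have hFG : MeasurableSet[ℱ t] (F ∩ G) := (ℱ.mono hst _ hF).inter hG
  have hFG' : MeasurableSet (F ∩ G) := ℱ.le t _ hFG
  have hm : MeasurableSet {e : ℝ≥0 × ℝ × ℝ | t < e.1} := measurableSet_lt measurable_const
    measurable_fst
  set Tb := T₁ ∩ {e | t < e.1} with hTb
  set Ta := T₁ \ {e | t < e.1} with hTa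
  have ha : MeasurableSet Ta := h₁.diff hm
  have hb : MeasurableSet Tb := h₁.inter hm
  have ha' : μ Ta ≠ ∞ := measure_ne_top_of_subset sdiff_subset h₁'
  have hb' : μ Tb ≠ ∞ := measure_ne_top_of_subset inter_subset_left h₁'
  have hat : Ta ⊆ {e | e.1 ≤ t} := fun e he =>
    show e.1 ≤ t from le_of_not_gt fun hh => he.2 hh
  have hbt : Tb ⊆ {e | t < e.1} := inter_subset_right
  have hu := h.ae_compMass_union hb hb' ha ha' disjoint_inf_sdiff
  rw [hTb, hTa, inter_union_sdiff, ← hTb, ← hTa] at hu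
  let φ : Ω → ℝ := (F ∩ G).indicator fun _ => 1
  have hφ : Measurable[ℱ t] φ := (@measurable_const _ _ _ (ℱ t) 1).indicator hFG
  have e : ∫ ω, (F ∩ G).indicator (fun ω => compMass μ N T₁ ω * compMass μ N T₂ ω) ω ∂P =
      ∫ ω, (φ ω * (compMass μ N Tb ω * compMass μ N T₂ ω) +
        (φ ω * compMass μ N Ta ω) * compMass μ N T₂ ω) ∂P := by
    refine integral_congr_ae ?_
    filter_upwards [hu] with ω hω
    by_cases hx : ω ∈ F ∩ G
    · simp only [φ, indicator_of_mem hx, hω]; ring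
    · simp only [φ, indicator_of_notMem hx]; ring
  have m2 := h.memLp_compMass h₂ h₂'
  have i1 : Integrable (fun ω => φ ω * (compMass μ N Tb ω * compMass μ N T₂ ω)) P := by
    have := ((h.memLp_compMass hb hb').integrable_mul m2).indicator hFG'
    refine this.congr (Eventually.of_forall fun ω => ?_)
    by_cases hx : ω ∈ F ∩ G
    · simp [φ, indicator_of_mem hx]
    · simp [φ, indicator_of_notMem hx]
  have i2 : Integrable (fun ω => (φ ω * compMass μ N Ta ω) * compMass μ N T₂ ω) P := by
    have := ((h.memLp_compMass ha ha').integrable_mul m2).indicator hFG'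
    refine this.congr (Eventually.of_forall fun ω => ?_)
    by_cases hx : ω ∈ F ∩ G
    · simp [φ, indicator_of_mem hx]
    · simp [φ, indicator_of_notMem hx]
  have f1 := h.integral_mul_of_past_future hφ
    ((measurable_compMass_future μ N hb hbt).mul (measurable_compMass_future μ N h₂ hT))
  have f2 := h.integral_mul_of_past_future (hφ.mul (h.measurable_compMass_past ha hat))
    (measurable_compMass_future μ N h₂ hT)
  simp only [Pi.mul_apply] at f1 f2
  rw [e, integral_add i1 i2, f1, f2, h.integral_compMass h₂ h₂', mul_zero, add_zero,
    h.integral_compMass_mul hb hb' h₂ h₂', integral_indicator hFG', setIntegral_const,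
    integral_indicator hFG', setIntegral_const]
  have : Tb ∩ T₂ = T₁ ∩ T₂ := by
    ext x; exact ⟨fun hx => ⟨hx.1.1, hx.2⟩, fun hx => ⟨⟨hx.1, hT hx.2⟩, hx.2⟩⟩
  rw [this]
  simp

omit mΩ in
lemma slice_inter_rect (s : ℝ≥0) (F : Set Ω) (D : Set (ℝ × ℝ)) (S : Set (ℝ≥0 × ℝ × ℝ)) (ω : Ω) :
    (ω ∈ F → slice ((Ioi s ×ˢ F) ×ˢ D) ω ∩ S = (Ioi s ×ˢ D) ∩ S) ∧
    (ω ∉ F → slice ((Ioi s ×ˢ F) ×ˢ D) ω ∩ S = ∅) := by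
  constructor
  · intro hω
    ext e; simp [slice, hω]
  · intro hω
    ext e; simp [slice, hω]

lemma IsPoissonRandomMeasure.hasCov_rect_rect_of_le [IsProbabilityMeasure P]
    (h : IsPoissonRandomMeasure P ℱ μ N) (hS : MeasurableSet S) (hS' : μ S ≠ ∞)
    {s t : ℝ≥0} (hst : s ≤ t) {F G : Set Ω} (hF : MeasurableSet[ℱ s] F)
    (hG : MeasurableSet[ℱ t] G) {D E : Set (ℝ × ℝ)} (hD : MeasurableSet D)
    (hE : MeasurableSet E) :
    HasCov P μ N S ((Ioi s ×ˢ F) ×ˢ D) ((Ioi t ×ˢ G) ×ˢ E) := by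
  have key := h.integral_compMass_pair (T₁ := (Ioi s ×ˢ D) ∩ S) (T₂ := (Ioi t ×ˢ E) ∩ S)
    ((measurableSet_Ioi.prod hD).inter hS) (measure_ne_top_of_subset inter_subset_right hS')
    ((measurableSet_Ioi.prod hE).inter hS) (measure_ne_top_of_subset inter_subset_right hS')
    hst (fun e he => he.1.1) hF hG
  unfold HasCov
  convert key using 2
  · ext ω
    by_cases h1 : ω ∈ F
    · by_cases h2 : ω ∈ G
      · rw [indicator_of_mem (mem_inter h1 h2), (slice_inter_rect s F D S ω).1 h1,
          (slice_inter_rect t G E S ω).1 h2]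
      · rw [indicator_of_notMem (fun hx => h2 hx.2), (slice_inter_rect t G E S ω).2 h2]
        simp [compMass]
    · rw [indicator_of_notMem (fun hx => h1 hx.1), (slice_inter_rect s F D S ω).2 h1]
      simp [compMass]
  · ext ω
    have e : slice ((Ioi s ×ˢ F) ×ˢ D) ω ∩ slice ((Ioi t ×ˢ G) ×ˢ E) ω ∩ S =
        (slice ((Ioi s ×ˢ F) ×ˢ D) ω ∩ S) ∩ (slice ((Ioi t ×ˢ G) ×ˢ E) ω ∩ S) := by
      ext e; simp only [mem_inter_iff]; tauto
    rw [e]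
    by_cases h1 : ω ∈ F
    · by_cases h2 : ω ∈ G
      · rw [indicator_of_mem (mem_inter h1 h2), (slice_inter_rect s F D S ω).1 h1,
          (slice_inter_rect t G E S ω).1 h2]
      · rw [indicator_of_notMem (fun hx => h2 hx.2), (slice_inter_rect t G E S ω).2 h2]
        simp
    · rw [indicator_of_notMem (fun hx => h1 hx.1), (slice_inter_rect s F D S ω).2 h1]
      simp

/-- Time zero carries no intensity and hence almost surely no point. This disposes of the generators
over `{⊥}` and lets the whole space be replaced by a predictable rectangle. -/
lemma IsPoissonRandomMeasure.hasCov_congr [IsProbabilityMeasure P] {A' : Set ((ℝ≥0 × Ω) × (ℝ × ℝ))}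
    (h : IsPoissonRandomMeasure P ℱ μ N) (h0 : μ {e | e.1 = 0} = 0)
    (hAA : ∀ p : (ℝ≥0 × Ω) × (ℝ × ℝ), p.1.1 ≠ 0 → (p ∈ A ↔ p ∈ A'))
    (hc : HasCov P μ N S A B) : HasCov P μ N S A' B := by
  have hm : MeasurableSet {e : ℝ≥0 × ℝ × ℝ | e.1 = 0} :=
    measurableSet_eq_fun measurable_fst measurable_const
  have hz : ∀ {ν : Measure (ℝ≥0 × ℝ × ℝ)}, ν {e | e.1 = 0} = 0 → ∀ (ω : Ω) (T : Set _),
      ν.real (slice A ω ∩ T) = ν.real (slice A' ω ∩ T) := by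
    intro ν hν ω T
    rw [measureReal_def, measureReal_def]
    congr 1
    refine measure_congr ?_
    have : ∀ᵐ e ∂ν, e.1 ≠ 0 := by rw [ae_iff]; simpa using hν
    filter_upwards [this] with e he
    exact propext (and_congr_left fun _ => hAA ((e.1, ω), e.2) he)
  unfold HasCov at hc ⊢
  rw [← integral_congr_ae (f := fun ω => compMass μ N (slice A ω ∩ S) ω *
    compMass μ N (slice B ω ∩ S) ω), hc]
  · simp_rw [inter_assoc, hz h0]
  · filter_upwards [h.ae_null hm h0] with ω hω
    unfold compMass
    rw [hz h0, hz hω]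

lemma IsPoissonRandomMeasure.hasCov_rect_rect [IsProbabilityMeasure P]
    (h : IsPoissonRandomMeasure P ℱ μ N) (h0 : μ {e | e.1 = 0} = 0) (hS : MeasurableSet S)
    (hS' : μ S ≠ ∞) (hA : A ∈ predictableRect ℱ) (hB : B ∈ predictableRect ℱ) :
    HasCov P μ N S A B := by
  have hE : ∀ {B}, HasCov P μ N S ∅ B := by intro B; simp [HasCov, slice, compMass]
  have hE' : ∀ {B} {F : Set Ω} {D : Set (ℝ × ℝ)}, HasCov P μ N S ((({⊥} : Set ℝ≥0) ×ˢ F) ×ˢ D) B := by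
    intro B F D
    refine h.hasCov_congr h0 (fun p hp => ?_) hE
    simp only [mem_empty_iff_false, mem_prod, mem_singleton_iff, false_iff, not_and]
    intro h1; exact absurd h1.1 hp
  obtain ⟨_, ⟨F, hF, rfl⟩ | ⟨s, F, hF, rfl⟩, D, hD, rfl⟩ := hA
  · exact hE'
  obtain ⟨_, ⟨G, hG, rfl⟩ | ⟨t, G, hG, rfl⟩, E, hEm, rfl⟩ := hB
  · exact hE'.symm
  rcases le_total s t with hst | hst
  · exact h.hasCov_rect_rect_of_le hS hS' hst hF hG hD hEm
  · exact (h.hasCov_rect_rect_of_le hS hS' hst hG hF hEm hD).symm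

/-- The covariance formula on the predictable σ-algebra. -/
theorem IsPoissonRandomMeasure.hasCov [IsProbabilityMeasure P] [SigmaFinite μ]
    (h : IsPoissonRandomMeasure P ℱ μ N) (h0 : μ {e | e.1 = 0} = 0) (hS : MeasurableSet S)
    (hS' : μ S ≠ ∞) (hA : MeasurableSet[predictableProd ℱ] A)
    (hB : MeasurableSet[predictableProd ℱ] B) : HasCov P μ N S A B := by
  have hRm : ((Ioi (0 : ℝ≥0) ×ˢ (univ : Set Ω)) ×ˢ (univ : Set (ℝ × ℝ))) ∈ predictableRect ℱ :=
    ⟨_, Or.inr ⟨0, univ, MeasurableSet.univ, rfl⟩, univ, MeasurableSet.univ (α := ℝ × ℝ), rfl⟩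
  have hU : ∀ {B}, HasCov P μ N S ((Ioi (0 : ℝ≥0) ×ˢ (univ : Set Ω)) ×ˢ (univ : Set (ℝ × ℝ))) B →
      HasCov P μ N S univ B := fun hc => h.hasCov_congr h0 (fun p hp => by
    simpa using pos_iff_ne_zero.2 hp) hc
  -- The monotone class argument runs twice: in the first set against a rectangle, then, by
  -- symmetry, in the other one.
  have step : ∀ {A t}, t ∈ predictableRect ℱ → MeasurableSet[predictableProd ℱ] A →
      HasCov P μ N S A t := fun ht hA =>
    h.hasCov_of_rect hS hS' (measurableSet_of_predictableRect ht)
      (hU (h.hasCov_rect_rect h0 hS hS' hRm ht))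
      (fun t' ht' => h.hasCov_rect_rect h0 hS hS' ht' ht) hA
  exact h.hasCov_of_rect hS hS' (predictable_prod_le ℱ _ hB) (hU (step hRm hB).symm)
    (fun t ht => (step ht hB).symm) hA

end Covariance

/-! ### Second moments of compensated integrals -/

section Isometry

variable {Ω : Type u} [mΩ : MeasurableSpace Ω] {P : Measure Ω} {ℱ : Filtration ℝ≥0 mΩ}
  {N : Ω → Measure (ℝ≥0 × ℝ × ℝ)} {μ : Measure (ℝ≥0 × ℝ × ℝ)}
  {S : Set (ℝ≥0 × ℝ × ℝ)} {G : (ℝ≥0 × Ω) × (ℝ × ℝ) → ℝ}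

/-- The pathwise compensated integral. -/
def compInt (μ : Measure (ℝ≥0 × ℝ × ℝ)) (N : Ω → Measure (ℝ≥0 × ℝ × ℝ))
    (G : (ℝ≥0 × Ω) × (ℝ × ℝ) → ℝ) (ω : Ω) : ℝ :=
  ∫ e, G ((e.1, ω), e.2) ∂(N ω) - ∫ e, G ((e.1, ω), e.2) ∂μ

lemma IsPoissonRandomMeasure.aestronglyMeasurable_integral [SigmaFinite μ]
    (h : IsPoissonRandomMeasure P ℱ μ N) (hG : Measurable G) (hS : MeasurableSet S) :
    AEStronglyMeasurable (fun ω => ∫ e in S, G ((e.1, ω), e.2) ∂(N ω)) P := by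
  obtain ⟨κ, hκ, hκN⟩ := h.exists_kernel
  have h1 : StronglyMeasurable fun p : Ω × (ℝ≥0 × ℝ × ℝ) =>
      S.indicator (fun e => G ((e.1, p.1), e.2)) p.2 := by
    refine Measurable.stronglyMeasurable ?_
    exact Measurable.indicator (f := fun p : Ω × (ℝ≥0 × ℝ × ℝ) => G ((p.2.1, p.1), p.2.2))
      (hG.comp measurable_place) (s := {p : Ω × (ℝ≥0 × ℝ × ℝ) | p.2 ∈ S}) (measurable_snd hS)
  refine (h1.integral_kernel_prod_right' (κ := κ)).aestronglyMeasurable.congr ?_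
  filter_upwards [hκN] with ω hω
  rw [hω, integral_indicator hS]

lemma stronglyMeasurable_integral_section [SigmaFinite μ] (hG : Measurable G) :
    StronglyMeasurable fun ω => ∫ e, G ((e.1, ω), e.2) ∂μ :=
  StronglyMeasurable.integral_prod_right' (f := fun p : Ω × (ℝ≥0 × ℝ × ℝ) =>
    G ((p.2.1, p.1), p.2.2)) (hG.comp measurable_place).stronglyMeasurable

lemma IsPoissonRandomMeasure.aestronglyMeasurable_compInt [SigmaFinite μ]
    (h : IsPoissonRandomMeasure P ℱ μ N) (hG : Measurable G) :
    AEStronglyMeasurable (compInt μ N G) P := by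
  refine AEStronglyMeasurable.sub ?_
    (stronglyMeasurable_integral_section hG).aestronglyMeasurable
  simpa using h.aestronglyMeasurable_integral hG MeasurableSet.univ

lemma IsPoissonRandomMeasure.aestronglyMeasurable_compInt_restrict [SigmaFinite μ]
    (h : IsPoissonRandomMeasure P ℱ μ N) (hG : Measurable G) (hS : MeasurableSet S) :
    AEStronglyMeasurable (compInt (μ.restrict S) (fun ω => (N ω).restrict S) G) P :=
  (h.aestronglyMeasurable_integral hG hS).sub
    (stronglyMeasurable_integral_section hG).aestronglyMeasurable

/-! ### Simple integrands -/

omit mΩ in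
lemma eq_sum_indicator {X : Type*} {φ : X → ℝ} {R : Finset ℝ} (hR : ∀ p, φ p ∈ R) (p : X) :
    φ p = ∑ x ∈ R, (φ ⁻¹' {x}).indicator (fun _ => x) p := by
  rw [Finset.sum_eq_single (φ p)]
  · simp
  · intro x _ hx
    exact indicator_of_notMem (fun hp => hx hp.symm) _
  · intro hx
    exact absurd (hR p) hx

lemma exists_simple_approx {X : Type*} [MeasurableSpace X] {G : X → ℝ} (hG : Measurable G) {C : ℝ}
    (hC0 : 0 ≤ C) (hC : ∀ p, |G p| ≤ C) : ∃ φ : ℕ → X → ℝ,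
      (∀ n, ∃ R : Finset ℝ, ∀ p, φ n p ∈ R) ∧ (∀ n, Measurable (φ n)) ∧
      (∀ p, Tendsto (fun n => φ n p) atTop (𝓝 (G p))) ∧ ∀ n p, |φ n p| ≤ C :=
  ⟨fun n => hG.stronglyMeasurable.approxBounded C n,
    fun _ => ⟨_, fun p => SimpleFunc.mem_range_self _ p⟩, fun _ => SimpleFunc.measurable _,
    fun p => hG.stronglyMeasurable.tendsto_approxBounded_of_norm_le (hC p),
    fun n p => hG.stronglyMeasurable.norm_approxBounded_le hC0 n p⟩

lemma measurable_truncate {X : Type*} [MeasurableSpace X] {G : X → ℝ} (hG : Measurable G) (C : ℝ) :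
    Measurable ({p | |G p| ≤ C}.indicator G) :=
  hG.indicator (measurableSet_le (_root_.measurable_abs.comp hG) measurable_const)

variable {φ : (ℝ≥0 × Ω) × (ℝ × ℝ) → ℝ} {R : Finset ℝ}

lemma setIntegral_simple (hφ : Measurable φ) (hR : ∀ p, φ p ∈ R)
    {ν : Measure (ℝ≥0 × ℝ × ℝ)} (hν : ν S ≠ ∞) (ω : Ω) :
    ∫ e in S, φ ((e.1, ω), e.2) ∂ν = ∑ x ∈ R, x * ν.real (slice (φ ⁻¹' {x}) ω ∩ S) := by
  have : Fact (ν S < ∞) := ⟨hν.lt_top⟩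
  have hm : ∀ x, MeasurableSet (slice (φ ⁻¹' {x}) ω) := fun x =>
    measurableSet_slice (hφ (measurableSet_singleton x)) ω
  have e : ∀ e : ℝ≥0 × ℝ × ℝ, φ ((e.1, ω), e.2) =
      ∑ x ∈ R, (slice (φ ⁻¹' {x}) ω).indicator (fun _ => x) e := fun e =>
    eq_sum_indicator hR _
  simp_rw [e]
  rw [integral_finsetSum _ fun x _ => (integrable_const x).indicator (hm x)]
  refine Finset.sum_congr rfl fun x _ => ?_
  rw [integral_indicator_const _ (hm x), measureReal_restrict_apply (hm x), smul_eq_mul, mul_comm]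

lemma setIntegral_simple_sq (hφ : Measurable φ) (hR : ∀ p, φ p ∈ R)
    {ν : Measure (ℝ≥0 × ℝ × ℝ)} (hν : ν S ≠ ∞) (ω : Ω) :
    ∫ e in S, φ ((e.1, ω), e.2) ^ 2 ∂ν = ∑ x ∈ R, ∑ y ∈ R,
      x * y * ν.real (slice (φ ⁻¹' {x}) ω ∩ slice (φ ⁻¹' {y}) ω ∩ S) := by
  have : Fact (ν S < ∞) := ⟨hν.lt_top⟩
  have hm : ∀ x, MeasurableSet (slice (φ ⁻¹' {x}) ω) := fun x =>
    measurableSet_slice (hφ (measurableSet_singleton x)) ω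
  have e : ∀ e : ℝ≥0 × ℝ × ℝ, φ ((e.1, ω), e.2) ^ 2 = ∑ x ∈ R, ∑ y ∈ R,
      (slice (φ ⁻¹' {x}) ω ∩ slice (φ ⁻¹' {y}) ω).indicator (fun _ => x * y) e := by
    intro e
    rw [sq, eq_sum_indicator hR, Finset.sum_mul_sum]
    refine Finset.sum_congr rfl fun x _ => Finset.sum_congr rfl fun y _ => ?_
    exact (inter_indicator_mul (s := slice (φ ⁻¹' {x}) ω) (t := slice (φ ⁻¹' {y}) ω)
      (fun _ => x) (fun _ => y) e).symm
  simp_rw [e]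
  rw [integral_finsetSum _ fun x _ => integrable_finsetSum _ fun y _ =>
    (integrable_const (x * y)).indicator ((hm x).inter (hm y))]
  refine Finset.sum_congr rfl fun x _ => ?_
  rw [integral_finsetSum _ fun y _ => (integrable_const (x * y)).indicator ((hm x).inter (hm y))]
  refine Finset.sum_congr rfl fun y _ => ?_
  rw [integral_indicator_const _ ((hm x).inter (hm y)),
    measureReal_restrict_apply ((hm x).inter (hm y)), smul_eq_mul, mul_comm]

variable [IsProbabilityMeasure P] [SigmaFinite μ]

/-- Expanding the square over the finitely many values of the integrand gives a double sum of
covariances of predictable level sets. -/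
lemma IsPoissonRandomMeasure.integral_compInt_simple_sq (h : IsPoissonRandomMeasure P ℱ μ N)
    (h0 : μ {e | e.1 = 0} = 0) (hS : MeasurableSet S) (hS' : μ S ≠ ∞)
    (hφ : IsPredictableIntegrand ℱ φ) (hR : ∀ p, φ p ∈ R) :
    Integrable (fun ω => compInt (μ.restrict S) (fun ω => (N ω).restrict S) φ ω ^ 2) P ∧
    ∫ ω, compInt (μ.restrict S) (fun ω => (N ω).restrict S) φ ω ^ 2 ∂P =
      ∫ ω, ∫ e in S, φ ((e.1, ω), e.2) ^ 2 ∂μ ∂P := by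
  have hA : ∀ x, MeasurableSet[predictableProd ℱ] (φ ⁻¹' {x}) := fun x =>
    hφ (measurableSet_singleton x)
  have hA' : ∀ x, MeasurableSet (φ ⁻¹' {x}) := fun x => predictable_prod_le ℱ _ (hA x)
  have e1 : ∀ᵐ ω ∂P, compInt (μ.restrict S) (fun ω => (N ω).restrict S) φ ω ^ 2 =
      ∑ x ∈ R, ∑ y ∈ R, x * y * (compMass μ N (slice (φ ⁻¹' {x}) ω ∩ S) ω *
        compMass μ N (slice (φ ⁻¹' {y}) ω ∩ S) ω) := by
    filter_upwards [h.ae_lt_top hS hS'] with ω hω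
    have : compInt (μ.restrict S) (fun ω => (N ω).restrict S) φ ω =
        ∑ x ∈ R, x * compMass μ N (slice (φ ⁻¹' {x}) ω ∩ S) ω := by
      unfold compInt compMass
      rw [setIntegral_simple hφ.measurable hR hω.ne,
        setIntegral_simple hφ.measurable hR hS', ← Finset.sum_sub_distrib]
      simp_rw [mul_sub]
    rw [this, sq, Finset.sum_mul_sum]
    refine Finset.sum_congr rfl fun x _ => Finset.sum_congr rfl fun y _ => by ring
  have i1 : ∀ x y, Integrable (fun ω => x * y * (compMass μ N (slice (φ ⁻¹' {x}) ω ∩ S) ω *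
        compMass μ N (slice (φ ⁻¹' {y}) ω ∩ S) ω)) P := fun x y =>
    ((h.memLp_compMass_slice hS hS' (hA' x)).integrable_mul
      (h.memLp_compMass_slice hS hS' (hA' y))).const_mul _
  have i2 : ∀ x y, Integrable (fun ω => x * y *
      μ.real (slice (φ ⁻¹' {x}) ω ∩ slice (φ ⁻¹' {y}) ω ∩ S)) P := fun x y =>
    (IsPoissonRandomMeasure.integrable_measure_slice_inter hS hS' (hA' x) (hA' y)).const_mul _
  refine ⟨(integrable_finsetSum _ fun x _ => integrable_finsetSum _ fun y _ => i1 x y).congr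
    (e1.mono fun ω hω => hω.symm), ?_⟩
  simp_rw [setIntegral_simple_sq hφ.measurable hR hS']
  rw [integral_congr_ae e1, integral_finsetSum _ fun x _ => integrable_finsetSum _ fun y _ =>
    i1 x y, integral_finsetSum _ fun x _ => integrable_finsetSum _ fun y _ => i2 x y]
  refine Finset.sum_congr rfl fun x _ => ?_
  rw [integral_finsetSum _ fun y _ => i1 x y, integral_finsetSum _ fun y _ => i2 x y]
  refine Finset.sum_congr rfl fun y _ => ?_
  rw [integral_const_mul, integral_const_mul, h.hasCov h0 hS hS' (hA x) (hA y)]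

lemma IsPoissonRandomMeasure.lintegral_compInt_simple_sq (h : IsPoissonRandomMeasure P ℱ μ N)
    (h0 : μ {e | e.1 = 0} = 0) (hS : MeasurableSet S) (hS' : μ S ≠ ∞)
    (hφ : IsPredictableIntegrand ℱ φ) (hR : ∀ p, φ p ∈ R) :
    ∫⁻ ω, ENNReal.ofReal (compInt (μ.restrict S) (fun ω => (N ω).restrict S) φ ω ^ 2) ∂P =
      ∫⁻ p, ENNReal.ofReal (φ ((p.2.1, p.1), p.2.2) ^ 2) ∂(P.prod (μ.restrict S)) := by
  have : Fact (μ S < ∞) := ⟨hS'.lt_top⟩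
  obtain ⟨h1, h2⟩ := h.integral_compInt_simple_sq h0 hS hS' hφ hR
  have hi : Integrable (fun p : Ω × (ℝ≥0 × ℝ × ℝ) => φ ((p.2.1, p.1), p.2.2) ^ 2)
      (P.prod (μ.restrict S)) := by
    refine Integrable.mono' (integrable_const (∑ x ∈ R, x ^ 2))
      ((hφ.measurable.comp measurable_place).pow_const 2).aestronglyMeasurable
      (Eventually.of_forall fun p => ?_)
    rw [Real.norm_of_nonneg (sq_nonneg _)]
    exact Finset.single_le_sum (f := fun x : ℝ => x ^ 2) (fun _ _ => sq_nonneg _) (hR _)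
  rw [← ofReal_integral_eq_lintegral_ofReal h1 (Eventually.of_forall fun ω => sq_nonneg _), h2,
    ← ofReal_integral_eq_lintegral_ofReal hi (Eventually.of_forall fun ω => sq_nonneg _),
    integral_prod _ hi]

/-! ### Bounded and general integrands -/

/-- Bounded simple predictable approximants converge pathwise under the integrals, since `N ω S` is
almost surely finite. Fatou keeps one inequality of the isometry, the only one used later. -/
lemma IsPoissonRandomMeasure.lintegral_compInt_sq_le_of_bounded
    (h : IsPoissonRandomMeasure P ℱ μ N) (h0 : μ {e | e.1 = 0} = 0) (hS : MeasurableSet S)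
    (hS' : μ S ≠ ∞) (hG : IsPredictableIntegrand ℱ G) {C : ℝ} (hC : ∀ p, |G p| ≤ C) :
    ∫⁻ ω, ENNReal.ofReal (compInt (μ.restrict S) (fun ω => (N ω).restrict S) G ω ^ 2) ∂P ≤
      ∫⁻ p, ENNReal.ofReal (G ((p.2.1, p.1), p.2.2) ^ 2) ∂(P.prod (μ.restrict S)) := by
  have : Fact (μ S < ∞) := ⟨hS'.lt_top⟩
  have hC0 : 0 ≤ C ∨ IsEmpty Ω := by
    rcases isEmpty_or_nonempty Ω with hΩ | ⟨⟨ω⟩⟩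
    · exact Or.inr hΩ
    · exact Or.inl ((abs_nonneg _).trans (hC ((0, ω), (0, 0))))
  rcases hC0 with hC0 | hΩ
  swap
  · rw [Measure.eq_zero_of_isEmpty P]; simp
  obtain ⟨φ, hφR, hφp, hφt, hφb⟩ :=
    @exists_simple_approx _ (predictableProd ℱ) G hG C hC0 hC
  have hφm : ∀ n, Measurable (φ n) := fun n => IsPredictableIntegrand.measurable (hφp n)
  have hint : ∀ (ν : Measure (ℝ≥0 × ℝ × ℝ)), ν S < ∞ → ∀ ω,
      Tendsto (fun n => ∫ e in S, φ n ((e.1, ω), e.2) ∂ν) atTop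
        (𝓝 (∫ e in S, G ((e.1, ω), e.2) ∂ν)) := by
    intro ν hν ω
    have : Fact (ν S < ∞) := ⟨hν⟩
    exact tendsto_integral_of_dominated_convergence (fun _ => C)
      (fun n => ((hφm n).comp (measurable_place_right ω)).aestronglyMeasurable)
      (integrable_const _) (fun n => Eventually.of_forall fun e => hφb n _)
      (Eventually.of_forall fun e => hφt _)
  have hlim : ∀ᵐ ω ∂P, Tendsto (fun n => ENNReal.ofReal
      (compInt (μ.restrict S) (fun ω => (N ω).restrict S) (φ n) ω ^ 2)) atTop
      (𝓝 (ENNReal.ofReal (compInt (μ.restrict S) (fun ω => (N ω).restrict S) G ω ^ 2))) := by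
    filter_upwards [h.ae_lt_top hS hS'] with ω hω
    refine (ENNReal.continuous_ofReal.tendsto _).comp (Tendsto.pow ?_ 2)
    exact (hint _ hω ω).sub (hint _ hS'.lt_top ω)
  have hR : Tendsto (fun n => ∫⁻ p, ENNReal.ofReal (φ n ((p.2.1, p.1), p.2.2) ^ 2)
      ∂(P.prod (μ.restrict S))) atTop
      (𝓝 (∫⁻ p, ENNReal.ofReal (G ((p.2.1, p.1), p.2.2) ^ 2) ∂(P.prod (μ.restrict S)))) := by
    refine tendsto_lintegral_of_dominated_convergence (fun _ => ENNReal.ofReal (C ^ 2))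
      (fun n => (((hφm n).comp measurable_place).pow_const 2).ennreal_ofReal)
      (fun n => Eventually.of_forall fun p => ENNReal.ofReal_le_ofReal ?_) ?_
      (Eventually.of_forall fun p => (ENNReal.continuous_ofReal.tendsto _).comp
        ((hφt _).pow 2))
    · have := hφb n ((p.2.1, p.1), p.2.2)
      rw [← sq_abs]
      exact pow_le_pow_left₀ (abs_nonneg _) this 2
    · rw [lintegral_const]
      exact ENNReal.mul_ne_top ENNReal.ofReal_ne_top (measure_ne_top _ _)
  calc _ = ∫⁻ ω, liminf (fun n => ENNReal.ofReal
        (compInt (μ.restrict S) (fun ω => (N ω).restrict S) (φ n) ω ^ 2)) atTop ∂P :=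
        lintegral_congr_ae (hlim.mono fun ω hω => hω.liminf_eq.symm)
    _ ≤ liminf (fun n => ∫⁻ ω, ENNReal.ofReal
        (compInt (μ.restrict S) (fun ω => (N ω).restrict S) (φ n) ω ^ 2) ∂P) atTop :=
        lintegral_liminf_le' fun n => ((h.aestronglyMeasurable_compInt_restrict (hφm n)
          hS).aemeasurable.pow_const 2).ennreal_ofReal
    _ = _ := by
        refine Eq.trans ?_ hR.liminf_eq
        congr 1
        ext n
        obtain ⟨R, hR⟩ := hφR n
        exact h.lintegral_compInt_simple_sq h0 hS hS' (hφp n) hR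

/-- The isometry inequality. -/
theorem IsPoissonRandomMeasure.lintegral_compInt_sq_le
    (h : IsPoissonRandomMeasure P ℱ μ N) (h0 : μ {e | e.1 = 0} = 0)
    (hG : IsPredictableIntegrand ℱ G)
    (hi : ∀ᵐ ω ∂P, Integrable (fun e => G ((e.1, ω), e.2)) μ ∧
      Integrable (fun e => G ((e.1, ω), e.2)) (N ω)) :
    ∫⁻ ω, ENNReal.ofReal (compInt μ N G ω ^ 2) ∂P ≤
      ∫⁻ ω, ∫⁻ e, ENNReal.ofReal (G ((e.1, ω), e.2) ^ 2) ∂μ ∂P := by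
  have hGm := hG.measurable
  -- The integrand is truncated in size and, through `S n`, in space. Both truncations are dominated
  -- by `|G|`, so the pathwise integrals converge for almost every `ω`, and Fatou applies once more.
  let g : ℕ → (ℝ≥0 × Ω) × (ℝ × ℝ) → ℝ := fun n => {p | |G p| ≤ n}.indicator G
  have hg : ∀ n, IsPredictableIntegrand ℱ (g n) := fun n =>
    @measurable_truncate _ (predictableProd ℱ) G hG n
  have hgm := fun n => (hg n).measurable
  have hgb : ∀ n p, |g n p| ≤ n := fun n p => by
    by_cases hp : |G p| ≤ n
    · simpa only [g, indicator_of_mem (show p ∈ {p | |G p| ≤ n} from hp)]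
    · simp [g, indicator_of_notMem (show p ∉ {p | |G p| ≤ n} from hp)]
  have hgG : ∀ n p, |g n p| ≤ |G p| := fun n p => by
    by_cases hp : |G p| ≤ n
    · simp only [g, indicator_of_mem (show p ∈ {p | |G p| ≤ n} from hp)]; exact le_rfl
    · simp [g, indicator_of_notMem (show p ∉ {p | |G p| ≤ n} from hp)]
  let S := spanningSets μ
  have hS := measurableSet_spanningSets μ
  have hS' := fun n => (measure_spanningSets_lt_top μ n).ne
  have hpt : ∀ ω (e : ℝ≥0 × ℝ × ℝ), Tendsto (fun n => (S n).indicator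
      (fun e => g n ((e.1, ω), e.2)) e) atTop (𝓝 (G ((e.1, ω), e.2))) := by
    intro ω e
    refine tendsto_const_nhds.congr' ?_
    obtain ⟨i, hi⟩ := exists_nat_ge |G ((e.1, ω), e.2)|
    have : e ∈ ⋃ n, S n := by rw [iUnion_spanningSets]; trivial
    obtain ⟨j, hj⟩ := mem_iUnion.1 this
    filter_upwards [eventually_ge_atTop (max i j)] with n hn
    rw [indicator_of_mem (monotone_spanningSets μ ((le_max_right _ _).trans hn) hj)]
    refine (indicator_of_mem (s := {p | |G p| ≤ n}) ?_ G).symm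
    exact hi.trans (by exact_mod_cast (le_max_left _ _).trans hn)
  have hint : ∀ ω (ν : Measure (ℝ≥0 × ℝ × ℝ)), Integrable (fun e => G ((e.1, ω), e.2)) ν →
      Tendsto (fun n => ∫ e in S n, g n ((e.1, ω), e.2) ∂ν) atTop
        (𝓝 (∫ e, G ((e.1, ω), e.2) ∂ν)) := by
    intro ω ν hν
    simp_rw [S, ← integral_indicator (hS _)]
    refine tendsto_integral_of_dominated_convergence _ (fun n => ?_) hν.norm
      (fun n => Eventually.of_forall fun e => ?_) (Eventually.of_forall (hpt ω))
    · exact (((hgm n).comp (measurable_place_right ω)).indicator (hS n)).aestronglyMeasurable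
    · exact (norm_indicator_le_norm_self _ _).trans (hgG n _)
  have hlim : ∀ᵐ ω ∂P, Tendsto (fun n => ENNReal.ofReal
      (compInt (μ.restrict (S n)) (fun ω => (N ω).restrict (S n)) (g n) ω ^ 2)) atTop
      (𝓝 (ENNReal.ofReal (compInt μ N G ω ^ 2))) := by
    filter_upwards [hi] with ω hω
    refine (ENNReal.continuous_ofReal.tendsto _).comp (Tendsto.pow ?_ 2)
    exact (hint ω _ hω.2).sub (hint ω _ hω.1)
  calc _ = ∫⁻ ω, liminf (fun n => ENNReal.ofReal
        (compInt (μ.restrict (S n)) (fun ω => (N ω).restrict (S n)) (g n) ω ^ 2)) atTop ∂P :=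
        lintegral_congr_ae (hlim.mono fun ω hω => hω.liminf_eq.symm)
    _ ≤ liminf (fun n => ∫⁻ ω, ENNReal.ofReal
        (compInt (μ.restrict (S n)) (fun ω => (N ω).restrict (S n)) (g n) ω ^ 2) ∂P) atTop :=
        lintegral_liminf_le' fun n => ((h.aestronglyMeasurable_compInt_restrict (hgm n)
          (hS n)).aemeasurable.pow_const 2).ennreal_ofReal
    _ ≤ liminf (fun _ : ℕ => ∫⁻ ω, ∫⁻ e, ENNReal.ofReal (G ((e.1, ω), e.2) ^ 2) ∂μ ∂P) atTop := by
        refine liminf_le_liminf (Eventually.of_forall fun n => ?_)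
        refine (h.lintegral_compInt_sq_le_of_bounded h0 (hS n) (hS' n) (hg n) (hgb n)).trans ?_
        have hm : Measurable fun p : Ω × (ℝ≥0 × ℝ × ℝ) =>
            ENNReal.ofReal (g n ((p.2.1, p.1), p.2.2) ^ 2) :=
          (((hgm n).comp measurable_place).pow_const 2).ennreal_ofReal
        rw [lintegral_prod _ hm.aemeasurable]
        refine lintegral_mono fun ω => ?_
        refine (lintegral_mono fun e => ENNReal.ofReal_le_ofReal ?_).trans
          (lintegral_mono' Measure.restrict_le_self le_rfl)
        exact sq_le_sq.2 (hgG n _)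
    _ = _ := liminf_const _

end Isometry

/-! ### Stability of the compensated integral in probability -/

lemma tendstoInMeasure_add {X : Type*} {mX : MeasurableSpace X} {μ : Measure X} {f g : ℕ → X → ℝ}
    {f' g' : X → ℝ} (hf : TendstoInMeasure μ f atTop f') (hg : TendstoInMeasure μ g atTop g') :
    TendstoInMeasure μ (fun n x => f n x + g n x) atTop fun x => f' x + g' x := by
  intro ε hε
  have hε2 : 0 < ε / 2 := ENNReal.half_pos hε.ne'
  have h := (hf _ hε2).add (hg _ hε2)
  rw [add_zero] at h
  refine tendsto_of_tendsto_of_tendsto_of_le_of_le tendsto_const_nhds h (fun _ => zero_le)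
    fun n => ?_
  refine (measure_mono fun x hx => ?_).trans (measure_union_le _ _)
  by_contra hcon
  simp only [mem_union, mem_ofPred_eq, not_or, not_le] at hcon
  have h1 := (edist_add_add_le (f n x) (g n x) (f' x) (g' x)).trans_lt
    (ENNReal.add_lt_add hcon.1 hcon.2)
  rw [ENNReal.add_halves] at h1
  exact absurd (show ε ≤ _ from hx) (not_le.2 h1)

section Stability

variable {Ω : Type u} [mΩ : MeasurableSpace Ω] {P : Measure Ω} {ℱ : Filtration ℝ≥0 mΩ}
  {N : Ω → Measure (ℝ≥0 × ℝ × ℝ)} {μ : Measure (ℝ≥0 × ℝ × ℝ)}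
  {G : (ℝ≥0 × Ω) × (ℝ × ℝ) → ℝ}

/-- Integrals of predictable functions over the past are adapted. -/
lemma measurable_lintegral_past [SFinite μ] {f : (ℝ≥0 × Ω) × (ℝ × ℝ) → ℝ≥0∞}
    (hf : Measurable[predictableProd ℱ] f) (s : ℝ≥0) :
    Measurable[ℱ s] fun ω => ∫⁻ e in {e | e.1 < s}, f ((e.1, ω), e.2) ∂μ := by
  have hS : MeasurableSet {e : ℝ≥0 × ℝ × ℝ | e.1 < s} :=
    measurableSet_lt measurable_fst measurable_const
  have h1 : Measurable[(Subtype.instMeasurableSpace.prod (ℱ s)).prod inferInstance]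
      fun p : (Iic s × Ω) × (ℝ × ℝ) => f ((p.1.1.1, p.1.2), p.2) := by
    refine hf.comp ?_
    have h2 : Measurable[Subtype.instMeasurableSpace.prod (ℱ s), ℱ.predictable]
        fun x : Iic s × Ω => ((x.1 : ℝ≥0), x.2) := measurable_inclusion_predictable
    exact @Measurable.prodMk _ ((Subtype.instMeasurableSpace.prod (ℱ s)).prod inferInstance) _ _
      ℱ.predictable _ _ _ (h2.comp (@measurable_fst _ _ (Subtype.instMeasurableSpace.prod (ℱ s)) _))
      (@measurable_snd _ _ (Subtype.instMeasurableSpace.prod (ℱ s)) _)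
  -- Replacing the time by its minimum with `s` lands in `Iic s`, where predictable functions are
  -- measurable for `ℱ s`, and changes nothing on the domain of integration.
  have h3 : Measurable[(ℱ s).prod inferInstance, (Subtype.instMeasurableSpace.prod (ℱ s)).prod
      inferInstance] fun p : Ω × (ℝ≥0 × ℝ × ℝ) =>
        (((⟨min p.2.1 s, mem_Iic.2 (min_le_right _ _)⟩, p.1), p.2.2) : (Iic s × Ω) × (ℝ × ℝ)) := by
    let : MeasurableSpace Ω := ℱ s
    have : Measurable fun p : Ω × (ℝ≥0 × ℝ × ℝ) => (⟨min p.2.1 s, mem_Iic.2 (min_le_right _ _)⟩ : Iic s) :=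
      Measurable.subtype_mk (by fun_prop)
    exact (this.prodMk measurable_fst).prodMk (by fun_prop)
  have h4 := h1.comp h3
  have h5 := @Measurable.lintegral_prod_right' _ _ (ℱ s) _ (μ.restrict {e | e.1 < s}) _ _ h4
  convert h5 using 2 with ω
  refine setLIntegral_congr_fun hS fun e he => ?_
  simp only [Function.comp_apply]
  rw [min_eq_left (le_of_lt he)]

lemma exists_countable_past : ∃ D : Set ℝ≥0, D.Countable ∧ ∀ s t : ℝ≥0, s < t →
    ∃ q ∈ D, s < q ∧ q < t := by
  obtain ⟨D, hD, hD'⟩ := TopologicalSpace.exists_countable_dense ℝ≥0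
  exact ⟨D, hD, fun s t hst => by
    obtain ⟨q, hq, h1⟩ := hD'.exists_between hst
    exact ⟨q, hq, h1.1, h1.2⟩⟩

lemma measure_past_eq_iSup (ν : Measure (ℝ≥0 × ℝ × ℝ)) {D T : Set ℝ≥0} (hD : D.Countable)
    (hT : T ⊆ D) : ν (⋃ q ∈ T, {e | e.1 < q}) = ⨆ q ∈ T, ν {e | e.1 < q} := by
  refine measure_biUnion_eq_iSup (hD.mono hT) ?_
  intro a ha b hb
  rcases le_total a b with h | h
  · exact ⟨b, hb, fun e (he : e.1 < a) => he.trans_le h, fun e he => he⟩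
  · exact ⟨a, ha, fun e he => he, fun e (he : e.1 < b) => he.trans_le h⟩

/-- The accumulated mass of a nonnegative predictable function before each time is predictable. -/
lemma measurableSet_accumulated_le [SFinite μ] {f : (ℝ≥0 × Ω) × (ℝ × ℝ) → ℝ≥0∞}
    (hf : Measurable[predictableProd ℱ] f) (x : ℝ≥0∞) :
    MeasurableSet[predictableProd ℱ] {p : (ℝ≥0 × Ω) × (ℝ × ℝ) |
      ∫⁻ e in {e | e.1 < p.1.1}, f ((e.1, p.1.2), e.2) ∂μ ≤ x} := by
  obtain ⟨D, hD, hDd⟩ := exists_countable_past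
  have hS : ∀ s, MeasurableSet {e : ℝ≥0 × ℝ × ℝ | e.1 < s} := fun s =>
    measurableSet_lt measurable_fst measurable_const
  -- The mass of the strict past is left continuous in time. It exceeds `x` at time `s` exactly when
  -- it does so at some `q < s` of a countable dense set, which displays the complement as a
  -- countable union of predictable rectangles.
  have key : {p : ℝ≥0 × Ω | ∫⁻ e in {e | e.1 < p.1}, f ((e.1, p.2), e.2) ∂μ ≤ x} =
      (⋃ q ∈ D, Ioi q ×ˢ {ω | x < ∫⁻ e in {e | e.1 < q}, f ((e.1, ω), e.2) ∂μ})ᶜ := by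
    ext ⟨s, ω⟩
    simp only [mem_ofPred_eq, mem_compl_iff, ← not_lt, not_iff_not, mem_iUnion, mem_prod, mem_Ioi,
      exists_prop]
    have hν : ∀ q, ∫⁻ e in {e | e.1 < q}, f ((e.1, ω), e.2) ∂μ =
        (μ.withDensity fun e => f ((e.1, ω), e.2)) {e | e.1 < q} := fun q =>
      (withDensity_apply _ (hS q)).symm
    simp_rw [hν]
    have hU : {e : ℝ≥0 × ℝ × ℝ | e.1 < s} = ⋃ q ∈ D ∩ Iio s, {e | e.1 < q} := by
      ext e
      simp only [mem_ofPred_eq, mem_iUnion, mem_inter_iff, mem_Iio, exists_prop]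
      constructor
      · intro he
        obtain ⟨q, hq, h1, h2⟩ := hDd _ _ he
        exact ⟨q, ⟨hq, h2⟩, h1⟩
      · rintro ⟨q, ⟨_, h1⟩, h2⟩
        exact h2.trans h1
    rw [hU, measure_past_eq_iSup _ hD inter_subset_left]
    simp only [lt_iSup_iff, mem_inter_iff, mem_Iio, exists_prop, and_assoc]
  have h1 : MeasurableSet[ℱ.predictable]
      {p : ℝ≥0 × Ω | ∫⁻ e in {e | e.1 < p.1}, f ((e.1, p.2), e.2) ∂μ ≤ x} := by
    rw [key]
    refine MeasurableSet.compl (MeasurableSet.biUnion hD fun q _ => ?_)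
    exact measurableSet_predictable_Ioi_prod
      (measurableSet_lt (mδ := ℱ q) (@measurable_const _ _ _ (ℱ q) _)
        (measurable_lintegral_past hf q))
  exact (@measurable_fst _ _ ℱ.predictable _) h1

/-- The times whose strict past has mass at most `x` form an initial segment. Continuity from below
bounds the mass of the times lying under some point of the segment; only its largest time, if there
is one, escapes, and a single time is null. -/
lemma lintegral_accumulated_le (hμ : ∀ t, μ {e | e.1 = t} = 0) (f : ℝ≥0 × ℝ × ℝ → ℝ≥0∞)
    (x : ℝ≥0∞) :
    ∫⁻ e, {e | ∫⁻ e' in {e' | e'.1 < e.1}, f e' ∂μ ≤ x}.indicator f e ∂μ ≤ x := by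
  obtain ⟨D, hD, hDd⟩ := exists_countable_past
  have hS : ∀ s, MeasurableSet {e : ℝ≥0 × ℝ × ℝ | e.1 < s} := fun s =>
    measurableSet_lt measurable_fst measurable_const
  set ν := μ.withDensity f with hν
  have hν' : ∀ q, ∫⁻ e in {e | e.1 < q}, f e ∂μ = ν {e | e.1 < q} := fun q =>
    (withDensity_apply _ (hS q)).symm
  set I : Set ℝ≥0 := {s | ν {e | e.1 < s} ≤ x} with hI
  have hlow : ∀ s t, s ≤ t → t ∈ I → s ∈ I := fun s t hst ht => by
    have : {e : ℝ≥0 × ℝ × ℝ | e.1 < s} ⊆ {e | e.1 < t} := fun e he => lt_of_lt_of_le he hst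
    exact (measure_mono this).trans ht
  set U := ⋃ q ∈ D ∩ I, {e : ℝ≥0 × ℝ × ℝ | e.1 < q} with hU
  have hUm : MeasurableSet U := MeasurableSet.biUnion (hD.mono inter_subset_left) fun q _ => hS q
  have hUx : ν U ≤ x := by
    rw [hU, measure_past_eq_iSup _ hD inter_subset_left]
    exact iSup₂_le fun q hq => hq.2
  have hJ : ∃ t : ℝ≥0, ∀ e : ℝ≥0 × ℝ × ℝ, e.1 ∈ I → e ∉ U → e.1 = t := by
    by_cases hne : ∃ s ∈ I, ∀ q ∈ D ∩ I, q ≤ s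
    · obtain ⟨s, hs, hsq⟩ := hne
      refine ⟨s, fun e he heU => ?_⟩
      simp only [hU, mem_iUnion, mem_ofPred_eq, not_exists, not_lt] at heU
      by_contra hcon
      rcases lt_or_gt_of_ne hcon with h | h
      · obtain ⟨q, hq, h1, h2⟩ := hDd _ _ h
        exact absurd (heU q ⟨hq, hlow _ _ h2.le hs⟩) (not_le.2 h1)
      · obtain ⟨q, hq, h1, h2⟩ := hDd _ _ h
        exact absurd (hsq q ⟨hq, hlow _ _ h2.le he⟩) (not_le.2 h1)
    · refine ⟨0, fun e he heU => ?_⟩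
      exfalso
      refine hne ⟨e.1, he, fun q hq => ?_⟩
      simp only [hU, mem_iUnion, mem_ofPred_eq, not_exists, not_lt] at heU
      exact heU q hq
  obtain ⟨t, ht⟩ := hJ
  have hle : ∀ᵐ e ∂μ, {e | ∫⁻ e' in {e' | e'.1 < e.1}, f e' ∂μ ≤ x}.indicator f e ≤
      U.indicator f e := by
    have h0 : ∀ᵐ e ∂μ, e.1 ≠ t := by rw [ae_iff]; simpa using hμ t
    filter_upwards [h0] with e he
    by_cases h1 : e.1 ∈ I
    · by_cases h2 : e ∈ U
      · rw [indicator_of_mem h2]; exact indicator_le_self _ _ _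
      · exact absurd (ht e h1 h2) he
    · rw [indicator_of_notMem]
      · exact zero_le
      · simp only [mem_ofPred_eq, hν']; exact h1
  calc _ ≤ ∫⁻ e, U.indicator f e ∂μ := lintegral_mono_ae hle
    _ = ν U := by rw [lintegral_indicator hUm, hν, withDensity_apply _ hUm]
    _ ≤ x := hUx

variable [IsProbabilityMeasure P] [SigmaFinite μ]

/-- A Lenglart type inequality. -/
lemma IsPoissonRandomMeasure.measure_compInt_ge_le (h : IsPoissonRandomMeasure P ℱ μ N)
    (hμ : ∀ t, μ {e | e.1 = t} = 0) (hG : IsPredictableIntegrand ℱ G)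
    (hi : ∀ᵐ ω ∂P, Integrable (fun e => G ((e.1, ω), e.2)) μ ∧
      Integrable (fun e => G ((e.1, ω), e.2)) (N ω)) {δ : ℝ} (hδ : 0 < δ) (η : ℝ≥0∞) :
    P {ω | δ ≤ |compInt μ N G ω|} ≤
      P {ω | η ≤ ∫⁻ e, ENNReal.ofReal (G ((e.1, ω), e.2) ^ 2) ∂μ} +
        η / ENNReal.ofReal (δ ^ 2) := by
  have hf : Measurable[predictableProd ℱ] fun p => ENNReal.ofReal (G p ^ 2) :=
    ENNReal.measurable_ofReal.comp ((measurable_id.pow_const 2).comp hG)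
  -- Stopping the integrand when its accumulated square reaches `η` is predictable and leaves a
  -- total of at most `η` for every `ω`, so the second moment bound and Chebyshev apply. Off the
  -- event in the first term nothing has been removed.
  set L : Set ((ℝ≥0 × Ω) × (ℝ × ℝ)) := {p | ∫⁻ e in {e | e.1 < p.1.1},
    ENNReal.ofReal (G ((e.1, p.1.2), e.2) ^ 2) ∂μ ≤ η} with hL
  have hLm : MeasurableSet[predictableProd ℱ] L := measurableSet_accumulated_le hf η
  have hG' : IsPredictableIntegrand ℱ (L.indicator G) :=
    Measurable.indicator (m := predictableProd ℱ) hG hLm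
  have hind : ∀ ω, (fun e : ℝ≥0 × ℝ × ℝ => L.indicator G ((e.1, ω), e.2)) =
      (slice L ω).indicator fun e => G ((e.1, ω), e.2) := fun ω => rfl
  have hsl : ∀ ω, MeasurableSet (slice L ω) := fun ω =>
    measurableSet_slice (predictable_prod_le ℱ _ hLm) ω
  have hi' : ∀ᵐ ω ∂P, Integrable (fun e => L.indicator G ((e.1, ω), e.2)) μ ∧
      Integrable (fun e => L.indicator G ((e.1, ω), e.2)) (N ω) := by
    filter_upwards [hi] with ω hω
    rw [hind]
    exact ⟨hω.1.indicator (hsl ω), hω.2.indicator (hsl ω)⟩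
  have h1 := h.lintegral_compInt_sq_le (hμ 0) hG' hi'
  have h2 : ∀ ω, ∫⁻ e, ENNReal.ofReal (L.indicator G ((e.1, ω), e.2) ^ 2) ∂μ ≤ η := by
    intro ω
    refine le_trans (le_of_eq (lintegral_congr fun e => ?_)) (lintegral_accumulated_le hμ
      (fun e => ENNReal.ofReal (G ((e.1, ω), e.2) ^ 2)) η)
    by_cases he : ((e.1, ω), e.2) ∈ L
    · rw [indicator_of_mem he, indicator_of_mem]; exact he
    · rw [indicator_of_notMem he, indicator_of_notMem]
      · simp
      · exact he
  have h3 : P {ω | δ ≤ |compInt μ N (L.indicator G) ω|} ≤ η / ENNReal.ofReal (δ ^ 2) := by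
    have h4 : ∫⁻ ω, ENNReal.ofReal (compInt μ N (L.indicator G) ω ^ 2) ∂P ≤ η := by
      refine (h1.trans (lintegral_mono h2)).trans ?_
      simp
    refine le_trans ?_ (ENNReal.div_le_div_right h4 _)
    refine le_trans (measure_mono fun ω hω => ?_) (meas_ge_le_lintegral_div
      ((h.aestronglyMeasurable_compInt hG'.measurable).aemeasurable.pow_const
        2).ennreal_ofReal (by simpa using hδ.ne') ENNReal.ofReal_ne_top)
    refine ENNReal.ofReal_le_ofReal ?_
    rw [← sq_abs (compInt μ N (L.indicator G) ω)]
    exact pow_le_pow_left₀ hδ.le hω 2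
  refine le_trans (measure_mono fun ω hω => ?_) ((measure_union_le _ _).trans
    (add_le_add le_rfl h3))
  by_cases hc : η ≤ ∫⁻ e, ENNReal.ofReal (G ((e.1, ω), e.2) ^ 2) ∂μ
  · exact Or.inl hc
  · refine Or.inr ?_
    have : slice L ω = univ := by
      refine eq_univ_of_forall fun e => ?_
      exact (setLIntegral_le_lintegral _ _).trans (not_le.1 hc).le
    have e : compInt μ N (L.indicator G) ω = compInt μ N G ω := by
      unfold compInt
      rw [hind, this, indicator_univ]
    simp only [mem_ofPred_eq, e]
    exact hω

/-- The compensated integral is continuous in probability. -/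
theorem IsPoissonRandomMeasure.tendstoInMeasure_compInt (h : IsPoissonRandomMeasure P ℱ μ N)
    (hμ : ∀ t, μ {e | e.1 = t} = 0) {G : ℕ → (ℝ≥0 × Ω) × (ℝ × ℝ) → ℝ}
    (hG : ∀ n, IsPredictableIntegrand ℱ (G n))
    (hi : ∀ n, ∀ᵐ ω ∂P, Integrable (fun e => G n ((e.1, ω), e.2)) μ ∧
      Integrable (fun e => G n ((e.1, ω), e.2)) (N ω))
    (ht : ∀ ε : ℝ≥0∞, 0 < ε → Tendsto (fun n => P {ω | ε ≤
      ∫⁻ e, ENNReal.ofReal (G n ((e.1, ω), e.2) ^ 2) ∂μ}) atTop (𝓝 0)) :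
    TendstoInMeasure P (fun n => compInt μ N (G n)) atTop fun _ => 0 := by
  rw [tendstoInMeasure_iff_norm]
  intro δ hδ
  simp only [sub_zero, Real.norm_eq_abs]
  rw [ENNReal.tendsto_nhds_zero]
  intro κ hκ
  have hδ2 : ENNReal.ofReal (δ ^ 2) ≠ 0 := by simpa using hδ.ne'
  set η := κ / 2 * ENNReal.ofReal (δ ^ 2) with hη
  have hη0 : 0 < η := ENNReal.mul_pos (ENNReal.half_pos hκ.ne').ne' hδ2
  have h1 := (ENNReal.tendsto_nhds_zero.1 (ht η hη0)) (κ / 2) (ENNReal.half_pos hκ.ne')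
  filter_upwards [h1] with n hn
  refine (h.measure_compInt_ge_le hμ (hG n) (hi n) hδ η).trans ?_
  have h2 : η / ENNReal.ofReal (δ ^ 2) ≤ κ / 2 := ENNReal.div_le_of_le_mul le_rfl
  exact (add_le_add hn h2).trans (ENNReal.add_halves κ).le

/-- Every approximating sequence computes the compensated integral. -/
theorem IsCompensatedIntegral.tendstoInMeasure (h : IsPoissonRandomMeasure P ℱ μ N)
    (hμ : ∀ t, μ {e | e.1 = t} = 0) {H : (ℝ≥0 × Ω) × (ℝ × ℝ) → ℝ} {Y : Ω → ℝ}
    (hY : IsCompensatedIntegral P ℱ μ N H Y) {G : ℕ → (ℝ≥0 × Ω) × (ℝ × ℝ) → ℝ}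
    (hG : ∀ n, IsPredictableIntegrand ℱ (G n))
    (hi : ∀ n, ∀ᵐ ω ∂P, Integrable (fun e => G n ((e.1, ω), e.2)) μ ∧
      Integrable (fun e => G n ((e.1, ω), e.2)) (N ω))
    (ht : ∀ ε : ℝ≥0∞, 0 < ε → Tendsto (fun n => P {ω | ε ≤
      ∫⁻ e, ENNReal.ofReal ((G n ((e.1, ω), e.2) - H ((e.1, ω), e.2)) ^ 2) ∂μ}) atTop (𝓝 0)) :
    TendstoInMeasure P (fun n => compInt μ N (G n)) atTop Y := by
  obtain ⟨Hn, hHp, hHi, hHt, hHY⟩ := hY.exists_approx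
  have hd : TendstoInMeasure P (fun n => compInt μ N (G n - Hn n)) atTop fun _ => 0 := by
    refine h.tendstoInMeasure_compInt hμ (fun n => ?_) (fun n => ?_) fun ε hε => ?_
    · exact Measurable.sub (hG n) (hHp n)
    · filter_upwards [hi n, hHi n] with ω h1 h2
      exact ⟨h1.1.sub h2.1, h1.2.sub h2.2⟩
    -- The quarter comes from `(x - y)² ≤ 2 x² + 2 y²` applied with `H` subtracted from both
    -- sequences.
    · have hε4 : 0 < ε / 4 := ENNReal.div_pos hε.ne' (by simp)
      have h1 := (ht _ hε4).add (hHt _ hε4)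
      rw [add_zero] at h1
      refine tendsto_of_tendsto_of_tendsto_of_le_of_le tendsto_const_nhds h1 (fun _ => zero_le)
        fun n => (measure_mono fun ω hω => ?_).trans (measure_union_le _ _)
      by_contra hcon
      simp only [mem_union, mem_ofPred_eq, not_or, not_le] at hcon
      refine absurd (show ε ≤ _ from hω) (not_le.2 ?_)
      have m1 : Measurable fun e : ℝ≥0 × ℝ × ℝ =>
          ENNReal.ofReal ((G n ((e.1, ω), e.2) - H ((e.1, ω), e.2)) ^ 2) :=
        ((((hG n).measurable.sub hY.predictable.measurable).comp
          (measurable_place_right ω)).pow_const 2).ennreal_ofReal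
      calc ∫⁻ e, ENNReal.ofReal ((G n - Hn n) ((e.1, ω), e.2) ^ 2) ∂μ
          ≤ ∫⁻ e, (2 * ENNReal.ofReal ((G n ((e.1, ω), e.2) - H ((e.1, ω), e.2)) ^ 2) +
              2 * ENNReal.ofReal ((Hn n ((e.1, ω), e.2) - H ((e.1, ω), e.2)) ^ 2)) ∂μ := by
            refine lintegral_mono fun e => ?_
            rw [show (2 : ℝ≥0∞) = ENNReal.ofReal 2 by simp, ← ENNReal.ofReal_mul zero_le_two,
              ← ENNReal.ofReal_mul zero_le_two, ← ENNReal.ofReal_add (by positivity)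
              (by positivity)]
            refine ENNReal.ofReal_le_ofReal ?_
            simp only [Pi.sub_apply]
            nlinarith [sq_nonneg (G n ((e.1, ω), e.2) - H ((e.1, ω), e.2) +
              (Hn n ((e.1, ω), e.2) - H ((e.1, ω), e.2)))]
        _ = 2 * ∫⁻ e, ENNReal.ofReal ((G n ((e.1, ω), e.2) - H ((e.1, ω), e.2)) ^ 2) ∂μ +
            2 * ∫⁻ e, ENNReal.ofReal ((Hn n ((e.1, ω), e.2) - H ((e.1, ω), e.2)) ^ 2) ∂μ := by
            rw [lintegral_add_left (m1.const_mul 2), lintegral_const_mul' _ _ (by simp),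
              lintegral_const_mul' _ _ (by simp)]
        _ < 2 * (ε / 4) + 2 * (ε / 4) := by
            refine ENNReal.add_lt_add ?_ ?_
            · exact (ENNReal.mul_lt_mul_iff_right (by simp) (by simp)).2 hcon.1
            · exact (ENNReal.mul_lt_mul_iff_right (by simp) (by simp)).2 hcon.2
        _ = ε := by
            rw [← two_mul, ← mul_assoc, show (2 : ℝ≥0∞) * 2 = 4 by norm_num,
              ENNReal.mul_div_cancel (by simp) (by simp)]
  have hs := tendstoInMeasure_add hd hHY
  refine (hs.congr (fun n => ?_) (Eventually.of_forall fun ω => zero_add _))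
  filter_upwards [hi n, hHi n] with ω h1 h2
  have e1 := integral_sub h1.1 h2.1
  have e2 := integral_sub h1.2 h2.2
  simp only [compInt, Pi.sub_apply]
  rw [e1, e2]; ring

end Stability

/-! ### Predictability of continuous adapted processes -/

section Predictable

variable {Ω : Type u} [mΩ : MeasurableSpace Ω] {ℱ : Filtration ℝ≥0 mΩ} {X : ℝ≥0 → Ω → ℝ}

/-- The left end point of the interval of the grid of mesh `1 / (n + 1)` containing `s`. -/
def gridLeft (n : ℕ) (s : ℝ≥0) : ℝ≥0 := ((⌈s * (n + 1)⌉₊ - 1 : ℕ) : ℝ≥0) / (n + 1)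

lemma tendsto_gridLeft (s : ℝ≥0) : Tendsto (fun n => gridLeft n s) atTop (𝓝 s) := by
  rw [← NNReal.tendsto_coe]
  have h1 : Tendsto (fun n : ℕ => (s : ℝ) - 1 / ((n : ℝ) + 1)) atTop (𝓝 s) := by
    simpa using tendsto_const_nhds.sub (tendsto_one_div_add_atTop_nhds_zero_nat (𝕜 := ℝ))
  refine tendsto_of_tendsto_of_tendsto_of_le_of_le h1 tendsto_const_nhds (fun n => ?_) fun n => ?_
  · have hn : (0 : ℝ) < n + 1 := by positivity
    simp only [gridLeft, NNReal.coe_div, NNReal.coe_add, NNReal.coe_natCast, NNReal.coe_one]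
    rw [← sub_nonneg, sub_sub_eq_add_sub, ← add_div, sub_nonneg, le_div_iff₀ hn]
    have h2 : (s * (n + 1) : ℝ≥0) ≤ ⌈s * ((n : ℝ≥0) + 1)⌉₊ := Nat.le_ceil _
    have h3 : (⌈s * ((n : ℝ≥0) + 1)⌉₊ : ℝ) ≤ ((⌈s * ((n : ℝ≥0) + 1)⌉₊ - 1 : ℕ) : ℝ) + 1 := by
      norm_cast; omega
    exact le_trans (by exact_mod_cast h2) h3
  · have hn : (0 : ℝ) < n + 1 := by positivity
    simp only [gridLeft, NNReal.coe_div, NNReal.coe_add, NNReal.coe_natCast, NNReal.coe_one]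
    rw [div_le_iff₀ hn]
    by_cases h0 : ⌈s * ((n : ℝ≥0) + 1)⌉₊ = 0
    · rw [h0]; simp; positivity
    · have h2 : ((⌈s * ((n : ℝ≥0) + 1)⌉₊ - 1 : ℕ) : ℝ≥0) < s * (n + 1) :=
        Nat.lt_ceil.1 (Nat.sub_lt (Nat.pos_of_ne_zero h0) one_pos)
      exact_mod_cast h2.le

/-- On each left-open grid interval the process is frozen at the left end point, so preimages are
countable unions of predictable rectangles. At time `0` the truncated subtraction `0 - 1 = 0` gives
grid point `0`, hence the separate piece over `{⊥}`. -/
lemma measurable_comp_gridLeft (hX : StronglyAdapted ℱ X) (n : ℕ) :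
    Measurable[ℱ.predictable] fun p : ℝ≥0 × Ω => X (gridLeft n p.1) p.2 := by
  intro B hB
  have hn : (0 : ℝ≥0) < n + 1 := by positivity
  have hXB : ∀ s, MeasurableSet[ℱ s] (X s ⁻¹' B) := fun s => (hX s).measurable hB
  have e : (fun p : ℝ≥0 × Ω => X (gridLeft n p.1) p.2) ⁻¹' B =
      ({⊥} ×ˢ (X ⊥ ⁻¹' B)) ∪ ⋃ k : ℕ, Ioc ((k : ℝ≥0) / (n + 1)) ((k + 1 : ℕ) / (n + 1)) ×ˢ
        (X ((k : ℝ≥0) / (n + 1)) ⁻¹' B) := by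
    ext ⟨s, ω⟩
    simp only [mem_preimage, mem_union, mem_prod, mem_singleton_iff, mem_iUnion]
    have hiff : ∀ k : ℕ, s ∈ Ioc ((k : ℝ≥0) / (n + 1)) ((k + 1 : ℕ) / (n + 1)) ↔
        ⌈s * ((n : ℝ≥0) + 1)⌉₊ = k + 1 := by
      intro k
      rw [Nat.ceil_eq_iff (Nat.succ_ne_zero k), mem_Ioc, div_lt_iff₀ hn, le_div_iff₀ hn]
      simp
    constructor
    · intro h
      by_cases hs : s = ⊥
      · left
        refine ⟨hs, ?_⟩
        subst hs
        simpa [gridLeft] using h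
      · right
        have hpos : 0 < ⌈s * ((n : ℝ≥0) + 1)⌉₊ :=
          Nat.ceil_pos.2 (mul_pos (pos_iff_ne_zero.2 hs) hn)
        exact ⟨⌈s * ((n : ℝ≥0) + 1)⌉₊ - 1, (hiff _).2 (by omega), h⟩
    · rintro (⟨hs, h⟩ | ⟨k, hk, h⟩)
      · subst hs; simpa [gridLeft] using h
      · rw [gridLeft, (hiff k).1 hk]; simpa using h
  rw [e]
  exact MeasurableSet.union (measurableSet_predictable_singleton_bot_prod (hXB _))
    (MeasurableSet.iUnion fun k => measurableSet_predictable_Ioc_prod _ _ (hXB _))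

/-- Continuous adapted processes are predictable. -/
lemma measurable_predictable_of_continuous (hX : StronglyAdapted ℱ X)
    (hXc : ∀ ω, Continuous fun t => X t ω) :
    Measurable[ℱ.predictable] fun p : ℝ≥0 × Ω => X p.1 p.2 :=
  @measurable_of_tendsto_metrizable _ _ ℱ.predictable _ _ _ _ _ _
    (fun n => measurable_comp_gridLeft hX n)
    (tendsto_pi_nhds.2 fun p => ((hXc p.2).tendsto p.1).comp (tendsto_gridLeft p.1))

lemma measurable_uncurry_of_continuous_adapted (hX : StronglyAdapted ℱ X)
    (hXc : ∀ ω, Continuous fun t => X t ω) : Measurable fun p : ℝ≥0 × Ω => X p.1 p.2 :=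
  (measurable_predictable_of_continuous hX hXc).mono (predictable_le ℱ) le_rfl

lemma measurable_predictable_time (ℱ : Filtration ℝ≥0 mΩ) :
    Measurable[ℱ.predictable] fun p : ℝ≥0 × Ω => (p.1 : ℝ) :=
  measurable_predictable_of_continuous (X := fun s _ => (s : ℝ))
    (fun s => @stronglyMeasurable_const _ _ (ℱ s) _ _) fun _ => NNReal.continuous_coe

lemma isPredictableIntegrand_volterraIntegrand (hX : StronglyAdapted ℱ X)
    (hXc : ∀ ω, Continuous fun t => X t ω) {k : ℝ → ℝ → ℝ}
    (hk : Measurable fun p : ℝ × ℝ => k p.1 p.2) (t : ℝ≥0) :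
    IsPredictableIntegrand ℱ (volterraIntegrand X k t) := by
  have hf : Measurable[predictableProd ℱ, ℱ.predictable]
      (Prod.fst : (ℝ≥0 × Ω) × (ℝ × ℝ) → ℝ≥0 × Ω) := @measurable_fst _ _ ℱ.predictable _
  have hs : Measurable[predictableProd ℱ] (Prod.snd : (ℝ≥0 × Ω) × (ℝ × ℝ) → ℝ × ℝ) :=
    @measurable_snd _ _ ℱ.predictable _
  have h1 : Measurable[predictableProd ℱ] fun p : (ℝ≥0 × Ω) × (ℝ × ℝ) => (p.1.1 : ℝ) :=
    (measurable_predictable_time ℱ).comp hf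
  have h2 : Measurable[predictableProd ℱ] fun p : (ℝ≥0 × Ω) × (ℝ × ℝ) => X p.1.1 p.1.2 :=
    (measurable_predictable_of_continuous hX hXc).comp hf
  have hy : Measurable[predictableProd ℱ] fun p : (ℝ≥0 × Ω) × (ℝ × ℝ) => p.2.1 :=
    measurable_fst.comp hs
  have hz : Measurable[predictableProd ℱ] fun p : (ℝ≥0 × Ω) × (ℝ × ℝ) => p.2.2 :=
    measurable_snd.comp hs
  have hc : Measurable[predictableProd ℱ] fun _ : (ℝ≥0 × Ω) × (ℝ × ℝ) => (t : ℝ) :=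
    @measurable_const _ _ _ (predictableProd ℱ) _
  have h0 : Measurable[predictableProd ℱ] fun _ : (ℝ≥0 × Ω) × (ℝ × ℝ) => (0 : ℝ) :=
    @measurable_const _ _ _ (predictableProd ℱ) _
  refine Measurable.indicator (m := predictableProd ℱ) ?_ ?_
  · exact hk.comp (@Measurable.prodMk _ (predictableProd ℱ) _ _ _ _ _ _
      (h1.const_sub (t : ℝ)) hy)
  · have e : {p : (ℝ≥0 × Ω) × (ℝ × ℝ) | p.1.1 ≤ t ∧ 0 < p.2.2 ∧ p.2.2 ≤ X p.1.1 p.1.2} =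
        {p | (p.1.1 : ℝ) ≤ t} ∩ ({p | 0 < p.2.2} ∩ {p | p.2.2 ≤ X p.1.1 p.1.2}) := by
      ext p; simp
    rw [e]
    exact @MeasurableSet.inter _ (predictableProd ℱ) _ _
      (measurableSet_le (mδ := predictableProd ℱ) h1 hc)
      (@MeasurableSet.inter _ (predictableProd ℱ) _ _
        (measurableSet_lt (mδ := predictableProd ℱ) h0 hz)
        (measurableSet_le (mδ := predictableProd ℱ) hz h2))

lemma measurableSet_predictable_mark {D : Set (ℝ × ℝ)} (hD : MeasurableSet D) :
    MeasurableSet[predictableProd ℱ] {p : (ℝ≥0 × Ω) × (ℝ × ℝ) | p.2 ∈ D} :=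
  (@measurable_snd _ _ ℱ.predictable _) hD

lemma IsPredictableIntegrand.indicator {H : (ℝ≥0 × Ω) × (ℝ × ℝ) → ℝ}
    (hH : IsPredictableIntegrand ℱ H) {L : Set ((ℝ≥0 × Ω) × (ℝ × ℝ))}
    (hL : MeasurableSet[predictableProd ℱ] L) : IsPredictableIntegrand ℱ (L.indicator H) :=
  Measurable.indicator (m := predictableProd ℱ) hH hL

end Predictable

/-! ### The intensity -/

instance (α c : ℝ) : SigmaFinite (intensity α c) :=
  inferInstanceAs (SigmaFinite (timeMeasure.prod ((levyMeasure α c).prod (volume.restrict (Ioi 0)))))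

lemma intensity_singleton (α c : ℝ) (t : ℝ≥0) : intensity α c {e | e.1 = t} = 0 := by
  have : {e : ℝ≥0 × ℝ × ℝ | e.1 = t} = {t} ×ˢ univ := by ext e; simp
  rw [this, intensity, Measure.prod_prod, timeMeasure_singleton, zero_mul]

lemma ae_intensity_pos (α c : ℝ) : ∀ᵐ e ∂(intensity α c), 0 < e.2.1 := by
  have h1 : MeasurableSet {e : ℝ≥0 × ℝ × ℝ | 0 < e.2.1} :=
    measurableSet_lt measurable_const (by fun_prop)
  rw [intensity, Measure.ae_prod_iff_ae_ae h1]
  refine Eventually.of_forall fun s => ?_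
  have h2 : MeasurableSet {e : ℝ × ℝ | 0 < e.1} := measurableSet_lt measurable_const (by fun_prop)
  rw [Measure.ae_prod_iff_ae_ae h2]
  filter_upwards [ae_levyMeasure_pos (α := α) (c := c)] with y hy
  exact Eventually.of_forall fun _ => hy

/-! ### The variance of the fractional kernel under the Levy measure -/

variable {α c : ℝ}

/-- The increment `∫_{(r-y)^+}^r x^(α-1) / (c Γ(α)) dx`. -/
def kernIncr (α c r y : ℝ) : ℝ := kernInt α c r - kernInt α c (max (r - y) 0)

lemma measurable_kernIncr (hα0 : 0 < α) : Measurable fun p : ℝ × ℝ => kernIncr α c p.1 p.2 := by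
  have h := kernInt_continuous (c := c) hα0
  have : Continuous fun p : ℝ × ℝ => kernIncr α c p.1 p.2 := by
    unfold kernIncr
    exact (h.comp continuous_fst).sub
      (h.comp ((continuous_fst.sub continuous_snd).max continuous_const))
  exact this.measurable

lemma kernIncr_nonneg (hα0 : 0 < α) (hc : 0 < c) {r y : ℝ} (hr : 0 ≤ r) (hy : 0 ≤ y) :
    0 ≤ kernIncr α c r y :=
  sub_nonneg.2 (kernInt_mono hα0 hc (le_max_right _ _) (max_le (by linarith) hr))

lemma kernIncr_le_kernInt (hα0 : 0 < α) (hc : 0 < c) (r y : ℝ) :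
    kernIncr α c r y ≤ kernInt α c r := by
  have := kernInt_mono (α := α) (c := c) hα0 hc le_rfl (le_max_right (r - y) 0)
  rw [kernInt_zero] at this
  unfold kernIncr; linarith

/-- For `y < r` the estimate is `1 - y / r ≤ (1 - y / r) ^ α`, valid because the base is in `(0, 1)`
and `α < 1`. -/
lemma kernIncr_le (hα0 : 0 < α) (hα1 : α < 1) (hc : 0 < c) {r y : ℝ} (hr : 0 < r) (hy : 0 < y) :
    kernIncr α c r y ≤ r ^ (α - 1) * min y r / (c * Real.Gamma (α + 1)) := by
  have hΓ := Real.Gamma_pos_of_pos (show 0 < α + 1 by linarith)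
  rw [kernIncr, kernInt_eq hα0 hc hr.le, kernInt_eq hα0 hc (le_max_right _ _), ← sub_div]
  refine div_le_div_of_nonneg_right ?_ (by positivity)
  rcases le_or_gt r y with h | h
  · rw [max_eq_right (by linarith), min_eq_right h, Real.zero_rpow hα0.ne',
      Real.rpow_sub_one hr.ne']
    field_simp
    simp
  · rw [max_eq_left (by linarith), min_eq_left h.le]
    have h1 : (r - y) ^ α = r ^ α * (1 - y / r) ^ α := by
      rw [← Real.mul_rpow hr.le (by rw [sub_nonneg, div_le_one hr]; exact h.le)]
      congr 1; field_simp
    have h0 : 0 < 1 - y / r := by rw [sub_pos, div_lt_one hr]; exact h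
    have h2 : 1 - y / r ≤ (1 - y / r) ^ α := by
      conv_lhs => rw [← Real.rpow_one (1 - y / r)]
      exact Real.rpow_le_rpow_of_exponent_ge h0 (by have := div_pos hy hr; linarith) hα1.le
    rw [h1, Real.rpow_sub_one hr.ne']
    have h3 : 0 < r ^ α := Real.rpow_pos_of_pos hr α
    have h4 := mul_le_mul_of_nonneg_left h2 h3.le
    have h5 : r ^ α / r * y = r ^ α * (y / r) := by field_simp
    rw [h5]; linarith

/-- The variance of the fractional kernel up to time `u` over jump sizes in `Z`. -/
def kernVar (α c : ℝ) (Z : Set ℝ) (u : ℝ) : ℝ≥0∞ :=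
  ∫⁻ r in Icc 0 u, ∫⁻ y in Z, ENNReal.ofReal (kernIncr α c r y ^ 2) ∂(levyMeasure α c)

lemma kernVar_mono {Z Z' : Set ℝ} {u u' : ℝ} (hZ : Z ⊆ Z') (hu : u ≤ u') :
    kernVar α c Z u ≤ kernVar α c Z' u' :=
  (lintegral_mono fun _ => lintegral_mono_set hZ).trans
    (lintegral_mono_set (Icc_subset_Icc_right hu))

/-- Squaring `kernIncr_le` and integrating with `levy_min_sq` leaves `r ^ (2 * (α - 1)) * r ^ (1 -
α) = r ^ (α - 1)`, which is integrable at `0`: the stochastic integrals have finite variance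
although the kernel is singular. -/
lemma lintegral_kernIncr_sq_le (hα0 : 0 < α) (hα1 : α < 1) (hc : 0 < c) {r : ℝ} (hr : 0 < r) :
    ∫⁻ y, ENNReal.ofReal (kernIncr α c r y ^ 2) ∂(levyMeasure α c) ≤
      ENNReal.ofReal (levyConst α c / (c * Real.Gamma (α + 1)) ^ 2 * r ^ (α - 1)) := by
  have hΓ := Real.Gamma_pos_of_pos (show 0 < α + 1 by linarith)
  obtain ⟨hi, he⟩ := levy_min_sq hα0 hα1 hc hr
  have h1 := (hi.const_mul ((r ^ (α - 1) / (c * Real.Gamma (α + 1))) ^ 2))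
  have h2 : levyConst α c / (c * Real.Gamma (α + 1)) ^ 2 * r ^ (α - 1) =
      ∫ y, (r ^ (α - 1) / (c * Real.Gamma (α + 1))) ^ 2 * (min y r) ^ 2 ∂(levyMeasure α c) := by
    rw [integral_const_mul, he, div_pow]
    have : r ^ (α - 1) = (r ^ (α - 1)) ^ 2 * r ^ (1 - α) := by
      rw [← Real.rpow_natCast, ← Real.rpow_mul hr.le, ← Real.rpow_add hr]
      congr 1; push_cast; ring
    conv_lhs => rw [this]
    ring
  rw [h2, ofReal_integral_eq_lintegral_ofReal h1 (Eventually.of_forall fun y => by positivity)]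
  refine lintegral_mono_ae ?_
  filter_upwards [ae_levyMeasure_pos] with y hy
  refine ENNReal.ofReal_le_ofReal ?_
  rw [← mul_pow]
  refine pow_le_pow_left₀ (kernIncr_nonneg hα0 hc hr.le hy.le) ?_ 2
  have := kernIncr_le hα0 hα1 hc hr hy
  rwa [mul_div_right_comm] at this

lemma measurable_lintegral_kernIncr_sq (hα0 : 0 < α) (Z : Set ℝ) :
    Measurable fun r => ∫⁻ y in Z, ENNReal.ofReal (kernIncr α c r y ^ 2) ∂(levyMeasure α c) :=
  Measurable.lintegral_prod_right' (f := fun p : ℝ × ℝ => ENNReal.ofReal (kernIncr α c p.1 p.2 ^ 2))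
    ((measurable_kernIncr hα0).pow_const 2).ennreal_ofReal

lemma kernVar_univ_lt_top (hα0 : 0 < α) (hα1 : α < 1) (hc : 0 < c) (u : ℝ) :
    kernVar α c univ u < ∞ := by
  rcases le_or_gt u 0 with hu | hu
  · have : kernVar α c univ u = 0 := by
      refine setLIntegral_measure_zero _ _ ?_
      simp [hu]
    rw [this]; exact ENNReal.zero_lt_top
  have h1 : IntegrableOn (fun r : ℝ => levyConst α c / (c * Real.Gamma (α + 1)) ^ 2 * r ^ (α - 1))
      (Ioc 0 u) :=
    (intervalIntegrable_iff_integrableOn_Ioc_of_le hu.le).1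
      ((intervalIntegral.intervalIntegrable_rpow' (by linarith)).const_mul _)
  have h2 : ∫⁻ r in Ioc 0 u, ENNReal.ofReal
      (levyConst α c / (c * Real.Gamma (α + 1)) ^ 2 * r ^ (α - 1)) < ∞ := by
    refine lt_of_le_of_lt (lintegral_mono fun r => ?_) h1.2
    exact Real.ofReal_le_enorm _
  rw [kernVar, setLIntegral_congr Ioc_ae_eq_Icc.symm]
  refine lt_of_le_of_lt (setLIntegral_mono' measurableSet_Ioc fun r hr => ?_) h2
  rw [Measure.restrict_univ]
  exact lintegral_kernIncr_sq_le hα0 hα1 hc hr.1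

/-- Dominated convergence, first in the jump size and then in time: every `y > 0` eventually exceeds
`1 / (n + 1)`. -/
lemma tendsto_kernVar (hα0 : 0 < α) (hα1 : α < 1) (hc : 0 < c) (u : ℝ) :
    Tendsto (fun n : ℕ => kernVar α c (Iic (1 / ((n : ℝ) + 1))) u) atTop (𝓝 0) := by
  have hfin := kernVar_univ_lt_top hα0 hα1 hc u
  have hm := fun Z => measurable_lintegral_kernIncr_sq (α := α) (c := c) hα0 Z
  have hae : ∀ᵐ r ∂(volume.restrict (Icc 0 u)),
      ∫⁻ y in univ, ENNReal.ofReal (kernIncr α c r y ^ 2) ∂(levyMeasure α c) < ∞ :=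
    ae_lt_top (hm univ) hfin.ne
  have h0 : ∀ᵐ r ∂(volume.restrict (Icc 0 u)), Tendsto (fun n : ℕ =>
      ∫⁻ y in Iic (1 / ((n : ℝ) + 1)), ENNReal.ofReal (kernIncr α c r y ^ 2) ∂(levyMeasure α c))
      atTop (𝓝 0) := by
    filter_upwards [hae] with r hr
    rw [Measure.restrict_univ] at hr
    have hmy : Measurable fun y => ENNReal.ofReal (kernIncr α c r y ^ 2) :=
      (((measurable_kernIncr hα0).comp measurable_prodMk_left).pow_const 2).ennreal_ofReal
    have e : ∫⁻ _ : ℝ, (0 : ℝ≥0∞) ∂(levyMeasure α c) = 0 := lintegral_zero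
    rw [← e]
    simp_rw [← lintegral_indicator measurableSet_Iic]
    refine tendsto_lintegral_of_dominated_convergence _ (fun n => hmy.indicator measurableSet_Iic)
      (fun n => Eventually.of_forall fun y => indicator_le_self _ _ y) hr.ne ?_
    filter_upwards [ae_levyMeasure_pos] with y hy
    refine tendsto_const_nhds.congr' ?_
    have := (tendsto_one_div_add_atTop_nhds_zero_nat (𝕜 := ℝ)).eventually_lt_const hy
    filter_upwards [this] with n hn
    rw [indicator_of_notMem]
    simpa using hn
  have e : ∫⁻ _ in Icc 0 u, (0 : ℝ≥0∞) = 0 := lintegral_zero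
  rw [← e]
  refine tendsto_lintegral_of_dominated_convergence _ (fun n => hm _)
    (fun n => Eventually.of_forall fun r => lintegral_mono_set (subset_univ _)) hfin.ne h0

lemma lintegral_past_time {f : ℝ → ℝ≥0∞} (u : ℝ≥0) :
    ∫⁻ s : ℝ≥0, (Iic u).indicator (fun s => f ((u : ℝ) - s)) s ∂timeMeasure =
      ∫⁻ r in Icc (0 : ℝ) u, f r := by
  have h1 := lintegral_timeMeasure fun s : ℝ => (Iic (u : ℝ)).indicator (fun s => f (u - s)) s
  have h2 : ∀ s : ℝ≥0, (Iic u).indicator (fun s : ℝ≥0 => f ((u : ℝ) - s)) s =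
      (Iic (u : ℝ)).indicator (fun s => f (u - s)) s := fun s => by
    by_cases hs : s ∈ Iic u
    · rw [indicator_of_mem hs, indicator_of_mem (by simpa using hs)]
    · rw [indicator_of_notMem hs, indicator_of_notMem (by simpa using hs)]
  simp_rw [h2]
  rw [h1, ← lintegral_indicator measurableSet_Ici, ← lintegral_indicator measurableSet_Icc,
    ← lintegral_sub_left_eq_self (fun r => (Icc (0 : ℝ) u).indicator f r) (u : ℝ)]
  refine lintegral_congr fun s => ?_
  by_cases h1 : s ∈ Ici (0 : ℝ)
  · rw [indicator_of_mem h1]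
    by_cases h2 : s ∈ Iic (u : ℝ)
    · rw [indicator_of_mem h2, indicator_of_mem]
      simp only [mem_Ici, mem_Iic, mem_Icc] at *
      constructor <;> linarith
    · rw [indicator_of_notMem h2, indicator_of_notMem]
      simp only [mem_Iic, mem_Icc] at *
      intro h; apply h2; linarith
  · rw [indicator_of_notMem h1, indicator_of_notMem]
    simp only [mem_Ici, mem_Icc] at *
    intro h; apply h1; linarith

/-- Square integrals against the intensity of integrands bounded by the fractional kernel. -/
lemma lintegral_sq_intensity_le (hα0 : 0 < α) {Z : Set ℝ} (hZ : MeasurableSet Z) {M : ℝ}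
    (u : ℝ≥0) {F : ℝ≥0 × ℝ × ℝ → ℝ}
    (hF : ∀ e, 0 < e.2.1 → F e ≠ 0 → |F e| ≤ kernIncr α c ((u : ℝ) - e.1) e.2.1 ∧
      e.1 ≤ u ∧ e.2.1 ∈ Z ∧ 0 < e.2.2 ∧ e.2.2 ≤ M) :
    ∫⁻ e, ENNReal.ofReal (F e ^ 2) ∂(intensity α c) ≤ ENNReal.ofReal M * kernVar α c Z u := by
  let g : ℝ≥0 → ℝ → ℝ≥0∞ := fun s y => (Iic u).indicator (fun s : ℝ≥0 => Z.indicator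
    (fun y => ENNReal.ofReal (kernIncr α c ((u : ℝ) - s) y ^ 2)) y) s
  let h : ℝ → ℝ≥0∞ := (Ioc 0 M).indicator 1
  have hg : Measurable fun p : ℝ≥0 × ℝ => g p.1 p.2 := by
    have : Measurable fun p : ℝ≥0 × ℝ =>
        ENNReal.ofReal (kernIncr α c ((u : ℝ) - p.1) p.2 ^ 2) :=
      (((measurable_kernIncr hα0).comp (g := fun p : ℝ × ℝ => kernIncr α c p.1 p.2)
        (f := fun p : ℝ≥0 × ℝ => ((u : ℝ) - p.1, p.2)) (by fun_prop)).pow_const 2).ennreal_ofReal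
    have e : (fun p : ℝ≥0 × ℝ => g p.1 p.2) = (Iic u ×ˢ Z).indicator fun p : ℝ≥0 × ℝ =>
        ENNReal.ofReal (kernIncr α c ((u : ℝ) - p.1) p.2 ^ 2) := by
      ext ⟨s, y⟩
      by_cases h1 : s ∈ Iic u
      · by_cases h2 : y ∈ Z
        · simp only [g]
          rw [indicator_of_mem h1, indicator_of_mem h2, indicator_of_mem (mk_mem_prod h1 h2)]
        · simp only [g]
          rw [indicator_of_mem h1, indicator_of_notMem h2,
            indicator_of_notMem fun h => h2 (mem_prod.1 h).2]
      · simp only [g]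
        rw [indicator_of_notMem h1, indicator_of_notMem fun h => h1 (mem_prod.1 h).1]
    rw [e]
    exact this.indicator (measurableSet_Iic.prod hZ)
  have hh : Measurable h := measurable_one.indicator measurableSet_Ioc
  have hle : ∀ᵐ e ∂(intensity α c), ENNReal.ofReal (F e ^ 2) ≤ g e.1 e.2.1 * h e.2.2 := by
    filter_upwards [ae_intensity_pos α c] with e he
    by_cases h0 : F e = 0
    · rw [h0]; simp
    · obtain ⟨h5, h1, h2, h3, h4⟩ := hF e he h0
      simp only [g, h]
      rw [indicator_of_mem (show e.1 ∈ Iic u from h1), indicator_of_mem h2,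
        indicator_of_mem (show e.2.2 ∈ Ioc 0 M from ⟨h3, h4⟩), Pi.one_apply, mul_one,
        ← sq_abs (F e)]
      exact ENNReal.ofReal_le_ofReal (pow_le_pow_left₀ (abs_nonneg _) h5 2)
  have hhi : ∫⁻ z in Ioi (0 : ℝ), h z = ENNReal.ofReal M := by
    simp only [h]
    rw [lintegral_indicator_one measurableSet_Ioc, Measure.restrict_apply measurableSet_Ioc,
      inter_eq_left.2 Ioc_subset_Ioi_self, Real.volume_Ioc, sub_zero]
  have hgi : ∀ s, ∫⁻ y, g s y ∂(levyMeasure α c) = (Iic u).indicator (fun s : ℝ≥0 =>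
      ∫⁻ y in Z, ENNReal.ofReal (kernIncr α c ((u : ℝ) - s) y ^ 2) ∂(levyMeasure α c)) s := by
    intro s
    by_cases h1 : s ∈ Iic u
    · simp only [g, indicator_of_mem h1]
      rw [lintegral_indicator hZ]
    · simp only [g, indicator_of_notMem h1]
      exact lintegral_zero
  have hm : Measurable fun e : ℝ≥0 × ℝ × ℝ => g e.1 e.2.1 * h e.2.2 :=
    (hg.comp (f := fun e : ℝ≥0 × ℝ × ℝ => (e.1, e.2.1)) (by fun_prop)).mul
      (hh.comp (by fun_prop))
  have hgs : ∀ s, Measurable (g s) := fun s => hg.comp measurable_prodMk_left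
  calc _ ≤ ∫⁻ e, g e.1 e.2.1 * h e.2.2 ∂(intensity α c) := lintegral_mono_ae hle
    _ = ∫⁻ s, (∫⁻ y, g s y ∂(levyMeasure α c)) * ENNReal.ofReal M ∂timeMeasure := by
        rw [intensity, lintegral_prod _ hm.aemeasurable]
        refine lintegral_congr fun s => ?_
        rw [← hhi, ← lintegral_prod_mul (hgs s).aemeasurable hh.aemeasurable]
    _ = ENNReal.ofReal M * kernVar α c Z u := by
        rw [lintegral_mul_const' _ _ ENNReal.ofReal_ne_top, mul_comm, kernVar]
        congr 1
        simp_rw [hgi]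
        exact lintegral_past_time (f := fun r =>
          ∫⁻ y in Z, ENNReal.ofReal (kernIncr α c r y ^ 2) ∂(levyMeasure α c)) u

/-- Bounded regions of the state space that avoid small jumps. -/
def largeJumps (t : ℝ≥0) (δ : ℝ) (M : ℝ) : Set (ℝ≥0 × ℝ × ℝ) := Iic t ×ˢ (Ioi δ ×ˢ Ioc 0 M)

lemma measurableSet_largeJumps (t : ℝ≥0) (δ M : ℝ) : MeasurableSet (largeJumps t δ M) :=
  measurableSet_Iic.prod (measurableSet_Ioi.prod measurableSet_Ioc)

lemma intensity_largeJumps_lt_top (hα0 : 0 < α) (hα1 : α < 1) (hc : 0 < c) (t : ℝ≥0) {δ : ℝ}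
    (hδ : 0 < δ) (M : ℝ) : intensity α c (largeJumps t δ M) < ∞ := by
  rw [largeJumps, intensity, Measure.prod_prod, Measure.prod_prod]
  refine ENNReal.mul_lt_top (timeMeasure_Iic_lt_top t) (ENNReal.mul_lt_top ?_ ?_)
  · have h1 := (levy_min_sq hα0 hα1 hc hδ).1.measure_ge_lt_top (ε := δ ^ 2) (by positivity)
    refine lt_of_le_of_lt (measure_mono fun y hy => ?_) h1
    simp only [mem_ofPred_eq]
    rw [min_eq_right (le_of_lt hy)]
  · rw [Measure.restrict_apply measurableSet_Ioc]
    exact (measure_mono inter_subset_left).trans_lt measure_Ioc_lt_top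

/-! ### Increment kernels -/

/-- A continuous function vanishing on the negative half line whose increments are dominated by
those of the integrated fractional kernel. -/
structure IsVolterraKernel (α c : ℝ) (A : ℝ → ℝ) : Prop where
  continuous : Continuous A
  eq_zero : ∀ x ≤ 0, A x = 0
  abs_sub_le : ∀ x y, 0 ≤ x → x ≤ y → |A y - A x| ≤ kernInt α c y - kernInt α c x

lemma IsVolterraKernel.abs_incr_le {α c : ℝ} {A : ℝ → ℝ} (hA : IsVolterraKernel α c A) {r y : ℝ}
    (hr : 0 ≤ r) (hy : 0 ≤ y) : |A r - A (r - y)| ≤ kernIncr α c r y := by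
  rcases le_total (r - y) 0 with h | h
  · have h0 : A (r - y) = A 0 := by rw [hA.eq_zero _ h, hA.eq_zero 0 le_rfl]
    rw [kernIncr, max_eq_right h, h0]
    exact hA.abs_sub_le 0 r le_rfl hr
  · rw [kernIncr, max_eq_left h]
    exact hA.abs_sub_le _ _ h (by linarith)

section Increments

variable {Ω : Type u} {X : ℝ≥0 → Ω → ℝ} {A : ℝ → ℝ} {α c : ℝ}

/-- The Volterra integrand of an increment kernel. -/
abbrev incrIntegrand (X : ℝ≥0 → Ω → ℝ) (A : ℝ → ℝ) (u : ℝ≥0) : (ℝ≥0 × Ω) × (ℝ × ℝ) → ℝ :=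
  volterraIntegrand X (fun r y => A r - A (r - y)) u

/-- The Volterra integrand without the small jumps. -/
def incrApprox (X : ℝ≥0 → Ω → ℝ) (A : ℝ → ℝ) (n : ℕ) (u : ℝ≥0) : (ℝ≥0 × Ω) × (ℝ × ℝ) → ℝ :=
  {p | p.2 ∈ {q : ℝ × ℝ | 1 / ((n : ℝ) + 1) < q.1}}.indicator (incrIntegrand X A u)

lemma incrIntegrand_of_mem {u s : ℝ≥0} {ω : Ω} {y z : ℝ} (h : s ≤ u ∧ 0 < z ∧ z ≤ X s ω) :
    incrIntegrand X A u ((s, ω), y, z) = A ((u : ℝ) - s) - A ((u : ℝ) - s - y) :=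
  indicator_of_mem (s := {p : (ℝ≥0 × Ω) × (ℝ × ℝ) | p.1.1 ≤ u ∧ 0 < p.2.2 ∧ p.2.2 ≤ X p.1.1 p.1.2})
    h _

lemma incrIntegrand_of_not_mem {u s : ℝ≥0} {ω : Ω} {y z : ℝ} (h : ¬(s ≤ u ∧ 0 < z ∧ z ≤ X s ω)) :
    incrIntegrand X A u ((s, ω), y, z) = 0 :=
  indicator_of_notMem (s := {p : (ℝ≥0 × Ω) × (ℝ × ℝ) | p.1.1 ≤ u ∧ 0 < p.2.2 ∧
    p.2.2 ≤ X p.1.1 p.1.2}) h _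

lemma incrIntegrand_bound (hA : IsVolterraKernel α c A) {u s : ℝ≥0} {ω : Ω} {y z : ℝ}
    (hy : 0 < y) (h0 : incrIntegrand X A u ((s, ω), y, z) ≠ 0) :
    |incrIntegrand X A u ((s, ω), y, z)| ≤ kernIncr α c ((u : ℝ) - s) y ∧
      s ≤ u ∧ 0 < z ∧ z ≤ X s ω := by
  by_cases h : s ≤ u ∧ 0 < z ∧ z ≤ X s ω
  · refine ⟨?_, h⟩
    rw [incrIntegrand_of_mem h]
    exact hA.abs_incr_le (sub_nonneg.2 (by exact_mod_cast h.1)) hy.le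
  · exact absurd (incrIntegrand_of_not_mem h) h0

lemma incrApprox_of_lt {n : ℕ} {u s : ℝ≥0} {ω : Ω} {y z : ℝ} (h : 1 / ((n : ℝ) + 1) < y) :
    incrApprox X A n u ((s, ω), y, z) = incrIntegrand X A u ((s, ω), y, z) :=
  indicator_of_mem (s := {p : (ℝ≥0 × Ω) × (ℝ × ℝ) | p.2 ∈ {q : ℝ × ℝ | 1 / ((n : ℝ) + 1) < q.1}}) h _

lemma incrApprox_of_le {n : ℕ} {u s : ℝ≥0} {ω : Ω} {y z : ℝ} (h : y ≤ 1 / ((n : ℝ) + 1)) :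
    incrApprox X A n u ((s, ω), y, z) = 0 :=
  indicator_of_notMem (s := {p : (ℝ≥0 × Ω) × (ℝ × ℝ) | p.2 ∈ {q : ℝ × ℝ | 1 / ((n : ℝ) + 1) < q.1}})
    (not_lt.2 h) _

/-- Without small jumps the integrand is bounded and lives on a region of finite mass. It is
therefore integrable pathwise, both for `N ω` and for the intensity. -/
lemma abs_incrApprox_le (hα0 : 0 < α) (hc : 0 < c) (hA : IsVolterraKernel α c A) {n : ℕ}
    {u t : ℝ≥0} (hut : u ≤ t) {ω : Ω} {M : ℝ} (hM : ∀ s ≤ t, X s ω ≤ M) (e : ℝ≥0 × ℝ × ℝ) :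
    |incrApprox X A n u ((e.1, ω), e.2)| ≤
      (largeJumps t (1 / ((n : ℝ) + 1)) M).indicator (fun _ => kernInt α c t) e := by
  obtain ⟨s, y, z⟩ := e
  have hk : 0 ≤ kernInt α c t := by
    have := kernInt_mono (α := α) (c := c) hα0 hc le_rfl t.2
    rwa [kernInt_zero] at this
  have hpos : (0 : ℝ) < 1 / ((n : ℝ) + 1) := by positivity
  rcases le_or_gt y (1 / ((n : ℝ) + 1)) with h | h
  · simp only [incrApprox_of_le h, abs_zero]
    exact indicator_nonneg (fun _ _ => hk) _
  · simp only [incrApprox_of_lt h]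
    by_cases h0 : incrIntegrand X A u ((s, ω), y, z) = 0
    · rw [h0, abs_zero]; exact indicator_nonneg (fun _ _ => hk) _
    · obtain ⟨h1, h2, h3, h4⟩ := incrIntegrand_bound hA (hpos.trans h) h0
      rw [indicator_of_mem]
      · refine (h1.trans (kernIncr_le_kernInt hα0 hc _ _)).trans ?_
        have h5 : (s : ℝ) ≤ u := by exact_mod_cast h2
        have h6 : (u : ℝ) ≤ t := by exact_mod_cast hut
        exact kernInt_mono hα0 hc (by linarith) (by linarith [s.2])
      · exact ⟨h2.trans hut, h, h3, h4.trans (hM s (h2.trans hut))⟩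

lemma exists_path_bound (hXc : ∀ ω, Continuous fun t => X t ω) (t : ℝ≥0) (ω : Ω) :
    ∃ M : ℕ, ∀ s ≤ t, X s ω ≤ M := by
  have h1 : IsCompact (Iic t) := by
    have : Iic t = Icc 0 t := by ext s; simp
    rw [this]; exact isCompact_Icc
  obtain ⟨C, hC⟩ := (h1.image (hXc ω)).bddAbove
  obtain ⟨M, hM⟩ := exists_nat_ge C
  exact ⟨M, fun s hs => (hC ⟨s, hs, rfl⟩).trans hM⟩

lemma lintegral_incrApprox_sub_sq_le (hα0 : 0 < α) (hA : IsVolterraKernel α c A) (n : ℕ)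
    (u : ℝ≥0) {ω : Ω} {M : ℝ} (hM : ∀ s ≤ u, X s ω ≤ M) :
    ∫⁻ e, ENNReal.ofReal ((incrApprox X A n u ((e.1, ω), e.2) -
      incrIntegrand X A u ((e.1, ω), e.2)) ^ 2) ∂(intensity α c) ≤
      ENNReal.ofReal M * kernVar α c (Iic (1 / ((n : ℝ) + 1))) u := by
  refine lintegral_sq_intensity_le hα0 measurableSet_Iic u fun e he hne => ?_
  obtain ⟨s, y, z⟩ := e
  rcases le_or_gt y (1 / ((n : ℝ) + 1)) with h | h
  · simp only [incrApprox_of_le h, zero_sub, abs_neg, ne_eq, neg_eq_zero] at hne ⊢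
    obtain ⟨h1, h2, h3, h4⟩ := incrIntegrand_bound hA he hne
    exact ⟨h1, h2, h, h3, h4.trans (hM s h2)⟩
  · simp only [incrApprox_of_lt h, sub_self, ne_eq, not_true] at hne

lemma lintegral_incrIntegrand_sq_le (hα0 : 0 < α) (hA : IsVolterraKernel α c A)
    (u : ℝ≥0) {ω : Ω} {M : ℝ} (hM : ∀ s ≤ u, X s ω ≤ M) :
    ∫⁻ e, ENNReal.ofReal (incrIntegrand X A u ((e.1, ω), e.2) ^ 2) ∂(intensity α c) ≤
      ENNReal.ofReal M * kernVar α c univ u := by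
  refine lintegral_sq_intensity_le hα0 MeasurableSet.univ u fun e he hne => ?_
  obtain ⟨s, y, z⟩ := e
  obtain ⟨h1, h2, h3, h4⟩ := incrIntegrand_bound hA he hne
  exact ⟨h1, h2, trivial, h3, h4.trans (hM s h2)⟩

variable [mΩ : MeasurableSpace Ω] {P : Measure Ω} [IsProbabilityMeasure P] {ℱ : Filtration ℝ≥0 mΩ}
  {N : Ω → Measure (ℝ≥0 × ℝ × ℝ)}

omit [IsProbabilityMeasure P] in
lemma isPredictable_incrIntegrand (hX : StronglyAdapted ℱ X)
    (hXc : ∀ ω, Continuous fun t => X t ω) (hA : IsVolterraKernel α c A) (u : ℝ≥0) :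
    IsPredictableIntegrand ℱ (incrIntegrand X A u) :=
  isPredictableIntegrand_volterraIntegrand hX hXc (by
    have := hA.continuous
    exact Continuous.measurable (by fun_prop)) u

omit [IsProbabilityMeasure P] in
lemma isPredictable_incrApprox (hX : StronglyAdapted ℱ X)
    (hXc : ∀ ω, Continuous fun t => X t ω) (hA : IsVolterraKernel α c A) (n : ℕ) (u : ℝ≥0) :
    IsPredictableIntegrand ℱ (incrApprox X A n u) :=
  (isPredictable_incrIntegrand hX hXc hA u).indicator
    (measurableSet_predictable_mark (measurableSet_lt measurable_const measurable_fst))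

omit [IsProbabilityMeasure P] in
lemma ae_largeJumps_lt_top (hα0 : 0 < α) (hα1 : α < 1) (hc : 0 < c)
    (h : IsPoissonRandomMeasure P ℱ (intensity α c) N) (t : ℝ≥0) :
    ∀ᵐ ω ∂P, ∀ n M : ℕ, N ω (largeJumps t (1 / ((n : ℝ) + 1)) M) < ∞ :=
  ae_all_iff.2 fun n => ae_all_iff.2 fun M => h.ae_lt_top (measurableSet_largeJumps _ _ _)
    (intensity_largeJumps_lt_top hα0 hα1 hc t (by positivity) M).ne

lemma integrable_incrApprox (hα0 : 0 < α) (hc : 0 < c) (hX : StronglyAdapted ℱ X)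
    (hXc : ∀ ω, Continuous fun t => X t ω) (hA : IsVolterraKernel α c A)
    {n : ℕ} {u t : ℝ≥0} (hut : u ≤ t) {ω : Ω} {M : ℝ} (hM : ∀ s ≤ t, X s ω ≤ M)
    {ν : Measure (ℝ≥0 × ℝ × ℝ)} (hν : ν (largeJumps t (1 / ((n : ℝ) + 1)) M) < ∞) :
    Integrable (fun e => incrApprox X A n u ((e.1, ω), e.2)) ν := by
  refine Integrable.mono' (g := (largeJumps t (1 / ((n : ℝ) + 1)) M).indicator
    fun _ => kernInt α c t) ?_ ?_ (Eventually.of_forall fun e => abs_incrApprox_le hα0 hc hA hut hM e)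
  · exact (integrable_indicator_iff (measurableSet_largeJumps _ _ _)).2 (integrableOn_const hν.ne)
  · exact ((isPredictable_incrApprox hX hXc hA n u).measurable.comp
      (measurable_place_right ω)).aestronglyMeasurable

omit [IsProbabilityMeasure P] in
lemma ae_integrable_incrApprox (hα0 : 0 < α) (hα1 : α < 1) (hc : 0 < c)
    (h : IsPoissonRandomMeasure P ℱ (intensity α c) N) (hX : StronglyAdapted ℱ X)
    (hXc : ∀ ω, Continuous fun t => X t ω) (hA : IsVolterraKernel α c A) (n : ℕ) (u : ℝ≥0) :
    ∀ᵐ ω ∂P, Integrable (fun e => incrApprox X A n u ((e.1, ω), e.2)) (intensity α c) ∧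
      Integrable (fun e => incrApprox X A n u ((e.1, ω), e.2)) (N ω) := by
  filter_upwards [ae_largeJumps_lt_top hα0 hα1 hc h u] with ω hω
  obtain ⟨M, hM⟩ := exists_path_bound hXc u ω
  exact ⟨integrable_incrApprox hα0 hc hX hXc hA le_rfl hM
    (intensity_largeJumps_lt_top hα0 hα1 hc u (by positivity) M),
    integrable_incrApprox hα0 hc hX hXc hA le_rfl hM (hω n M)⟩

/-- For each path the error tends to zero, with a bound depending on the maximum of that path. Hence
the indicators of the events converge to zero everywhere, and no moment of `X` is required. -/
lemma tendsto_incrApprox (hα0 : 0 < α) (hα1 : α < 1) (hc : 0 < c) (hX : StronglyAdapted ℱ X)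
    (hXc : ∀ ω, Continuous fun t => X t ω) (hA : IsVolterraKernel α c A) (u : ℝ≥0)
    (ε : ℝ≥0∞) (hε : 0 < ε) :
    Tendsto (fun n => P {ω | ε ≤ ∫⁻ e, ENNReal.ofReal ((incrApprox X A n u ((e.1, ω), e.2) -
      incrIntegrand X A u ((e.1, ω), e.2)) ^ 2) ∂(intensity α c)}) atTop (𝓝 0) := by
  rw [← measure_empty (μ := P)]
  refine tendsto_measure_of_tendsto_indicator_of_isFiniteMeasure atTop P (fun n => ?_) fun ω => ?_
  · have h1 : Measurable fun p : Ω × (ℝ≥0 × ℝ × ℝ) =>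
        ENNReal.ofReal ((incrApprox X A n u ((p.2.1, p.1), p.2.2) -
          incrIntegrand X A u ((p.2.1, p.1), p.2.2)) ^ 2) :=
      ((((isPredictable_incrApprox hX hXc hA n u).measurable.sub
        (isPredictable_incrIntegrand hX hXc hA u).measurable).comp measurable_place).pow_const
          2).ennreal_ofReal
    exact measurableSet_le measurable_const h1.lintegral_prod_right'
  · obtain ⟨M, hM⟩ := exists_path_bound hXc u ω
    have h1 : Tendsto (fun n : ℕ => ENNReal.ofReal M *
        kernVar α c (Iic (1 / ((n : ℝ) + 1))) u) atTop (𝓝 0) := by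
      have := ENNReal.Tendsto.const_mul (a := ENNReal.ofReal M) (tendsto_kernVar hα0 hα1 hc u)
        (Or.inr ENNReal.ofReal_ne_top)
      rwa [mul_zero] at this
    filter_upwards [h1.eventually_lt_const hε] with n hn
    simp only [mem_empty_iff_false, iff_false, not_le]
    exact (lintegral_incrApprox_sub_sq_le hα0 hA n u hM).trans_lt hn

lemma tendstoInMeasure_compInt_incrApprox (hα0 : 0 < α) (hα1 : α < 1) (hc : 0 < c)
    (h : IsPoissonRandomMeasure P ℱ (intensity α c) N) (hX : StronglyAdapted ℱ X)
    (hXc : ∀ ω, Continuous fun t => X t ω) (hA : IsVolterraKernel α c A) {u : ℝ≥0} {Y : Ω → ℝ}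
    (hY : IsCompensatedIntegral P ℱ (intensity α c) N (incrIntegrand X A u) Y) :
    TendstoInMeasure P (fun n => compInt (intensity α c) N (incrApprox X A n u)) atTop Y :=
  hY.tendstoInMeasure h (intensity_singleton α c) (fun n => isPredictable_incrApprox hX hXc hA n u)
    (fun n => ae_integrable_incrApprox hα0 hα1 hc h hX hXc hA n u)
    (tendsto_incrApprox hα0 hα1 hc hX hXc hA u)

/-- The compensated integral of an increment kernel is identified by its approximants. -/
lemma isCompensatedIntegral_of_tendsto (hα0 : 0 < α) (hα1 : α < 1) (hc : 0 < c)
    (h : IsPoissonRandomMeasure P ℱ (intensity α c) N) (hX : StronglyAdapted ℱ X)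
    (hXc : ∀ ω, Continuous fun t => X t ω) (hA : IsVolterraKernel α c A) {u : ℝ≥0} {Y : Ω → ℝ}
    (hY : TendstoInMeasure P (fun n => compInt (intensity α c) N (incrApprox X A n u)) atTop Y) :
    IsCompensatedIntegral P ℱ (intensity α c) N (incrIntegrand X A u) Y where
  predictable := isPredictable_incrIntegrand hX hXc hA u
  sq_finite := by
    refine Eventually.of_forall fun ω => ?_
    obtain ⟨M, hM⟩ := exists_path_bound hXc u ω
    exact (lintegral_incrIntegrand_sq_le hα0 hA u hM).trans_lt
      (ENNReal.mul_lt_top ENNReal.ofReal_lt_top (kernVar_univ_lt_top hα0 hα1 hc u))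
  exists_approx := ⟨fun n => incrApprox X A n u, fun n => isPredictable_incrApprox hX hXc hA n u,
    fun n => ae_integrable_incrApprox hα0 hα1 hc h hX hXc hA n u,
    tendsto_incrApprox hα0 hα1 hc hX hXc hA u, hY⟩

end Increments

/-! ### Pathwise convolution of the approximants -/

/-- Because `A` vanishes on the negative half line, translating it by `a ≥ 0` translates the
convolution identity. -/
lemma integral_mul_shift {A A' L : ℝ → ℝ} {α c β : ℝ} (hA : IsVolterraKernel α c A)
    (hA' : IsVolterraKernel α c A') (hLi : ∀ t, IntervalIntegrable L volume 0 t)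
    (hAA : ∀ x, 0 ≤ x → A' x = A x + β * conv L A x) {t a : ℝ} (ha : 0 ≤ a) :
    β * ∫ u in (0 : ℝ)..t, L (t - u) * A (u - a) = A' (t - a) - A (t - a) := by
  have hi : ∀ p q, IntervalIntegrable (fun u => L (t - u) * A (u - a)) volume p q := by
    intro p q
    have h1 : IntervalIntegrable L volume (t - p) (t - q) := (hLi _).symm.trans (hLi _)
    have h2 := (h1.comp_sub_left t)
    simp only [sub_sub_cancel] at h2
    exact h2.mul_continuousOn (hA.continuous.comp (by fun_prop : Continuous fun u => u - a)).continuousOn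
  have hz : ∀ q, q ≤ a → ∫ u in (0 : ℝ)..q, L (t - u) * A (u - a) = 0 := by
    intro q hq
    refine intervalIntegral.integral_zero_ae (Eventually.of_forall fun u hu => ?_)
    have h1 : u ≤ a := by
      rcases le_total 0 q with h | h
      · rw [uIoc_of_le h] at hu; exact hu.2.trans hq
      · rw [uIoc_of_ge h] at hu; exact hu.2.trans ha
    rw [hA.eq_zero _ (by linarith), mul_zero]
  rcases le_total t a with h | h
  · rw [hz t h, hA.eq_zero _ (by linarith), hA'.eq_zero _ (by linarith)]; simp
  · rw [← intervalIntegral.integral_add_adjacent_intervals (hi 0 a) (hi a t), hz a le_rfl, zero_add,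
      hAA _ (by linarith), conv]
    have := intervalIntegral.integral_comp_sub_right (a := a) (b := t)
      (fun w => L (t - a - w) * A w) a
    rw [sub_self] at this
    simp only [smul_eq_mul]
    rw [← this, add_sub_cancel_left]
    congr 2
    ext u
    congr 2
    ring

section Pathwise

variable {Ω : Type u} {X : ℝ≥0 → Ω → ℝ} {A A' L : ℝ → ℝ} {α c β : ℝ}

/-- As a function of the outer time, the integrand at a jump `(s, y)` is the difference of the
translates of `A` by `s` and by `s + y`. The cutoff at the outer time is automatic, since both
translates vanish before `s`. -/
lemma incrApprox_conv (hA : IsVolterraKernel α c A)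
    (hA' : IsVolterraKernel α c A') (hLi : ∀ t, IntervalIntegrable L volume 0 t)
    (hAA : ∀ x, 0 ≤ x → A' x = A x + β * conv L A x) (n : ℕ) (t : ℝ≥0) (ω : Ω)
    (e : ℝ≥0 × ℝ × ℝ) :
    incrApprox X A' n t ((e.1, ω), e.2) = incrApprox X A n t ((e.1, ω), e.2) +
      β * ∫ u in (0 : ℝ)..t, L (t - u) * incrApprox X A n u.toNNReal ((e.1, ω), e.2) := by
  obtain ⟨s, y, z⟩ := e
  rcases le_or_gt y (1 / ((n : ℝ) + 1)) with h | h
  · simp [incrApprox_of_le h]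
  have hy : 0 < y := lt_trans (by positivity) h
  simp only [incrApprox_of_lt h]
  by_cases hz : 0 < z ∧ z ≤ X s ω
  · have key : ∀ u : ℝ≥0, incrIntegrand X A u ((s, ω), y, z) = A (u - s) - A (u - s - y) := by
      intro u
      by_cases hs : s ≤ u
      · exact incrIntegrand_of_mem ⟨hs, hz⟩
      · rw [incrIntegrand_of_not_mem fun hc => hs hc.1]
        have : (u : ℝ) < s := by exact_mod_cast not_le.1 hs
        rw [hA.eq_zero _ (by linarith), hA.eq_zero _ (by linarith), sub_zero]
    have key' : incrIntegrand X A' t ((s, ω), y, z) = A' (t - s) - A' (t - s - y) := by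
      by_cases hs : s ≤ t
      · exact incrIntegrand_of_mem ⟨hs, hz⟩
      · rw [incrIntegrand_of_not_mem fun hc => hs hc.1]
        have : (t : ℝ) < s := by exact_mod_cast not_le.1 hs
        rw [hA'.eq_zero _ (by linarith), hA'.eq_zero _ (by linarith), sub_zero]
    have e1 : ∫ u in (0 : ℝ)..t, L (t - u) * incrIntegrand X A u.toNNReal ((s, ω), y, z) =
        ∫ u in (0 : ℝ)..t, (L (t - u) * A (u - s) - L (t - u) * A (u - (s + y))) := by
      refine intervalIntegral.integral_congr fun u hu => ?_
      rw [uIcc_of_le t.coe_nonneg] at hu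
      simp only [key, Real.coe_toNNReal u hu.1]
      rw [mul_sub, sub_sub]
    have hi : ∀ a, IntervalIntegrable (fun u => L (t - u) * A (u - a)) volume 0 t := by
      intro a
      have h2 := ((hLi t).symm.comp_sub_left t)
      simp only [sub_self, sub_zero] at h2
      exact h2.mul_continuousOn
        (hA.continuous.comp (by fun_prop : Continuous fun u => u - a)).continuousOn
    rw [e1, intervalIntegral.integral_sub (hi _) (hi _), mul_sub,
      integral_mul_shift hA hA' hLi hAA s.coe_nonneg, integral_mul_shift hA hA' hLi hAA
      (add_nonneg s.coe_nonneg hy.le), key, key', ← sub_sub]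
    ring
  · have h0 : ∀ (B : ℝ → ℝ) (u : ℝ≥0), incrIntegrand X B u ((s, ω), y, z) = 0 := fun B u =>
      incrIntegrand_of_not_mem fun hc => hz hc.2
    simp [h0]

variable [mΩ : MeasurableSpace Ω] {ℱ : Filtration ℝ≥0 mΩ}

lemma measurable_incrApprox_joint (hX : StronglyAdapted ℱ X)
    (hXc : ∀ ω, Continuous fun t => X t ω) (hA : IsVolterraKernel α c A) (n : ℕ) :
    Measurable fun p : (ℝ≥0 × Ω) × (ℝ≥0 × ℝ × ℝ) =>
      incrApprox X A n p.1.1 ((p.2.1, p.1.2), p.2.2) := by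
  have hXm : Measurable fun p : (ℝ≥0 × Ω) × (ℝ≥0 × ℝ × ℝ) => X p.2.1 p.1.2 :=
    (measurable_uncurry_of_continuous_adapted hX hXc).comp
      (f := fun p : (ℝ≥0 × Ω) × (ℝ≥0 × ℝ × ℝ) => (p.2.1, p.1.2)) (by fun_prop)
  have hAm := hA.continuous.measurable
  have e : (fun p : (ℝ≥0 × Ω) × (ℝ≥0 × ℝ × ℝ) =>
      incrApprox X A n p.1.1 ((p.2.1, p.1.2), p.2.2)) =
      ({p | 1 / ((n : ℝ) + 1) < p.2.2.1} ∩ ({p | p.2.1 ≤ p.1.1} ∩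
        ({p | 0 < p.2.2.2} ∩ {p | p.2.2.2 ≤ X p.2.1 p.1.2}))).indicator fun p =>
        A ((p.1.1 : ℝ) - p.2.1) - A ((p.1.1 : ℝ) - p.2.1 - p.2.2.1) := by
    ext ⟨⟨u, ω⟩, s, y, z⟩
    by_cases h : 1 / ((n : ℝ) + 1) < y
    · by_cases h' : s ≤ u ∧ 0 < z ∧ z ≤ X s ω
      · rw [indicator_of_mem (by exact ⟨h, h'⟩)]
        simp only [incrApprox_of_lt h]
        exact incrIntegrand_of_mem h'
      · rw [indicator_of_notMem (by exact fun hc => h' hc.2)]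
        simp only [incrApprox_of_lt h]
        exact incrIntegrand_of_not_mem h'
    · rw [indicator_of_notMem (by exact fun hc => h hc.1)]
      exact incrApprox_of_le (not_lt.1 h)
  rw [e]
  refine Measurable.indicator ?_ ?_
  · fun_prop
  · exact (measurableSet_lt measurable_const (by fun_prop)).inter
      ((measurableSet_le (by fun_prop) (by fun_prop)).inter
        ((measurableSet_lt measurable_const (by fun_prop)).inter
          (measurableSet_le (by fun_prop) hXm)))

/-- Fubini for the approximants against a measure with finitely many large jumps. -/
lemma integral_incrApprox_conv (hα0 : 0 < α) (hc : 0 < c) (hX : StronglyAdapted ℱ X)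
    (hXc : ∀ ω, Continuous fun t => X t ω) (hA : IsVolterraKernel α c A)
    (hA' : IsVolterraKernel α c A') (hLm : Measurable L)
    (hLi : ∀ t, IntervalIntegrable L volume 0 t)
    (hAA : ∀ x, 0 ≤ x → A' x = A x + β * conv L A x) {n : ℕ} {t : ℝ≥0} {ω : Ω} {M : ℝ}
    (hM : ∀ s ≤ t, X s ω ≤ M) {ν : Measure (ℝ≥0 × ℝ × ℝ)}
    (hν : ν (largeJumps t (1 / ((n : ℝ) + 1)) M) < ∞) :
    IntervalIntegrable (fun u => L (t - u) *
      ∫ e, incrApprox X A n u.toNNReal ((e.1, ω), e.2) ∂ν) volume 0 t ∧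
    ∫ e, incrApprox X A' n t ((e.1, ω), e.2) ∂ν = ∫ e, incrApprox X A n t ((e.1, ω), e.2) ∂ν +
      β * ∫ u in (0 : ℝ)..t, L (t - u) *
        ∫ e, incrApprox X A n u.toNNReal ((e.1, ω), e.2) ∂ν := by
  set Q := largeJumps t (1 / ((n : ℝ) + 1)) M with hQ
  have hQm : MeasurableSet Q := measurableSet_largeJumps _ _ _
  have : Fact (ν Q < ∞) := ⟨hν⟩
  have hk : 0 ≤ kernInt α c t := by
    have := kernInt_mono (α := α) (c := c) hα0 hc le_rfl t.2
    rwa [kernInt_zero] at this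
  have hto : ∀ u : ℝ, u ∈ Ioc (0 : ℝ) t → u.toNNReal ≤ t := fun u hu =>
    Real.toNNReal_le_iff_le_coe.2 hu.2
  have hb : ∀ u ≤ t, ∀ e : ℝ≥0 × ℝ × ℝ,
      |incrApprox X A n u ((e.1, ω), e.2)| ≤ Q.indicator (fun _ => kernInt α c t) e :=
    fun u hu e => abs_incrApprox_le hα0 hc hA hu hM e
  have hQr : ∀ u ≤ t, ∫ e in Q, incrApprox X A n u ((e.1, ω), e.2) ∂ν =
      ∫ e, incrApprox X A n u ((e.1, ω), e.2) ∂ν := by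
    intro u hu
    refine setIntegral_eq_integral_of_forall_compl_eq_zero fun e he => ?_
    have := hb u hu e
    rw [indicator_of_notMem he] at this
    exact abs_nonpos_iff.1 this
  have hLt : IntegrableOn (fun u => L (t - u)) (Ioc (0 : ℝ) t) := by
    have h2 := ((hLi t).symm.comp_sub_left t)
    simp only [sub_self, sub_zero] at h2
    exact (intervalIntegrable_iff_integrableOn_Ioc_of_le t.coe_nonneg).1 h2
  have hJm : Measurable fun p : ℝ × (ℝ≥0 × ℝ × ℝ) =>
      incrApprox X A n p.1.toNNReal ((p.2.1, ω), p.2.2) :=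
    (measurable_incrApprox_joint hX hXc hA n).comp
      (f := fun p : ℝ × (ℝ≥0 × ℝ × ℝ) => ((p.1.toNNReal, ω), p.2)) (by fun_prop)
  -- On the finite measure `ν.restrict Q` the integrand is dominated by `|L (t - u)|` times the
  -- constant `K t`.
  have hint : Integrable (fun p : ℝ × (ℝ≥0 × ℝ × ℝ) =>
      L (t - p.1) * incrApprox X A n p.1.toNNReal ((p.2.1, ω), p.2.2))
      ((volume.restrict (Ioc (0 : ℝ) t)).prod (ν.restrict Q)) := by
    have h1 : Integrable (fun p : ℝ × (ℝ≥0 × ℝ × ℝ) => L (t - p.1) * kernInt α c t)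
        ((volume.restrict (Ioc (0 : ℝ) t)).prod (ν.restrict Q)) :=
      Integrable.mul_prod (f := fun u : ℝ => L (t - u)) (g := fun _ => kernInt α c t) hLt
        (integrable_const _)
    refine h1.mono ?_ ?_
    · exact ((hLm.comp (by fun_prop : Measurable fun p : ℝ × (ℝ≥0 × ℝ × ℝ) =>
        (t : ℝ) - p.1)).mul hJm).aestronglyMeasurable
    · have h2 : ∀ᵐ u ∂(volume.restrict (Ioc (0 : ℝ) t)), u ∈ Ioc (0 : ℝ) t :=
        ae_restrict_mem measurableSet_Ioc
      filter_upwards [Measure.quasiMeasurePreserving_fst.ae h2] with p hp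
      rw [norm_mul, norm_mul]
      refine mul_le_mul_of_nonneg_left ?_ (norm_nonneg _)
      rw [Real.norm_eq_abs, Real.norm_of_nonneg hk]
      exact (hb _ (hto _ hp) p.2).trans (indicator_le_self' (fun _ _ => hk) _)
  have hae : ∀ᵐ u ∂(volume.restrict (Ioc (0 : ℝ) t)), ∫ e in Q,
      L (t - u) * incrApprox X A n u.toNNReal ((e.1, ω), e.2) ∂ν =
      L (t - u) * ∫ e, incrApprox X A n u.toNNReal ((e.1, ω), e.2) ∂ν := by
    filter_upwards [ae_restrict_mem measurableSet_Ioc] with u hu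
    rw [integral_const_mul, hQr _ (hto u hu)]
  refine ⟨?_, ?_⟩
  · rw [intervalIntegrable_iff_integrableOn_Ioc_of_le t.coe_nonneg]
    exact hint.integral_prod_left.congr hae
  · have h1 := integrable_incrApprox hα0 hc hX hXc hA le_rfl hM hν
    have h3 : ∫ u in (0 : ℝ)..t, L (t - u) *
        ∫ e, incrApprox X A n u.toNNReal ((e.1, ω), e.2) ∂ν =
        ∫ e in Q, (∫ u in (0 : ℝ)..t, L (t - u) *
          incrApprox X A n u.toNNReal ((e.1, ω), e.2)) ∂ν := by
      rw [intervalIntegral.integral_of_le t.coe_nonneg, ← integral_congr_ae hae, integral_integral_swap hint]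
      simp_rw [intervalIntegral.integral_of_le t.coe_nonneg]
    have h4 : Integrable (fun e : ℝ≥0 × ℝ × ℝ => ∫ u in (0 : ℝ)..t, L (t - u) *
        incrApprox X A n u.toNNReal ((e.1, ω), e.2)) (ν.restrict Q) := by
      simp_rw [intervalIntegral.integral_of_le t.coe_nonneg]
      exact hint.integral_prod_right
    rw [h3, ← integral_const_mul, ← hQr t le_rfl,
      ← integral_add h1.restrict (h4.const_mul β)]
    simp_rw [← incrApprox_conv hA hA' hLi hAA n t ω]
    refine (setIntegral_eq_integral_of_forall_compl_eq_zero fun e he => ?_).symm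
    have := abs_incrApprox_le hα0 hc hA' le_rfl hM (n := n) e
    rw [indicator_of_notMem he] at this
    exact abs_nonpos_iff.1 this

end Pathwise

/-! ### Stochastic Fubini theorem -/

section StochasticFubini

variable {Ω : Type u} {X : ℝ≥0 → Ω → ℝ} {A A' L : ℝ → ℝ} {α c β : ℝ}
  [mΩ : MeasurableSpace Ω] {P : Measure Ω} {ℱ : Filtration ℝ≥0 mΩ}
  {N : Ω → Measure (ℝ≥0 × ℝ × ℝ)}

lemma setLIntegral_enorm_le_sqrt [IsProbabilityMeasure P] (S : Set Ω) {f : Ω → ℝ}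
    (hf : AEMeasurable f P) : ∫⁻ ω in S, ‖f ω‖ₑ ∂P ≤
      (∫⁻ ω in S, ENNReal.ofReal (f ω ^ 2) ∂P) ^ (1 / 2 : ℝ) := by
  have h1 := ENNReal.lintegral_mul_le_Lp_mul_Lq (P.restrict S) Real.HolderConjugate.two_two
    (f := fun ω => ‖f ω‖ₑ) (g := fun _ => 1) hf.restrict.enorm aemeasurable_const
  have h2 : ∀ ω, ‖f ω‖ₑ ^ (2 : ℝ) = ENNReal.ofReal (f ω ^ 2) := by
    intro ω
    rw [ENNReal.rpow_two, ← sq_abs, ENNReal.ofReal_pow (abs_nonneg _), Real.enorm_eq_ofReal_abs]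
  simp only [Pi.mul_apply, mul_one, h2, ENNReal.one_rpow, lintegral_one] at h1
  refine h1.trans ?_
  conv_rhs => rw [← mul_one ((∫⁻ ω in S, ENNReal.ofReal (f ω ^ 2) ∂P) ^ (1 / 2 : ℝ))]
  refine mul_le_mul_right ?_ _
  exact ENNReal.rpow_le_one (by rw [Measure.restrict_apply_univ]; exact prob_le_one) (by norm_num)

/-- The event that the path is bounded by `m` up to time `t`. -/
def pathBound (X : ℝ≥0 → Ω → ℝ) (t : ℝ≥0) (m : ℕ) : Set Ω := {ω | ∀ s ≤ t, X s ω ≤ m}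

lemma measurableSet_pathBound (hX : StronglyAdapted ℱ X) (hXc : ∀ ω, Continuous fun t => X t ω)
    (t : ℝ≥0) (m : ℕ) : MeasurableSet (pathBound X t m) := by
  obtain ⟨D, hD, hD'⟩ := TopologicalSpace.exists_countable_dense ℝ≥0
  have e : pathBound X t m = ⋂ q ∈ D, {ω | X (min q t) ω ≤ m} := by
    ext ω
    simp only [pathBound, mem_ofPred_eq, mem_iInter]
    refine ⟨fun h q _ => h _ (min_le_right _ _), fun h s hs => ?_⟩
    have hcl : IsClosed {s | X (min s t) ω ≤ m} :=
      isClosed_le ((hXc ω).comp (continuous_id.min continuous_const)) continuous_const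
    have h1 : s ∈ {s | X (min s t) ω ≤ m} := by
      have := hcl.closure_subset_iff.2 (fun q hq => h q hq)
      rw [hD'.closure_eq] at this
      exact this trivial
    simpa [min_eq_left hs] using h1
  rw [e]
  exact MeasurableSet.biInter hD fun q _ =>
    measurableSet_le (((hX (min q t)).measurable).mono (ℱ.le _) le_rfl) measurable_const

lemma tendsto_measure_compl_pathBound [IsProbabilityMeasure P] (hX : StronglyAdapted ℱ X)
    (hXc : ∀ ω, Continuous fun t => X t ω) (t : ℝ≥0) :
    Tendsto (fun m => P (pathBound X t m)ᶜ) atTop (𝓝 0) := by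
  rw [← measure_empty (μ := P)]
  refine tendsto_measure_of_tendsto_indicator_of_isFiniteMeasure atTop P
    (fun m => (measurableSet_pathBound hX hXc t m).compl) fun ω => ?_
  obtain ⟨M, hM⟩ := exists_path_bound hXc t ω
  filter_upwards [eventually_ge_atTop M] with m hm
  simp only [mem_empty_iff_false, iff_false, mem_compl_iff, not_not]
  exact fun s hs => (hM s hs).trans (by exact_mod_cast hm)

variable [IsProbabilityMeasure P]

/-- The event that the path stays below `m` up to `t` anticipates, so its indicator cannot be put
into the integrand. Restricting to marks `z ≤ m` is predictable, changes nothing on that event, and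
makes the isometry bound finite. -/
lemma setLIntegral_compInt_sub_sq_le (hα0 : 0 < α) (hα1 : α < 1) (hc : 0 < c)
    (h : IsPoissonRandomMeasure P ℱ (intensity α c) N) (hX : StronglyAdapted ℱ X)
    (hXc : ∀ ω, Continuous fun t => X t ω) (hA : IsVolterraKernel α c A) {u t : ℝ≥0}
    (hut : u ≤ t) (m : ℕ) {n k : ℕ} (hnk : n ≤ k) :
    ∫⁻ ω in pathBound X t m, ENNReal.ofReal ((compInt (intensity α c) N (incrApprox X A n u) ω -
      compInt (intensity α c) N (incrApprox X A k u) ω) ^ 2) ∂P ≤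
      ENNReal.ofReal m * kernVar α c (Iic (1 / ((n : ℝ) + 1))) t := by
  set G : (ℝ≥0 × Ω) × (ℝ × ℝ) → ℝ := {p | p.2 ∈ {q : ℝ × ℝ | q.2 ≤ m}}.indicator
    (incrApprox X A n u - incrApprox X A k u) with hG
  have hm2 : MeasurableSet {q : ℝ × ℝ | q.2 ≤ m} := measurableSet_le measurable_snd measurable_const
  have hGp : IsPredictableIntegrand ℱ G :=
    IsPredictableIntegrand.indicator (Measurable.sub (isPredictable_incrApprox hX hXc hA n u)
      (isPredictable_incrApprox hX hXc hA k u)) (measurableSet_predictable_mark hm2)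
  have hGi : ∀ᵐ ω ∂P, Integrable (fun e => G ((e.1, ω), e.2)) (intensity α c) ∧
      Integrable (fun e => G ((e.1, ω), e.2)) (N ω) := by
    filter_upwards [ae_integrable_incrApprox hα0 hα1 hc h hX hXc hA n u,
      ae_integrable_incrApprox hα0 hα1 hc h hX hXc hA k u] with ω h1 h2
    have hs : MeasurableSet {e : ℝ≥0 × ℝ × ℝ | e.2.2 ≤ m} :=
      measurableSet_le (by fun_prop) measurable_const
    exact ⟨(h1.1.sub h2.1).indicator hs, (h1.2.sub h2.2).indicator hs⟩
  have hG0 : ∀ ω ∈ pathBound X t m, ∀ e : ℝ≥0 × ℝ × ℝ, G ((e.1, ω), e.2) =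
      incrApprox X A n u ((e.1, ω), e.2) - incrApprox X A k u ((e.1, ω), e.2) := by
    rintro ω hω ⟨s, y, z⟩
    by_cases hz : z ≤ m
    · exact indicator_of_mem (s := {p : (ℝ≥0 × Ω) × (ℝ × ℝ) | p.2 ∈ {q : ℝ × ℝ | q.2 ≤ m}}) hz _
    · have h0 : ∀ j, incrApprox X A j u ((s, ω), y, z) = 0 := by
        intro j
        have := abs_incrApprox_le hα0 hc hA hut hω (n := j) (s, y, z)
        rw [indicator_of_notMem fun hc => hz hc.2.2.2] at this
        exact abs_nonpos_iff.1 this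
      have h1 : G ((s, ω), y, z) = 0 :=
        indicator_of_notMem (s := {p : (ℝ≥0 × Ω) × (ℝ × ℝ) | p.2 ∈ {q : ℝ × ℝ | q.2 ≤ m}}) hz _
      simp only [h0, h1, sub_zero]
  have hbound : ∀ ω, ∫⁻ e, ENNReal.ofReal (G ((e.1, ω), e.2) ^ 2) ∂(intensity α c) ≤
      ENNReal.ofReal m * kernVar α c (Iic (1 / ((n : ℝ) + 1))) u := by
    intro ω
    refine lintegral_sq_intensity_le hα0 measurableSet_Iic u fun e he hne => ?_
    obtain ⟨s, y, z⟩ := e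
    have hz : z ≤ m := by
      by_contra hz
      exact hne (indicator_of_notMem
        (s := {p : (ℝ≥0 × Ω) × (ℝ × ℝ) | p.2 ∈ {q : ℝ × ℝ | q.2 ≤ m}}) hz _)
    have hGe : G ((s, ω), y, z) =
        incrApprox X A n u ((s, ω), y, z) - incrApprox X A k u ((s, ω), y, z) :=
      indicator_of_mem (s := {p : (ℝ≥0 × Ω) × (ℝ × ℝ) | p.2 ∈ {q : ℝ × ℝ | q.2 ≤ m}}) hz _
    simp only [hGe] at hne ⊢
    have hkn : 1 / ((k : ℝ) + 1) ≤ 1 / ((n : ℝ) + 1) :=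
      one_div_le_one_div_of_le (by positivity) (by have : (n : ℝ) ≤ k := by exact_mod_cast hnk
                                                   linarith)
    rcases le_or_gt y (1 / ((n : ℝ) + 1)) with hy | hy
    · rw [incrApprox_of_le hy, zero_sub] at hne ⊢
      rcases le_or_gt y (1 / ((k : ℝ) + 1)) with hy' | hy'
      · rw [incrApprox_of_le hy'] at hne; simp at hne
      · rw [incrApprox_of_lt hy'] at hne ⊢
        obtain ⟨h1, h2, h3, -⟩ := incrIntegrand_bound hA he (neg_ne_zero.1 hne)
        rw [abs_neg]
        exact ⟨h1, h2, hy, h3, hz⟩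
    · rw [incrApprox_of_lt hy, incrApprox_of_lt (hkn.trans_lt hy), sub_self] at hne
      exact absurd rfl hne
  have hS := measurableSet_pathBound hX hXc t m
  calc _ = ∫⁻ ω in pathBound X t m, ENNReal.ofReal (compInt (intensity α c) N G ω ^ 2) ∂P := by
        refine lintegral_congr_ae ?_
        filter_upwards [ae_restrict_mem hS, ae_restrict_of_ae
          (ae_integrable_incrApprox hα0 hα1 hc h hX hXc hA n u), ae_restrict_of_ae
          (ae_integrable_incrApprox hα0 hα1 hc h hX hXc hA k u)] with ω hω h1 h2
        have e1 := integral_sub h1.1 h2.1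
        have e2 := integral_sub h1.2 h2.2
        congr 2
        unfold compInt
        simp_rw [hG0 ω hω]
        rw [e1, e2]; ring
    _ ≤ ∫⁻ ω, ENNReal.ofReal (compInt (intensity α c) N G ω ^ 2) ∂P :=
        setLIntegral_le_lintegral _ _
    _ ≤ ∫⁻ ω, ∫⁻ e, ENNReal.ofReal (G ((e.1, ω), e.2) ^ 2) ∂(intensity α c) ∂P :=
        h.lintegral_compInt_sq_le (intensity_singleton α c 0) hGp hGi
    _ ≤ ∫⁻ _, ENNReal.ofReal m * kernVar α c (Iic (1 / ((n : ℝ) + 1))) t ∂P := by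
        refine lintegral_mono fun ω => (hbound ω).trans ?_
        exact mul_le_mul_right (kernVar_mono le_rfl (by exact_mod_cast hut)) _
    _ = _ := by simp

/-- Let the larger index tend to infinity along an almost surely convergent subsequence and apply
Fatou. -/
lemma setLIntegral_compInt_sub_limit_sq_le (hα0 : 0 < α) (hα1 : α < 1) (hc : 0 < c)
    (h : IsPoissonRandomMeasure P ℱ (intensity α c) N) (hX : StronglyAdapted ℱ X)
    (hXc : ∀ ω, Continuous fun t => X t ω) (hA : IsVolterraKernel α c A) {u t : ℝ≥0}
    (hut : u ≤ t) (m n : ℕ) {Y : Ω → ℝ}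
    (hY : IsCompensatedIntegral P ℱ (intensity α c) N (incrIntegrand X A u) Y) :
    ∫⁻ ω in pathBound X t m, ENNReal.ofReal ((compInt (intensity α c) N (incrApprox X A n u) ω -
      Y ω) ^ 2) ∂P ≤ ENNReal.ofReal m * kernVar α c (Iic (1 / ((n : ℝ) + 1))) t := by
  obtain ⟨φ, hφ, hφY⟩ :=
    (tendstoInMeasure_compInt_incrApprox hα0 hα1 hc h hX hXc hA hY).exists_seq_tendsto_ae
  have hJ : ∀ j, AEMeasurable (compInt (intensity α c) N (incrApprox X A j u)) P := fun j =>
    (h.aestronglyMeasurable_compInt (isPredictable_incrApprox hX hXc hA j u).measurable).aemeasurable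
  calc _ = ∫⁻ ω in pathBound X t m, liminf (fun k => ENNReal.ofReal
        ((compInt (intensity α c) N (incrApprox X A n u) ω -
          compInt (intensity α c) N (incrApprox X A (φ k) u) ω) ^ 2)) atTop ∂P := by
        refine lintegral_congr_ae ?_
        filter_upwards [ae_restrict_of_ae hφY] with ω hω
        refine (Tendsto.liminf_eq ?_).symm
        exact (ENNReal.continuous_ofReal.tendsto _).comp ((tendsto_const_nhds.sub hω).pow 2)
    _ ≤ liminf (fun k => ∫⁻ ω in pathBound X t m, ENNReal.ofReal
        ((compInt (intensity α c) N (incrApprox X A n u) ω -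
          compInt (intensity α c) N (incrApprox X A (φ k) u) ω) ^ 2) ∂P) atTop :=
        lintegral_liminf_le' fun k =>
          ((((hJ n).sub (hJ (φ k))).pow_const 2).ennreal_ofReal).restrict
    _ ≤ liminf (fun _ : ℕ => ENNReal.ofReal m * kernVar α c (Iic (1 / ((n : ℝ) + 1))) t) atTop := by
        refine liminf_le_liminf ?_
        filter_upwards [eventually_ge_atTop n] with k hk
        exact setLIntegral_compInt_sub_sq_le hα0 hα1 hc h hX hXc hA hut m
          (hk.trans (hφ.id_le k))
    _ = _ := liminf_const _

omit [IsProbabilityMeasure P] in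
-- The kernel version of `N` gives measurability jointly in time and `ω`, with one exceptional null
-- set for all times, as integration in time requires.
lemma exists_measurable_compInt (h : IsPoissonRandomMeasure P ℱ (intensity α c) N)
    (hX : StronglyAdapted ℱ X) (hXc : ∀ ω, Continuous fun t => X t ω)
    (hA : IsVolterraKernel α c A) (n : ℕ) : ∃ J : ℝ≥0 → Ω → ℝ,
      (Measurable fun p : ℝ≥0 × Ω => J p.1 p.2) ∧
      ∀ᵐ ω ∂P, ∀ u, J u ω = compInt (intensity α c) N (incrApprox X A n u) ω := by
  obtain ⟨κ, hκ, hκN⟩ := h.exists_kernel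
  have hm := (measurable_incrApprox_joint hX hXc hA n).stronglyMeasurable
  refine ⟨fun u ω => ∫ e, incrApprox X A n u ((e.1, ω), e.2) ∂(κ ω) -
    ∫ e, incrApprox X A n u ((e.1, ω), e.2) ∂(intensity α c), ?_, ?_⟩
  · refine Measurable.sub ?_ ?_
    · exact (hm.integral_kernel_prod_right' (κ := Kernel.prodMkLeft ℝ≥0 κ)).measurable
    · exact hm.integral_prod_right'.measurable
  · filter_upwards [hκN] with ω hω u
    simp only [hω, compInt]

/-- The convolutions of the approximants converge in probability. -/
lemma tendstoInMeasure_conv_compInt (hα0 : 0 < α) (hα1 : α < 1) (hc : 0 < c)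
    (h : IsPoissonRandomMeasure P ℱ (intensity α c) N) (hX : StronglyAdapted ℱ X)
    (hXc : ∀ ω, Continuous fun t => X t ω) (hA : IsVolterraKernel α c A)
    (hLm : Measurable L) (hLi : ∀ t, IntervalIntegrable L volume 0 t) {Y : ℝ≥0 → Ω → ℝ}
    (hYc : ∀ ω, Continuous fun u => Y u ω) (hYm : ∀ u, Measurable (Y u))
    (hY : ∀ u, IsCompensatedIntegral P ℱ (intensity α c) N (incrIntegrand X A u) (Y u))
    (t : ℝ≥0) :
    TendstoInMeasure P (fun n ω => ∫ s in (0 : ℝ)..t, L (t - s) *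
      (compInt (intensity α c) N (incrApprox X A n s.toNNReal) ω - Y s.toNNReal ω)) atTop
      fun _ => 0 := by
  choose J hJm hJ using exists_measurable_compInt h hX hXc hA
  have hYj : Measurable fun p : ℝ≥0 × Ω => Y p.1 p.2 :=
    measurable_uncurry_of_continuous_of_measurable (u := fun u ω => Y u ω) hYc hYm
  have hLt : IntegrableOn (fun u => L (t - u)) (Ioc (0 : ℝ) t) := by
    have h2 := ((hLi t).symm.comp_sub_left t)
    simp only [sub_self, sub_zero] at h2
    exact (intervalIntegrable_iff_integrableOn_Ioc_of_le t.coe_nonneg).1 h2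
  set CL := ∫⁻ s in Ioc (0 : ℝ) t, ‖L (t - s)‖ₑ with hCL
  have hCL' : CL ≠ ∞ := hLt.2.ne
  let f : ℕ → Ω → ℝ≥0∞ := fun n ω =>
    ∫⁻ s in Ioc (0 : ℝ) t, ‖L (t - s)‖ₑ * ‖J n s.toNNReal ω - Y s.toNNReal ω‖ₑ
  have hfm2 : ∀ n, Measurable fun p : Ω × ℝ =>
      ‖L (t - p.2)‖ₑ * ‖J n p.2.toNNReal p.1 - Y p.2.toNNReal p.1‖ₑ := by
    intro n
    have hp : Measurable fun p : Ω × ℝ => (p.2.toNNReal, p.1) := by fun_prop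
    refine ((hLm.comp (by fun_prop : Measurable fun p : Ω × ℝ => (t : ℝ) - p.2)).enorm).mul ?_
    exact (((hJm n).comp hp).sub (hYj.comp hp)).enorm
  have hfm : ∀ n, Measurable (f n) := fun n => (hfm2 n).lintegral_prod_right'
  -- After Tonelli, each time `s ≤ t` contributes `|L (t - s)|` times an `L¹` error. The `L²` bound
  -- for that error is uniform in `s`.
  have hfb : ∀ n m, ∫⁻ ω in pathBound X t m, f n ω ∂P ≤
      CL * (ENNReal.ofReal m * kernVar α c (Iic (1 / ((n : ℝ) + 1))) t) ^ (1 / 2 : ℝ) := by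
    intro n m
    have hLe : Measurable fun s : ℝ => ‖L (t - s)‖ₑ :=
      (hLm.comp (by fun_prop : Measurable fun s : ℝ => (t : ℝ) - s)).enorm
    rw [lintegral_lintegral_swap (hfm2 n).aemeasurable, hCL, ← lintegral_mul_const _ hLe]
    refine setLIntegral_mono' measurableSet_Ioc fun s hs => ?_
    have hst : s.toNNReal ≤ t := Real.toNNReal_le_iff_le_coe.2 hs.2
    rw [lintegral_const_mul' _ _ (by simp)]
    refine mul_le_mul_right ?_ _
    have hJs : Measurable (J n s.toNNReal) := (hJm n).comp measurable_prodMk_left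
    refine (setLIntegral_enorm_le_sqrt (P := P) _ (hJs.sub (hYm _)).aemeasurable).trans ?_
    refine ENNReal.rpow_le_rpow ?_ (by norm_num)
    refine le_trans (le_of_eq (lintegral_congr_ae ?_))
      (setLIntegral_compInt_sub_limit_sq_le hα0 hα1 hc h hX hXc hA hst m n (hY s.toNNReal))
    filter_upwards [ae_restrict_of_ae (hJ n)] with ω hω
    simp only [Pi.sub_apply, hω]
  rw [tendstoInMeasure_iff_norm]
  intro δ hδ
  simp only [sub_zero]
  rw [ENNReal.tendsto_nhds_zero]
  intro ε hε
  have hε2 : 0 < ε / 2 := ENNReal.half_pos hε.ne'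
  obtain ⟨m, hm⟩ := ((ENNReal.tendsto_nhds_zero.1
    (tendsto_measure_compl_pathBound (P := P) hX hXc t)) _ hε2).exists
  have hδ' : ENNReal.ofReal δ ≠ 0 := by simpa using hδ
  have hlim : Tendsto (fun n : ℕ => CL * (ENNReal.ofReal m *
      kernVar α c (Iic (1 / ((n : ℝ) + 1))) t) ^ (1 / 2 : ℝ) / ENNReal.ofReal δ) atTop (𝓝 0) := by
    have h1 := ENNReal.Tendsto.const_mul (a := ENNReal.ofReal m) (tendsto_kernVar hα0 hα1 hc t)
      (Or.inr ENNReal.ofReal_ne_top)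
    have h2 := ((ENNReal.continuous_rpow_const (y := 1 / 2)).tendsto _).comp h1
    have h3 := ENNReal.Tendsto.const_mul (a := CL) h2 (Or.inr hCL')
    have h4 := ENNReal.Tendsto.div_const h3 (Or.inr hδ')
    simpa [Function.comp_def] using h4
  filter_upwards [(ENNReal.tendsto_nhds_zero.1 hlim) _ hε2] with n hn
  have hS := measurableSet_pathBound hX hXc t m
  have hsub : ∀ᵐ ω ∂P, δ ≤ ‖∫ s in (0 : ℝ)..t, L (t - s) *
      (compInt (intensity α c) N (incrApprox X A n s.toNNReal) ω - Y s.toNNReal ω)‖ →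
      ω ∈ (pathBound X t m)ᶜ ∪ {ω | ENNReal.ofReal δ ≤ f n ω} ∩ pathBound X t m := by
    filter_upwards [hJ n] with ω hω hδω
    by_cases hb : ω ∈ pathBound X t m
    · refine Or.inr ⟨?_, hb⟩
      simp only [mem_ofPred_eq]
      refine (ENNReal.ofReal_le_ofReal hδω).trans ?_
      rw [ofReal_norm, intervalIntegral.integral_of_le t.coe_nonneg]
      refine (enorm_integral_le_lintegral_enorm _).trans (le_of_eq ?_)
      refine lintegral_congr fun s => ?_
      rw [enorm_mul, hω]
    · exact Or.inl hb
  refine (measure_mono_ae hsub).trans ((measure_union_le _ _).trans ?_)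
  refine le_trans (add_le_add hm (le_trans ?_ hn)) (ENNReal.add_halves ε).le
  rw [← Measure.restrict_apply (measurableSet_le measurable_const (hfm n))]
  exact (meas_ge_le_lintegral_div (hfm n).aemeasurable hδ' ENNReal.ofReal_ne_top).trans
    (ENNReal.div_le_div_right (hfb n m) _)

/-- The stochastic Fubini theorem for convolutions of compensated Volterra integrals. -/
theorem isCompensatedIntegral_conv (hα0 : 0 < α) (hα1 : α < 1) (hc : 0 < c)
    (h : IsPoissonRandomMeasure P ℱ (intensity α c) N) (hX : StronglyAdapted ℱ X)
    (hXc : ∀ ω, Continuous fun t => X t ω) (hA : IsVolterraKernel α c A)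
    (hA' : IsVolterraKernel α c A')
    (hLm : Measurable L) (hLi : ∀ t, IntervalIntegrable L volume 0 t)
    (hAA : ∀ x, 0 ≤ x → A' x = A x + β * conv L A x) {Y : ℝ≥0 → Ω → ℝ}
    (hYc : ∀ ω, Continuous fun u => Y u ω) (hYm : ∀ u, Measurable (Y u))
    (hY : ∀ u, IsCompensatedIntegral P ℱ (intensity α c) N (incrIntegrand X A u) (Y u))
    (t : ℝ≥0) :
    IsCompensatedIntegral P ℱ (intensity α c) N (incrIntegrand X A' t)
      (fun ω => Y t ω + β * conv L (fun s => Y s.toNNReal ω) t) := by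
  -- With `J n` and `J' n` the approximants for `A` and `A'`, the pathwise identity reads `J' n = J
  -- n + β L * (J n - Y) + β L * Y`. The first term converges to `Y t`, the second to zero.
  refine isCompensatedIntegral_of_tendsto hα0 hα1 hc h hX hXc hA' ?_
  have h1 := tendstoInMeasure_compInt_incrApprox hα0 hα1 hc h hX hXc hA (hY t)
  have h2 := tendstoInMeasure_conv_compInt hα0 hα1 hc h hX hXc hA (hLm.const_mul β)
    (fun t => (hLi t).const_mul β) hYc hYm hY t
  have h3 := tendstoInMeasure_add h1 h2
  have h4 : TendstoInMeasure P (fun (_ : ℕ) ω => β * conv L (fun s => Y s.toNNReal ω) t) atTop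
      fun ω => β * conv L (fun s => Y s.toNNReal ω) t := by
    intro ε hε
    simp [hε.ne']
  refine (tendstoInMeasure_add h3 h4).congr (fun n => ?_)
    (Eventually.of_forall fun ω => by simp)
  filter_upwards [ae_largeJumps_lt_top hα0 hα1 hc h t] with ω hω
  obtain ⟨M, hM⟩ := exists_path_bound hXc t ω
  obtain ⟨i1, e1⟩ := integral_incrApprox_conv hα0 hc hX hXc hA hA' hLm hLi hAA hM (hω n M)
  obtain ⟨i2, e2⟩ := integral_incrApprox_conv hα0 hc hX hXc hA hA' hLm hLi hAA hM
    (intensity_largeJumps_lt_top hα0 hα1 hc t (δ := 1 / ((n : ℝ) + 1)) (by positivity) M)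
  have i3 : IntervalIntegrable (fun s => L (t - s) * Y s.toNNReal ω) volume 0 t := by
    have h2 := ((hLi t).symm.comp_sub_left t)
    simp only [sub_self, sub_zero] at h2
    exact h2.mul_continuousOn ((hYc ω).comp continuous_real_toNNReal).continuousOn
  have e3 : ∫ s in (0 : ℝ)..t, β * L (t - s) *
      (compInt (intensity α c) N (incrApprox X A n s.toNNReal) ω - Y s.toNNReal ω) =
      β * ((∫ s in (0 : ℝ)..t, L (t - s) *
        ∫ e, incrApprox X A n s.toNNReal ((e.1, ω), e.2) ∂(N ω)) -
      (∫ s in (0 : ℝ)..t, L (t - s) *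
        ∫ e, incrApprox X A n s.toNNReal ((e.1, ω), e.2) ∂(intensity α c)) -
      ∫ s in (0 : ℝ)..t, L (t - s) * Y s.toNNReal ω) := by
    rw [← intervalIntegral.integral_sub i1 i2, ← intervalIntegral.integral_sub (i1.sub i2) i3,
      ← intervalIntegral.integral_const_mul]
    refine intervalIntegral.integral_congr fun s _ => ?_
    simp only [compInt]
    ring
  simp only [e3, conv, smul_eq_mul]
  simp only [compInt] at e1 e2 ⊢
  rw [e1, e2]
  ring

end StochasticFubini

/-! ### The stochastic equations -/

section StochasticVolterra

variable {Ω : Type u} {X : ℝ≥0 → Ω → ℝ} {α b c : ℝ} {W : ℝ → ℝ} {ζ : Ω → ℝ}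
  [mΩ : MeasurableSpace Ω] {P : Measure Ω} {ℱ : Filtration ℝ≥0 mΩ}
  {N : Ω → Measure (ℝ≥0 × ℝ × ℝ)}

lemma IsCompensatedIntegral.congr {μ : Measure (ℝ≥0 × ℝ × ℝ)}
    {H : (ℝ≥0 × Ω) × (ℝ × ℝ) → ℝ} {Y Y' : Ω → ℝ} (h : IsCompensatedIntegral P ℱ μ N H Y)
    (hY : Y =ᵐ[P] Y') : IsCompensatedIntegral P ℱ μ N H Y' := by
  refine ⟨h.predictable, h.sq_finite, ?_⟩
  obtain ⟨Hn, h1, h2, h3, h4⟩ := h.exists_approx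
  exact ⟨Hn, h1, h2, h3, h4.congr_right hY⟩

lemma IsScaleFunction.isVolterraKernel (hα0 : 0 < α) (hb : 0 ≤ b) (hc : 0 < c)
    (hW : IsScaleFunction α b c W) : IsVolterraKernel α c W where
  continuous := hW.continuous hα0 hb hc
  eq_zero x hx := by
    rcases hx.eq_or_lt with rfl | hx
    · exact hW.map_zero hα0 hb hc
    · exact hW.zero_of_neg x hx
  abs_sub_le x y hx hxy := by
    rw [abs_of_nonneg (sub_nonneg.2 (hW.monotone hα0 hb hc hxy))]
    exact hW.sub_le hα0 hb hc hx hxy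

/-- The primitive of the kernel, extended by zero to the negative half line. -/
def kernIntExt (α c x : ℝ) : ℝ := kernInt α c (max x 0)

lemma kernIntExt_of_nonneg {x : ℝ} (hx : 0 ≤ x) : kernIntExt α c x = kernInt α c x := by
  rw [kernIntExt, max_eq_left hx]

lemma isVolterraKernel_kernIntExt (hα0 : 0 < α) (hc : 0 < c) :
    IsVolterraKernel α c (kernIntExt α c) where
  continuous := (kernInt_continuous hα0).comp (continuous_id.max continuous_const)
  eq_zero x hx := by rw [kernIntExt, max_eq_right hx, kernInt_zero]
  abs_sub_le x y hx hxy := by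
    rw [kernIntExt_of_nonneg hx, kernIntExt_of_nonneg (hx.trans hxy),
      abs_of_nonneg (sub_nonneg.2 (kernInt_mono hα0 hc hx hxy))]

omit mΩ in
lemma volterraIntegrand_kern (hα0 : 0 < α) (t : ℝ≥0) :
    volterraIntegrand X
      (fun r y => ∫ x in (max (r - y) 0)..r, x ^ (α - 1) / (c * Real.Gamma α)) t =
      incrIntegrand X (kernIntExt α c) t := by
  refine indicator_congr fun p hp => ?_
  have hr : (0 : ℝ) ≤ t - p.1.1 := sub_nonneg.2 (by exact_mod_cast hp.1)
  simp only
  rw [kernIntExt_of_nonneg hr, kernIntExt, kernInt, kernInt,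
    intervalIntegral.integral_interval_sub_left (kern_intervalIntegrable hα0 _ _)
      (kern_intervalIntegrable hα0 _ _)]
  rfl

lemma continuous_conv_kern (hα0 : 0 < α) (hc : 0 < c) {x : ℝ≥0 → ℝ} (hx : Continuous x) :
    Continuous fun t : ℝ≥0 => conv (kern α c) (fun s => x s.toNNReal) t := by
  have hh : Continuous fun s : ℝ => x s.toNNReal := hx.comp continuous_real_toNNReal
  have h1 := conv_continuousOn (kern_continuousOn (α := α) (c := c))
    (fun T _ => kern_intervalIntegrable hα0 _ _) (fun T _ => hh.intervalIntegrable 0 T)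
    (fun δ hδ T => bounded_of_continuousOn_Ioi hh.continuousOn hδ T)
  rw [continuous_iff_continuousAt]
  intro t
  -- The general continuity result covers only positive times; at `0` the convolution is squeezed by
  -- a multiple of `K`.
  rcases eq_or_ne t 0 with rfl | ht
  · obtain ⟨M, hM⟩ := isCompact_Icc.exists_bound_of_continuousOn
      (hh.continuousOn (s := Icc (0 : ℝ) 1))
    have hM0 : 0 ≤ M := (norm_nonneg _).trans (hM 0 (by simp))
    rw [ContinuousAt]
    have e0 : conv (kern α c) (fun s => x s.toNNReal) ((0 : ℝ≥0) : ℝ) = 0 := by simp [conv]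
    rw [e0]
    have hlim : Tendsto (fun t : ℝ≥0 => M * kernInt α c t) (𝓝 0) (𝓝 0) := by
      have h2 : Continuous fun t : ℝ≥0 => M * kernInt α c t :=
        continuous_const.mul ((kernInt_continuous hα0).comp NNReal.continuous_coe)
      simpa [kernInt_zero] using h2.tendsto 0
    refine squeeze_zero_norm' ?_ hlim
    filter_upwards [Iic_mem_nhds (zero_lt_one' ℝ≥0)] with t ht
    rw [conv_eq_integral_comp_sub, kernInt, ← intervalIntegral.integral_const_mul]
    refine intervalIntegral.norm_integral_le_of_norm_le t.coe_nonneg ?_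
      ((kern_intervalIntegrable hα0 _ _).const_mul M)
    refine Eventually.of_forall fun s hs => ?_
    have ht1 : (t : ℝ) ≤ 1 := by exact_mod_cast ht
    rw [smul_eq_mul, norm_mul, mul_comm, Real.norm_of_nonneg (kern_pos hα0 hc hs.1).le]
    exact mul_le_mul_of_nonneg_right (hM _ ⟨by linarith [hs.2], by linarith [hs.1]⟩)
      (kern_pos hα0 hc hs.1).le
  · have ht0 : (0 : ℝ) < t := NNReal.coe_pos.2 (pos_iff_ne_zero.2 ht)
    exact ContinuousAt.comp (f := fun t : ℝ≥0 => (t : ℝ))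
      (h1.continuousAt (Ioi_mem_nhds ht0)) NNReal.continuous_coe.continuousAt

lemma measurable_conv_path {L : ℝ → ℝ} (hLm : Measurable L) (hX : ∀ t, Measurable (X t))
    (hXc : ∀ ω, Continuous fun t => X t ω) (t : ℝ≥0) :
    Measurable fun ω => conv L (fun s => X s.toNNReal ω) t := by
  have hj : Measurable fun p : ℝ≥0 × Ω => X p.1 p.2 :=
    measurable_uncurry_of_continuous_of_measurable (u := fun u ω => X u ω) hXc hX
  have hp : Measurable fun p : Ω × ℝ => (p.2.toNNReal, p.1) := by fun_prop
  simp only [conv, intervalIntegral.integral_of_le t.coe_nonneg, smul_eq_mul]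
  have hm : Measurable fun p : Ω × ℝ => L (t - p.2) * X p.2.toNNReal p.1 :=
    (hLm.comp (by fun_prop : Measurable fun p : Ω × ℝ => (t : ℝ) - p.2)).mul (hj.comp hp)
  exact (hm.stronglyMeasurable.integral_prod_right' (ν := volume.restrict (Ioc (0 : ℝ) t))).measurable

namespace IsScaleFunction

lemma deriv_intervalIntegrable_of_real (hα0 : 0 < α) (hb : 0 ≤ b) (hc : 0 < c)
    (hW : IsScaleFunction α b c W) (t : ℝ) : IntervalIntegrable (deriv W) volume 0 t := by
  rcases le_total 0 t with ht | ht
  · exact hW.deriv_intervalIntegrable hα0 hb hc ht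
  · refine (intervalIntegrable_const (c := (0 : ℝ))).congr_ae ?_
    rw [uIoc_of_ge ht, ← restrict_Ioo_eq_restrict_Ioc]
    filter_upwards [ae_restrict_mem measurableSet_Ioo] with s hs
    have : W =ᶠ[𝓝 s] fun _ => 0 := by
      filter_upwards [Iio_mem_nhds hs.2] with x hx using hW.zero_of_neg x hx
    rw [this.deriv_eq, deriv_const]

/-- The resolvent equation says `k * (1 - b W) = K - b (k * W) = W`. -/
lemma conv_kern_sub (hα0 : 0 < α) (hb : 0 ≤ b) (hc : 0 < c) (hW : IsScaleFunction α b c W)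
    {f : ℝ → ℝ} (hf : Continuous f) (z : ℝ) {t : ℝ} (ht : 0 ≤ t) :
    conv (kern α c) (fun s => f s - z * (1 - b * W s)) t = conv (kern α c) f t - z * W t := by
  have hk : IntervalIntegrable (fun s => kern α c (t - s)) volume 0 t := by
    have := ((kern_intervalIntegrable (c := c) hα0 0 t).comp_sub_left t).symm
    simpa using this
  have hi : ∀ {g : ℝ → ℝ}, Continuous g →
      IntervalIntegrable (fun s => kern α c (t - s) * g s) volume 0 t := fun hg =>
    hk.mul_continuousOn hg.continuousOn
  have h1 : conv (kern α c) (fun s => f s - z * (1 - b * W s)) t = conv (kern α c) f t -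
      z * (conv (kern α c) (fun _ => (1 : ℝ)) t - b * conv (kern α c) W t) := by
    simp only [conv, smul_eq_mul]
    rw [← intervalIntegral.integral_const_mul, ← intervalIntegral.integral_sub
      (hi continuous_const) ((hi (hW.continuous hα0 hb hc)).const_mul b),
      ← intervalIntegral.integral_const_mul, ← intervalIntegral.integral_sub (hi hf)
      (((hi continuous_const).sub ((hi (hW.continuous hα0 hb hc)).const_mul b)).const_mul z)]
    refine intervalIntegral.integral_congr fun s _ => ?_
    ring
  rw [h1, conv_kern_one, ← hW.resolvent hα0 hb hc ht]
  ring

/-- Associativity and `b (W' * k) = k - W'`. The general `conv_assoc` is used, because `W' * k`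
behaves like `t ^ (2 * α - 1)` at `0` and is only integrable in general. -/
lemma conv_deriv_conv_kern (hα0 : 0 < α) (hb : 0 ≤ b) (hc : 0 < c) (hW : IsScaleFunction α b c W)
    {f : ℝ → ℝ} (hf : Continuous f) {t : ℝ} (ht : 0 ≤ t) :
    b * conv (deriv W) (conv (kern α c) f) t = conv (kern α c) f t - conv (deriv W) f t := by
  have hR : ∀ {r : ℝ}, 0 < r →
      IntervalIntegrable (fun w => deriv W (r - w) * kern α c w) volume 0 r := fun hr =>
    conv_intervalIntegrable hr (hW.deriv_continuousOn hα0 hb hc)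
      (hW.deriv_intervalIntegrable hα0 hb hc hr.le) (kern_intervalIntegrable hα0 _ _)
      (fun δ hδ => bounded_of_continuousOn_Ioi kern_continuousOn hδ _)
  have h1 : conv (deriv W) (conv (kern α c) f) t = conv (conv (deriv W) (kern α c)) f t := by
    refine conv_assoc ht (measurable_deriv W) measurable_kern
      hf.aestronglyMeasurable (fun r hr => hR hr.1) ?_
    have h2 : IntervalIntegrable (fun u => conv (kern α c) (deriv W) (t - u)) volume 0 t := by
      have := ((hW.conv_kern_deriv_intervalIntegrable hα0 hb hc ht).comp_sub_left t).symm
      simpa using this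
    have h3 := (intervalIntegrable_iff_integrableOn_Ioc_of_le ht).1
      (h2.mul_continuousOn hf.norm.continuousOn)
    refine h3.congr_fun (fun u hu => ?_) measurableSet_Ioc
    simp only
    congr 1
    rw [conv_comm, conv]
    refine intervalIntegral.integral_congr_ae (Eventually.of_forall fun w hw => ?_)
    rw [uIoc_of_le (sub_nonneg.2 hu.2)] at hw
    rw [smul_eq_mul, Real.norm_of_nonneg
      (mul_nonneg (hW.deriv_nonneg hα0 hb hc _) (kern_pos hα0 hc hw.1).le)]
  have hi : ∀ {g : ℝ → ℝ}, IntervalIntegrable g volume 0 t →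
      IntervalIntegrable (fun s => g (t - s) * f s) volume 0 t := fun hg => by
    have := (hg.comp_sub_left t).symm
    simp only [sub_self, sub_zero] at this
    exact this.mul_continuousOn hf.continuousOn
  rw [h1]
  have h4 : conv (fun s => kern α c s - deriv W s) f t =
      conv (fun s => b * conv (deriv W) (kern α c) s) f t :=
    conv_congr ht (fun s hs => by rw [hW.deriv_eq hα0 hb hc hs.1, conv_comm]; ring)
      (Eventually.of_forall fun _ _ => rfl)
  simp only [conv, smul_eq_mul] at h4 ⊢
  rw [← intervalIntegral.integral_sub (hi (kern_intervalIntegrable hα0 _ _))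
    (hi (hW.deriv_intervalIntegrable hα0 hb hc ht)), ← intervalIntegral.integral_const_mul]
  simp only [sub_mul, mul_assoc] at h4 ⊢
  exact h4.symm

/-- `b W'` is the resolvent of `b k`: from `f + b (k * f) = z + Z` follows `f = (z + Z) - b (W' * (z
+ Z))`, and `W' * 1 = W`. -/
lemma eq_of_conv_kern (hα0 : 0 < α) (hb : 0 ≤ b) (hc : 0 < c) (hW : IsScaleFunction α b c W)
    {f Z : ℝ → ℝ} (hf : Continuous f) {z : ℝ} {t : ℝ} (ht : 0 ≤ t)
    (hk : Continuous fun s : ℝ≥0 => conv (kern α c) f s)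
    (hZ : ∀ s, 0 ≤ s → Z s = f s - z + b * conv (kern α c) f s) :
    f t = z * (1 - b * W t) + (Z t - b * conv (deriv W) Z t) := by
  have hi : ∀ {g : ℝ → ℝ}, ContinuousOn g (Icc 0 t) →
      IntervalIntegrable (fun s => deriv W (t - s) * g s) volume 0 t := fun hg => by
    have := ((hW.deriv_intervalIntegrable hα0 hb hc ht).comp_sub_left t).symm
    simp only [sub_self, sub_zero] at this
    exact this.mul_continuousOn (by rwa [uIcc_of_le ht])
  have hk' : ContinuousOn (conv (kern α c) f) (Icc 0 t) := by
    refine ((hk.comp continuous_real_toNNReal).continuousOn).congr fun s hs => ?_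
    simp [Real.coe_toNNReal _ hs.1]
  have h1 : conv (deriv W) Z t = conv (deriv W) f t - z * conv (deriv W) (fun _ => (1 : ℝ)) t +
      b * conv (deriv W) (conv (kern α c) f) t := by
    rw [conv_congr (f' := deriv W) ht (fun _ _ => rfl)
      (Eventually.of_forall fun s hs => hZ s hs.1.le)]
    rw [conv, conv, conv, conv]
    simp only [smul_eq_mul]
    rw [← intervalIntegral.integral_const_mul, ← intervalIntegral.integral_const_mul,
      ← intervalIntegral.integral_sub (hi hf.continuousOn)
        ((hi continuousOn_const).const_mul z),
      ← intervalIntegral.integral_add ((hi hf.continuousOn).sub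
        ((hi continuousOn_const).const_mul z)) ((hi hk').const_mul b)]
    refine intervalIntegral.integral_congr fun s _ => ?_
    ring
  rw [h1, hW.conv_deriv_conv_kern hα0 hb hc hf ht, conv_comm (deriv W) (fun _ => 1),
    conv_one_left, hW.integral_deriv hα0 hb hc ht, hZ t ht]
  ring

end IsScaleFunction

variable [IsProbabilityMeasure P]

/-- A solution of the stochastic Volterra equation solves its fractional form. -/
theorem SolvesSVE.solvesFractionalSVE (hα0 : 0 < α) (hα1 : α < 1) (hb : 0 ≤ b) (hc : 0 < c)
    (hW : IsScaleFunction α b c W) (hN : IsPoissonRandomMeasure P ℱ (intensity α c) N)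
    (hζ : Measurable ζ) (h : SolvesSVE α b c W P ℱ N ζ X) :
    SolvesFractionalSVE α b c P ℱ N ζ X := by
  have hXm : ∀ t, Measurable (X t) := fun t => (h.adapted t).measurable.mono (ℱ.le t) le_rfl
  have hWc := hW.continuous hα0 hb hc
  refine ⟨h.adapted, h.continuous, fun t => ?_⟩
  rw [volterraIntegrand_kern hα0 t]
  -- Solving the equation for the stochastic integral yields a version continuous in time, which the
  -- Fubini theorem needs.
  set Y : ℝ≥0 → Ω → ℝ := fun t ω => X t ω - ζ ω * (1 - b * W t) with hY
  have hYI : ∀ u, IsCompensatedIntegral P ℱ (intensity α c) N (incrIntegrand X W u) (Y u) := by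
    intro u
    obtain ⟨Y', h1, h2⟩ := h.equation u
    refine h1.congr ?_
    filter_upwards [h2] with ω hω
    rw [hY]; simp only [hω]; ring
  have hres := isCompensatedIntegral_conv (β := b) (Y := Y) (L := kern α c) hα0 hα1 hc hN h.adapted
    h.continuous (hW.isVolterraKernel hα0 hb hc) (isVolterraKernel_kernIntExt hα0 hc)
    measurable_kern (fun t => kern_intervalIntegrable hα0 0 t)
    (fun x hx => by rw [kernIntExt_of_nonneg hx, hW.resolvent hα0 hb hc hx])
    (fun ω => (h.continuous ω).sub (continuous_const.mul (continuous_const.sub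
      (continuous_const.mul (hWc.comp NNReal.continuous_coe)))))
    (fun u => (hXm u).sub (hζ.mul_const _)) hYI t
  refine ⟨_, hres, Eventually.of_forall fun ω => ?_⟩
  have hc1 : Continuous fun s : ℝ => X s.toNNReal ω :=
    (h.continuous ω).comp continuous_real_toNNReal
  have e1 : conv (kern α c) (fun s => Y s.toNNReal ω) t =
      conv (kern α c) (fun s => X s.toNNReal ω) t - ζ ω * W t := by
    rw [← hW.conv_kern_sub hα0 hb hc hc1 (ζ ω) t.coe_nonneg]
    refine conv_congr t.coe_nonneg (fun _ _ => rfl) (Eventually.of_forall fun s hs => ?_)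
    simp only [hY, Real.coe_toNNReal _ hs.1.le]
  have e2 : ∫ s in (0 : ℝ)..t, ((t : ℝ) - s) ^ (α - 1) / (c * Real.Gamma α) * X s.toNNReal ω =
      conv (kern α c) (fun s => X s.toNNReal ω) t := rfl
  rw [e1, e2]
  simp only [hY]
  ring

/-- A solution of the fractional form solves the stochastic Volterra equation. -/
theorem SolvesFractionalSVE.solvesSVE (hα0 : 0 < α) (hα1 : α < 1) (hb : 0 ≤ b) (hc : 0 < c)
    (hW : IsScaleFunction α b c W) (hN : IsPoissonRandomMeasure P ℱ (intensity α c) N)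
    (hζ : Measurable ζ) (h : SolvesFractionalSVE α b c P ℱ N ζ X) :
    SolvesSVE α b c W P ℱ N ζ X := by
  have hXm : ∀ t, Measurable (X t) := fun t => (h.adapted t).measurable.mono (ℱ.le t) le_rfl
  refine ⟨h.adapted, h.continuous, fun t => ?_⟩
  set Z : ℝ≥0 → Ω → ℝ :=
    fun t ω => X t ω - ζ ω + b * conv (kern α c) (fun s => X s.toNNReal ω) t with hZ
  have hZI : ∀ u, IsCompensatedIntegral P ℱ (intensity α c) N
      (incrIntegrand X (kernIntExt α c) u) (Z u) := by
    intro u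
    obtain ⟨Y', h1, h2⟩ := h.equation u
    rw [volterraIntegrand_kern hα0 u] at h1
    refine h1.congr ?_
    filter_upwards [h2] with ω hω
    have e2 : ∫ s in (0 : ℝ)..u, ((u : ℝ) - s) ^ (α - 1) / (c * Real.Gamma α) * X s.toNNReal ω =
        conv (kern α c) (fun s => X s.toNNReal ω) u := rfl
    rw [e2] at hω
    rw [hZ]; simp only [hω]; ring
  -- Here `W = K - b (W' * K)`, because `W' * K = k * W`.
  have hres := isCompensatedIntegral_conv (β := -b) (Y := Z) (L := deriv W) hα0 hα1 hc hN h.adapted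
    h.continuous (isVolterraKernel_kernIntExt hα0 hc) (hW.isVolterraKernel hα0 hb hc)
    (measurable_deriv W) (hW.deriv_intervalIntegrable_of_real hα0 hb hc)
    (fun x hx => by
      have e : conv (deriv W) (kernIntExt α c) x = conv (kern α c) W x := by
        rw [← hW.conv_deriv_kernInt hα0 hb hc hx]
        exact conv_congr hx (fun _ _ => rfl)
          (Eventually.of_forall fun s hs => kernIntExt_of_nonneg hs.1.le)
      rw [e, kernIntExt_of_nonneg hx, ← hW.resolvent hα0 hb hc hx]; ring)
    (fun ω => ((h.continuous ω).sub continuous_const).add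
      (continuous_const.mul (continuous_conv_kern hα0 hc (h.continuous ω))))
    (fun u => ((hXm u).sub hζ).add
      ((measurable_conv_path measurable_kern hXm h.continuous u).const_mul b)) hZI t
  refine ⟨_, hres, Eventually.of_forall fun ω => ?_⟩
  have hc1 : Continuous fun s : ℝ => X s.toNNReal ω :=
    (h.continuous ω).comp continuous_real_toNNReal
  have := hW.eq_of_conv_kern hα0 hb hc hc1 (z := ζ ω) t.coe_nonneg
    (continuous_conv_kern hα0 hc (h.continuous ω)) (Z := fun s => Z s.toNNReal ω)
    (fun s hs => by simp only [hZ, Real.coe_toNNReal _ hs])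
  simp only [Real.toNNReal_coe] at this
  rw [this]
  ring

end StochasticVolterra

end RoughBranching

end

/-! ### Both equivalences assembled -/

theorem theorem1p4 (α b c : ℝ) (hα0 : 0 < α) (hα1 : α < 1) (hb : 0 ≤ b) (hc : 0 < c)
    (W : ℝ → ℝ) (hW : IsScaleFunction α b c W) :
    (∀ (Ω : Type u) [mΩ : MeasurableSpace Ω] (P : Measure Ω) [IsProbabilityMeasure P]
      (ℱ : Filtration ℝ≥0 mΩ) (N : Ω → Measure (ℝ≥0 × ℝ × ℝ)),
      IsPoissonRandomMeasure P ℱ (intensity α c) N →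
      ∀ ζ : Ω → ℝ, Measurable[ℱ 0] ζ → (∀ᵐ ω ∂P, 0 < ζ ω) →
      ∀ X : ℝ≥0 → Ω → ℝ,
        SolvesSVE α b c W P ℱ N ζ X ↔ SolvesFractionalSVE α b c P ℱ N ζ X) ∧
    (∀ (lam : ℂ) (g : ℝ → ℂ), lam.re ≤ 0 → Measurable g →
      (∃ M : ℝ, ∀ t ≥ 0, ‖g t‖ ≤ M) → (∀ t ≥ 0, (g t).re ≤ 0) →
      ∀ v : ℝ → ℂ,
        (SolvesVolterra α c W lam g v ↔ SolvesFractionalRiccati α b c lam g v) ∧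
        (SolvesVolterra α c W lam g v → ∀ t > 0, ContinuousAt g t →
          DifferentiableAt ℝ (rlIntegral (1 - α) (1 / c) v) t ∧
          rlDeriv α c v t = -(b : ℂ) * v t + g t + opV α c v t)) := by
  refine ⟨fun Ω _ P _ ℱ N hN ζ hζ _ X => ?_, fun lam g _ hg hgb _ v => ⟨?_, ?_⟩⟩
  · have hζ' : Measurable ζ := hζ.mono (ℱ.le 0) le_rfl
    exact ⟨fun h => h.solvesFractionalSVE hα0 hα1 hb hc hW hN hζ',
      fun h => h.solvesSVE hα0 hα1 hb hc hW hN hζ'⟩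
  · exact solvesVolterra_iff_solvesFractionalRiccati hα0 hα1 hb hc hW hg hgb
  · exact fun h t ht hgt => h.differentiableAt hα0 hα1 hb hc hW hg hgb ht hgt
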